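/- Let $\sigma_1,\sigma_2\in L_{2,loc}(\mathbb R)$ and $\tau_1,\tau_2\in L_{1,loc}(\mathbb R)$ be real-valued $1$-periodic functions, let $\alpha,\theta\in[0,1)$, and consider the real-valued distribution $$q(t)=\sigma_1'(t)+\sigma_2'(\alpha t+\theta)+\tau_1(t)+\tau_2(\alpha t+\theta),$$ where $'$ is the distributional derivative and $\sigma_2'(\alpha t+\theta)$ is the composition of the distribution $\sigma_2'$ with the affine map $t\mapsto\alpha t+\theta$. Suppose that $\alpha$ is a Liouville number in the following sense: $\alpha$ is irrational and there are a constant $C$ and rationals $R_m/T_m$ ($R_m\in\mathbb Z$, $T_m\in\mathbb N$, $T_m\ge1$) with $|\alpha-R_m/T_m|\le C\,m^{-T_m}$ for all $m\ge1$. Suppose also that $\sigma_2\in W^s_{2,loc}(\mathbb R)$ for some $s>0$. Then $q$ is a singular Gordon potential: there are real-valued $\sigma,\tau$ with $q=\sigma'+\tau$ and $$\sup_t\int_t^{t+1}|\sigma|^2<\infty\quad(\sigma\in L_{2,unif}(\mathbb R)),\qquad \sup_t\int_t^{t+1}|\tau|<\infty\quad(\tau\in L_{1,unif}(\mathbb R)),$$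 numbers $P_m>0$ with $P_m\to\infty$, and real-valued $P_m$-periodic functions $\sigma_m\in L_{2,unif}(\mathbb R)$, $\tau_m\in L_{1,unif}(\mathbb R)$ (here $\sigma_m,\tau_m$ denote the members of these sequences, not the given functions), such that for every $C<\infty$ $$\lim_{m\to\infty}e^{CP_m}\Bigl\{\|\sigma-\sigma_m\|_{L_2[-P_m,2P_m]}+\|\tau-\tau_m\|_{L_1[-P_m,2P_m]}\Bigr\}=0.$$ Consequently the Schrödinger operator $S=-\frac{d^2}{dt^2}+q$ in $L_2(\mathbb R)$ has empty point spectrum (no eigenvalues). Here, for any decomposition $q=\sigma'+\tau$ with real-valued $\sigma\in L_{2,unif}(\mathbb R)$ and $\tau\in L_{1,unif}(\mathbb R)$, $Sf=l(f):=-(f'-\sigma f)'-\sigma f'+\tau f$ on the domain of all $f\in W^1_2(\mathbb R)$ with $f'-\sigma f\in W^1_{1,loc}(\mathbb R)$ and $l(f)\in L_2(\mathbb R)$; $S$ does not depend on the choice of the decomposition. -/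

import Mathlib

open MeasureTheory Filter Topology TopologicalSpace
open scoped Distributions LineDeriv ENNReal SchwartzMap

namespace SingularGordon

/-- Real-valued test functions on the line. -/
abbrev Test : Type := 𝓓((⊤ : Opens ℝ), ℝ)

/-- Real-valued distributions on the line. -/
abbrev Distr : Type := 𝓓'((⊤ : Opens ℝ), ℝ)

/-! ### Distributions -/

/-- The regular distribution `ψ ↦ ∫ ψ f` of a locally integrable function `f`. -/
noncomputable def ofFun (f : ℝ → ℝ) : Distr :=
  (TestFunction.integralAgainstBilinCLM (ContinuousLinearMap.mul ℝ ℝ) volume f :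
    Test →L[ℝ] ℝ)

/-- The distributional derivative, `⟨T', ψ⟩ = -⟨T, ψ'⟩`. -/
noncomputable def distDeriv (T : Distr) : Distr := ∂_{(1 : ℝ)} T

lemma iteratedFDeriv_comp_affine_norm (f : ℝ → ℝ) (a b : ℝ) (i : ℕ)
    (hf : ContDiff ℝ i f) (x : ℝ) :
    ‖iteratedFDeriv ℝ i (fun y => f ((y - b) / a)) x‖
      = |a⁻¹| ^ i * ‖iteratedFDeriv ℝ i f ((x - b) / a)‖ := by
  rw [norm_iteratedFDeriv_eq_norm_iteratedDeriv, norm_iteratedFDeriv_eq_norm_iteratedDeriv]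
  have h1 : (fun y => f ((y - b) / a)) = fun y => (fun z => f (a⁻¹ * z)) (y - b) := by
    funext y
    simp only [div_eq_inv_mul]
  rw [h1, iteratedDeriv_comp_sub_const (f := fun z => f (a⁻¹ * z)),
    iteratedDeriv_comp_const_mul hf]
  simp [div_eq_inv_mul, abs_inv]

/-- Continuous linear map `ψ ↦ ψ((· - b) / a)` on test functions, for `a ≠ 0`. -/
noncomputable def testAffine (a b : ℝ) (ha : a ≠ 0) : Test →L[ℝ] Test :=
  TestFunction.limitCLM ℝ
    (fun ψ =>
      { toFun := fun x => ψ ((x - b) / a)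
        contDiff' := ψ.contDiff.comp (by fun_prop)
        hasCompactSupport' :=
          ψ.hasCompactSupport.comp_homeomorph
            ((Homeomorph.subRight b).trans (Homeomorph.mulRight₀ a⁻¹ (inv_ne_zero ha)))
        tsupport_subset' := fun _ _ => trivial })
    (fun K _ =>
      (TestFunction.ofSupportedInCLM ℝ
        (K := ⟨(fun t => a * t + b) '' (K : Set ℝ), K.isCompact.image (by fun_prop)⟩)
        (Set.subset_univ _)).comp
      (ContDiffMapSupportedIn.mkCLM ℝ (fun ψ x => ψ ((x - b) / a))
        (fun _ _ _ => rfl) (fun _ _ _ => rfl)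
        (fun ψ => ψ.contDiff.comp (by fun_prop))
        (fun ψ x hx => ψ.zero_on_compl (fun hmem => hx ⟨_, hmem, by field_simp; ring⟩))
        (fun i _ => ⟨{i}, |a⁻¹| ^ i, by positivity, fun ψ x _ => by
          rw [Finset.sup_singleton,
            iteratedFDeriv_comp_affine_norm _ _ _ _
              (ψ.contDiff.of_le (by exact_mod_cast le_top))]
          gcongr
          exact ContDiffMapSupportedIn.norm_iteratedFDeriv_apply_le_seminorm_top ℝ⟩)))
    (fun _ _ _ => rfl)

/-- The distribution `T(a t + b)`, `a ≠ 0`, that is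
`⟨T(a · + b), ψ⟩ = |a|⁻¹ ⟨T, ψ((· - b) / a)⟩` (and `0` by convention if `a = 0`). -/
noncomputable def compAffine (a b : ℝ) (T : Distr) : Distr :=
  open scoped Classical in
  if ha : a ≠ 0 then |a|⁻¹ • (testAffine a b ha).precompCompactConvergenceCLM ℝ T else 0

/-! ### Function spaces -/

/-- `f ∈ L_{p,loc}(ℝ)`. -/
def MemLpLoc (p : ℝ≥0∞) (f : ℝ → ℝ) : Prop :=
  ∀ K : Set ℝ, IsCompact K → MemLp f p (volume.restrict K)

/-- `f ∈ L_{p,unif}(ℝ)`: the `L_p` norms over the intervals `[t, t + 1]` are bounded uniformly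
in `t`. -/
def MemLpUnif (p : ℝ≥0∞) (f : ℝ → ℝ) : Prop :=
  AEStronglyMeasurable f volume ∧
    ⨆ t : ℝ, eLpNorm f p (volume.restrict (Set.Icc t (t + 1))) < ∞

/-- `f ∈ W^s_{2,loc}(ℝ)`: for each test function `φ` the product `φ f` lies in `L_2(ℝ)` and in the
Sobolev space `W^s_2(ℝ)` (used for `s ≥ 0`). -/
def MemSobolevLoc (s : ℝ) (f : ℝ → ℝ) : Prop :=
  ∀ φ : Test, ∃ h : MemLp (fun x => ((φ x * f x : ℝ) : ℂ)) 2 (volume : Measure ℝ),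
    TemperedDistribution.MemSobolev s 2 ((h.toLp : Lp ℂ 2 (volume : Measure ℝ)) : 𝓢'(ℝ, ℂ))

/-! ### Singular Gordon potentials -/

/-- `q = σ' + τ` with `σ ∈ L_{2,unif}(ℝ)` and `τ ∈ L_{1,unif}(ℝ)`. The distributions `q` admitting
such a decomposition are precisely those of the class `W^{-1}_{2,unif}(ℝ)`. -/
structure IsDecomposition (q : Distr) (σ τ : ℝ → ℝ) : Prop where
  memσ : MemLpUnif 2 σ
  memτ : MemLpUnif 1 τ
  eq : q = distDeriv (ofFun σ) + ofFun τ

/-- `q = σ' + τ` is a singular Gordon potential: there are `T_m → ∞` and `T_m`-periodic functions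
`σ_m ∈ L_{2,unif}(ℝ)`, `τ_m ∈ L_{1,unif}(ℝ)` such that for every `C` the quantity
`exp (C T_m) (‖σ - σ_m‖_{L_2[-T_m, 2 T_m]} + ‖τ - τ_m‖_{L_1[-T_m, 2 T_m]})` tends to `0`. -/
def IsSingularGordon (q : Distr) : Prop :=
  ∃ σ τ : ℝ → ℝ, IsDecomposition q σ τ ∧
    ∃ (T : ℕ → ℝ) (σm τm : ℕ → ℝ → ℝ),
      (∀ m, 0 < T m) ∧ Tendsto T atTop atTop ∧
      (∀ m, MemLpUnif 2 (σm m) ∧ Function.Periodic (σm m) (T m)) ∧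
      (∀ m, MemLpUnif 1 (τm m) ∧ Function.Periodic (τm m) (T m)) ∧
      ∀ C : ℝ, Tendsto
        (fun m => ENNReal.ofReal (Real.exp (C * T m)) *
          (eLpNorm (σ - σm m) 2 (volume.restrict (Set.Icc (-T m) (2 * T m))) +
            eLpNorm (τ - τm m) 1 (volume.restrict (Set.Icc (-T m) (2 * T m)))))
        atTop (𝓝 0)

/-! ### The Schrödinger operator -/

/-- `g ∈ L_{1,loc}(ℝ)` is the weak derivative of `f ∈ L_{1,loc}(ℝ)`. -/
def HasWeakDeriv (f g : ℝ → ℂ) : Prop :=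
  LocallyIntegrable f volume ∧ LocallyIntegrable g volume ∧
    ∀ φ : Test, ∫ x, deriv φ x • f x = -∫ x, φ x • g x

/-- The graph of the operator `S = -d²/dx² + q` in `L_2(ℝ)`, `q = σ' + τ`. The pair `(f, g)` belongs
to it if `f` is in the domain of `S`, that is `f ∈ W^1_2(ℝ)`,
`f^{[1]} = f' - σ f ∈ W^1_{1,loc}(ℝ)` and `l(f) ∈ L_2(ℝ)`, and if `g = l(f)`, where
`l(f) = -(f' - σ f)' - σ f' + τ f`. -/
def schrodingerGraph (q : Distr) :
    Set (Lp ℂ 2 (volume : Measure ℝ) × Lp ℂ 2 (volume : Measure ℝ)) :=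
  {p | ∃ σ τ : ℝ → ℝ, IsDecomposition q σ τ ∧
    ∃ f' h' : ℝ → ℂ,
      MemLp f' 2 volume ∧ HasWeakDeriv p.1 f' ∧
      HasWeakDeriv (fun x => f' x - (σ x : ℂ) * p.1 x) h' ∧
      ∀ᵐ x ∂(volume : Measure ℝ),
        p.2 x = -h' x - (σ x : ℂ) * f' x + (τ x : ℂ) * p.1 x}

/-- The point spectrum (the set of eigenvalues) of the operator `S = -d²/dx² + q`. -/
def pointSpectrum (q : Distr) : Set ℂ :=
  {z | ∃ u : Lp ℂ 2 (volume : Measure ℝ), u ≠ 0 ∧ (u, z • u) ∈ schrodingerGraph q}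

/-! ### Quasiperiodic potentials -/

/-- Irrational numbers with rational approximations `R_m / T_m` such that
`|α - R_m / T_m| ≤ C m ^ (-T_m)` for all `m ≥ 1`. Note that the exponent is the denominator, so
this is more restrictive than `Liouville`. -/
def IsLiouvilleNumber (α : ℝ) : Prop :=
  Irrational α ∧ ∃ (C : ℝ) (R : ℕ → ℤ) (T : ℕ → ℕ),
    ∀ m : ℕ, 1 ≤ m → 0 < T m ∧ |α - (R m : ℝ) / (T m : ℝ)| ≤ C / (m : ℝ) ^ T m

/-- The distribution `q(t) = σ₁'(t) + σ₂'(α t + θ) + τ₁(t) + τ₂(α t + θ)`. -/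
noncomputable def quasiPotential (σ₁ σ₂ τ₁ τ₂ : ℝ → ℝ) (α θ : ℝ) : Distr :=
  distDeriv (ofFun σ₁) + compAffine α θ (distDeriv (ofFun σ₂)) +
    ofFun τ₁ + ofFun (fun t => τ₂ (α * t + θ))

end SingularGordon

/-!
The argument has two halves.

*Gordon potentials have no eigenvalues.* For a decomposition `q = σ' + τ` the equation `l(u) = z u`
is the first order system `Y' = A Y` for `Y = (u, u' - σ u)` with the trace-free matrix
`A = !![σ, 1; τ - z - σ², -σ]`, whose entries are integrable uniformly over unit intervals. An
eigenfunction and its quasi-derivative tend to zero at infinity (`tendsto_zero_of_memLp`). If `A` is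
replaced by a `T`-periodic coefficient, then the values of a
solution at `-T`, `T`, `2T` are `M⁻¹ Y(0)`, `M Y(0)`, `M² Y(0)` with the monodromy matrix `M` of
determinant one, and the Cayley–Hamilton theorem bounds `‖Y(0)‖` by the sum of their norms. As the
fundamental solution grows at most exponentially, a superexponentially good periodic approximation
transfers this bound to `Y` itself (`eq_zero_of_periodic_approximation`), so `Y(0) = 0`, `Y = 0`.
Another decomposition of the same distribution changes `σ` by a primitive of a locally integrable
function (`IsDecomposition.exists_isPrimitive`) and the quasi-derivative accordingly; this gives
`pointSpectrum_eq_empty` for the operator defined by all decompositions at once.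

*The quasiperiodic potential is a Gordon potential.* Up to its mean value, `τ₂` has a periodic
primitive `ρ`, so `q = σ' + τ` with `σ = σ₁ + α⁻¹ f(αt + θ)`, `f = σ₂ + ρ`, and a `1`-periodic `τ`
(`quasiPotential_eq`). The approximations replace `α` by `R_m / T_m` in `σ`. The function `f` has an
`L₂` modulus of continuity of Hölder type: for `σ₂` this is Plancherel's theorem in the Sobolev space
(`exists_eLpNorm_translate_sub_le`), for `ρ` it is elementary. Hence Steklov averages with step `ε`
approximate `f` with error `O(ε^(b/2))` and are Hölder continuous with constant `O(ε⁻¹)`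
(`HasHolderModulus.exists_approximation`). With `ε = m^(-T_m/4)` the error of the periodic
approximation on `[-T_m, 2T_m]` is `O(T_m m^(-κ T_m))` for some `κ > 0`, which is smaller than every
exponential `exp (-C T_m)`.
-/

namespace SingularGordon

/-! ### Primitives of locally integrable functions -/

section Primitive

variable {E : Type*} [NormedAddCommGroup E]

lemma AbsolutelyContinuousOnInterval.of_dist_le {X Y : Type*} [PseudoMetricSpace X]
    [PseudoMetricSpace Y] {f : ℝ → X} {g : ℝ → Y} {a b : ℝ}
    (hg : AbsolutelyContinuousOnInterval g a b)
    (h : ∀ x ∈ Set.uIcc a b, ∀ y ∈ Set.uIcc a b, dist (f x) (f y) ≤ dist (g x) (g y)) :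
    AbsolutelyContinuousOnInterval f a b := by
  unfold AbsolutelyContinuousOnInterval at hg ⊢
  refine squeeze_zero' (Eventually.of_forall fun _ => Finset.sum_nonneg fun _ _ => dist_nonneg)
    ?_ hg
  rw [eventually_inf_principal]
  filter_upwards with E hE
  exact Finset.sum_le_sum fun i hi => h _ (hE.1 i hi).1 _ (hE.1 i hi).2

lemma locallyIntegrable_intervalIntegrable {f : ℝ → E} (hf : LocallyIntegrable f volume)
    (a b : ℝ) : IntervalIntegrable f volume a b :=
  intervalIntegrable_iff.mpr
    ((hf.integrableOn_isCompact isCompact_uIcc).mono_set Set.uIoc_subset_uIcc)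

lemma locallyIntegrable_norm {f : ℝ → E} (hf : LocallyIntegrable f volume) :
    LocallyIntegrable (fun x => ‖f x‖) volume := by
  rw [locallyIntegrable_iff] at hf ⊢
  exact fun k hk => (hf k hk).norm

lemma exists_norm_le_of_continuous {F : ℝ → E} (h : Continuous F) (R : ℝ) :
    ∃ C, 0 ≤ C ∧ ∀ x ∈ Set.Icc (-R) R, ‖F x‖ ≤ C := by
  obtain ⟨C, hC⟩ := isCompact_Icc.exists_bound_of_continuousOn (h.continuousOn (s := Set.Icc (-R) R))
  exact ⟨max C 0, le_max_right _ _, fun x hx => (hC x hx).trans (le_max_left _ _)⟩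

lemma absolutelyContinuousOnInterval_of_norm_sub_le {F : ℝ → E} {p : ℝ → ℝ}
    (hp : LocallyIntegrable p volume) {a b : ℝ} (hab : a ≤ b)
    (hle : ∀ x ∈ Set.Icc a b, ∀ y ∈ Set.Icc a b, x ≤ y → ‖F y - F x‖ ≤ ∫ t in x..y, p t) :
    AbsolutelyContinuousOnInterval F a b := by
  have hi := locallyIntegrable_intervalIntegrable hp
  refine AbsolutelyContinuousOnInterval.of_dist_le
    ((hi a b).absolutelyContinuousOnInterval_intervalIntegral
      (c := a) Set.left_mem_uIcc) ?_
  have key : ∀ x ∈ Set.Icc a b, ∀ y ∈ Set.Icc a b, x ≤ y →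
      dist (F x) (F y) ≤ dist (∫ v in a..x, p v) (∫ v in a..y, p v) := by
    intro x hx y hy hxy
    rw [dist_comm, dist_comm (∫ v in a..x, p v), dist_eq_norm, dist_eq_norm,
      intervalIntegral.integral_interval_sub_left (hi _ _) (hi _ _)]
    exact (hle x hx y hy hxy).trans (le_abs_self _)
  rw [Set.uIcc_of_le hab]
  intro x hx y hy
  rcases le_total x y with h | h
  · exact key x hx y hy h
  · rw [dist_comm, dist_comm (∫ v in a..x, p v)]
    exact key y hy x hx h

variable [NormedSpace ℝ E]

/-- The fundamental theorem of calculus for a function whose increments are controlled by the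
integral of a locally integrable function. -/
lemma sub_eq_integral_of_norm_sub_le [CompleteSpace E] {F f : ℝ → E} {p : ℝ → ℝ}
    (hp : LocallyIntegrable p volume) (hf : LocallyIntegrable f volume) {a b : ℝ} (hab : a ≤ b)
    (hle : ∀ x ∈ Set.Icc a b, ∀ y ∈ Set.Icc a b, x ≤ y → ‖F y - F x‖ ≤ ∫ t in x..y, p t)
    (hd : ∀ᵐ x : ℝ, HasDerivAt F (f x) x) : F b - F a = ∫ t in a..b, f t := by
  have hi := locallyIntegrable_intervalIntegrable hf
  have h1 := absolutelyContinuousOnInterval_of_norm_sub_le hp hab hle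
  have h2 : AbsolutelyContinuousOnInterval (fun x => ∫ t in a..x, f t) a b := by
    refine absolutelyContinuousOnInterval_of_norm_sub_le (locallyIntegrable_norm hf) hab
      fun x _ y _ hxy => ?_
    rw [intervalIntegral.integral_interval_sub_left (hi _ _) (hi _ _)]
    exact intervalIntegral.norm_integral_le_integral_norm hxy
  obtain ⟨C, hC⟩ := (h1.sub h2).const_of_ae_hasDerivAt_zero (by
    filter_upwards [hd, LocallyIntegrable.ae_hasDerivAt_integral hf] with x hx hx' _
    simpa using hx.sub (hx' a))
  have ha := hC a Set.left_mem_uIcc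
  have hb := hC b Set.right_mem_uIcc
  simp only [Pi.sub_apply, intervalIntegral.integral_same, sub_zero] at ha hb
  rw [ha, ← hb]
  abel

/-- `F` is a primitive of the locally integrable function `f`; equivalently, `F` is locally
absolutely continuous with derivative `f` almost everywhere. -/
structure IsPrimitive (F f : ℝ → E) : Prop where
  locallyIntegrable : LocallyIntegrable f volume
  sub_eq : ∀ x y, F y - F x = ∫ t in x..y, f t

namespace IsPrimitive

variable {F G f g : ℝ → E}

lemma intervalIntegrable (h : IsPrimitive F f) (a b : ℝ) : IntervalIntegrable f volume a b :=
  locallyIntegrable_intervalIntegrable h.locallyIntegrable a b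

lemma eq_add (h : IsPrimitive F f) (a x : ℝ) : F x = F a + ∫ t in a..x, f t := by
  rw [← h.sub_eq a x]; abel

protected lemma continuous (h : IsPrimitive F f) : Continuous F := by
  have : F = fun x => F 0 + ∫ t in (0 : ℝ)..x, f t := funext fun x => h.eq_add 0 x
  rw [this]
  exact continuous_const.add (intervalIntegral.continuous_primitive h.intervalIntegrable 0)

lemma ae_hasDerivAt [CompleteSpace E] (h : IsPrimitive F f) : ∀ᵐ x : ℝ, HasDerivAt F (f x) x := by
  have : F = fun x => F 0 + ∫ t in (0 : ℝ)..x, f t := funext fun x => h.eq_add 0 x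
  filter_upwards [LocallyIntegrable.ae_hasDerivAt_integral h.locallyIntegrable] with x hx
  rw [this]
  simpa using (hx 0).const_add (F 0)

lemma norm_sub_le (h : IsPrimitive F f) {x y : ℝ} (hxy : x ≤ y) :
    ‖F y - F x‖ ≤ ∫ t in x..y, ‖f t‖ := by
  rw [h.sub_eq]
  exact intervalIntegral.norm_integral_le_integral_norm hxy

lemma of_integral (hf : LocallyIntegrable f volume) (a : ℝ) :
    IsPrimitive (fun x => ∫ t in a..x, f t) f :=
  ⟨hf, fun _ _ => intervalIntegral.integral_interval_sub_left
    (locallyIntegrable_intervalIntegrable hf _ _) (locallyIntegrable_intervalIntegrable hf _ _)⟩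

lemma const (c : E) : IsPrimitive (fun _ => c) (fun _ => (0 : E)) :=
  ⟨locallyIntegrable_const 0, by simp⟩

lemma congr (h : IsPrimitive F f) (hfg : f =ᵐ[volume] g) : IsPrimitive F g :=
  ⟨(locallyIntegrable_congr hfg).1 h.locallyIntegrable, fun x y => by
    rw [h.sub_eq]
    exact intervalIntegral.integral_congr_ae (hfg.mono fun _ hx _ => hx)⟩

lemma add (h : IsPrimitive F f) (h' : IsPrimitive G g) :
    IsPrimitive (fun x => F x + G x) (fun x => f x + g x) :=
  ⟨h.locallyIntegrable.add h'.locallyIntegrable, fun x y => by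
    rw [intervalIntegral.integral_add (h.intervalIntegrable _ _) (h'.intervalIntegrable _ _),
      ← h.sub_eq, ← h'.sub_eq]
    abel⟩

lemma sub (h : IsPrimitive F f) (h' : IsPrimitive G g) :
    IsPrimitive (fun x => F x - G x) (fun x => f x - g x) :=
  ⟨h.locallyIntegrable.sub h'.locallyIntegrable, fun x y => by
    rw [intervalIntegral.integral_sub (h.intervalIntegrable _ _) (h'.intervalIntegrable _ _),
      ← h.sub_eq, ← h'.sub_eq]
    abel⟩

/-- A primitive may be pushed through a continuous linear map. -/
lemma clm_apply [CompleteSpace E] {E' : Type*} [NormedAddCommGroup E'] [NormedSpace ℝ E']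
    [CompleteSpace E'] (L : E →L[ℝ] E') (h : IsPrimitive F f) :
    IsPrimitive (fun x => L (F x)) (fun x => L (f x)) :=
  ⟨fun x => L.integrableAtFilter_comp (h.locallyIntegrable x), fun x y => by
    rw [ContinuousLinearMap.intervalIntegral_comp_comm L (h.intervalIntegrable _ _), ← h.sub_eq,
      map_sub]⟩

lemma of_hasDerivAt [CompleteSpace E] (hF : ∀ x, HasDerivAt F (f x) x) (hf : Continuous f) :
    IsPrimitive F f :=
  ⟨hf.locallyIntegrable, fun _ _ => (intervalIntegral.integral_eq_sub_of_hasDerivAt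
    (fun x _ => hF x) (hf.intervalIntegrable _ _)).symm⟩

/-- A function with derivative `f` almost everywhere is a primitive of `f` if its increments are
locally dominated by the integrals of a locally integrable function. -/
lemma of_norm_sub_le [CompleteSpace E] (hf : LocallyIntegrable f volume)
    (hd : ∀ᵐ x : ℝ, HasDerivAt F (f x) x)
    (hle : ∀ R : ℝ, ∃ p : ℝ → ℝ, LocallyIntegrable p volume ∧
      ∀ x ∈ Set.Icc (-R) R, ∀ y ∈ Set.Icc (-R) R, x ≤ y → ‖F y - F x‖ ≤ ∫ t in x..y, p t) :
    IsPrimitive F f := by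
  have key : ∀ x y, x ≤ y → F y - F x = ∫ t in x..y, f t := by
    intro x y hxy
    obtain ⟨p, hp, h⟩ := hle (max |x| |y|)
    have hx := abs_le.1 (le_max_left |x| |y|)
    have hy := abs_le.1 (le_max_right |x| |y|)
    exact sub_eq_integral_of_norm_sub_le hp hf hxy (fun u hu v hv huv =>
      h u ⟨hx.1.trans hu.1, hu.2.trans hy.2⟩ v ⟨hx.1.trans hv.1, hv.2.trans hy.2⟩ huv) hd
  refine ⟨hf, fun x y => ?_⟩
  rcases le_total x y with h | h
  · exact key x y h
  · rw [intervalIntegral.integral_symm, ← key y x h]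
    abel

end IsPrimitive

lemma locallyIntegrable_continuous_mul {A : Type*} [NormedRing A] {F f : ℝ → A}
    (hF : Continuous F) (hf : LocallyIntegrable f volume) :
    LocallyIntegrable (fun x => F x * f x) volume := by
  rw [locallyIntegrable_iff] at hf ⊢
  exact fun k hk => (hf k hk).continuousOn_mul hF.continuousOn hk

lemma locallyIntegrable_mul_continuous {A : Type*} [NormedRing A] {F f : ℝ → A}
    (hF : Continuous F) (hf : LocallyIntegrable f volume) :
    LocallyIntegrable (fun x => f x * F x) volume := by
  rw [locallyIntegrable_iff] at hf ⊢
  exact fun k hk => (hf k hk).mul_continuousOn hF.continuousOn hk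

/-- Product rule for locally absolutely continuous functions with values in a Banach algebra. -/
lemma IsPrimitive.mul {A : Type*} [NormedRing A] [NormedAlgebra ℝ A] [CompleteSpace A]
    {F G f g : ℝ → A} (hF : IsPrimitive F f) (hG : IsPrimitive G g) :
    IsPrimitive (fun x => F x * G x) (fun x => f x * G x + F x * g x) := by
  refine .of_norm_sub_le ((locallyIntegrable_mul_continuous hG.continuous
    hF.locallyIntegrable).add (locallyIntegrable_continuous_mul hF.continuous
    hG.locallyIntegrable)) ?_ fun R => ?_
  · filter_upwards [hF.ae_hasDerivAt, hG.ae_hasDerivAt] with x h1 h2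
    exact h1.mul h2
  · obtain ⟨C, hC0, hC⟩ := exists_norm_le_of_continuous hF.continuous R
    obtain ⟨D, hD0, hD⟩ := exists_norm_le_of_continuous hG.continuous R
    refine ⟨fun t => D * ‖f t‖ + C * ‖g t‖,
      ((locallyIntegrable_norm hF.locallyIntegrable).smul D).add
        ((locallyIntegrable_norm hG.locallyIntegrable).smul C),
      fun x hx y hy hxy => ?_⟩
    rw [intervalIntegral.integral_add ((hF.intervalIntegrable _ _).norm.const_mul _)
      ((hG.intervalIntegrable _ _).norm.const_mul _), intervalIntegral.integral_const_mul,
      intervalIntegral.integral_const_mul]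
    calc ‖F y * G y - F x * G x‖ = ‖(F y - F x) * G y + F x * (G y - G x)‖ := by
          congr 1; noncomm_ring
      _ ≤ ‖F y - F x‖ * ‖G y‖ + ‖F x‖ * ‖G y - G x‖ :=
          (norm_add_le _ _).trans (add_le_add (norm_mul_le _ _) (norm_mul_le _ _))
      _ ≤ ‖F y - F x‖ * D + C * ‖G y - G x‖ := by
          gcongr
          · exact hD y hy
          · exact hC x hx
      _ ≤ D * (∫ t in x..y, ‖f t‖) + C * ∫ t in x..y, ‖g t‖ := by
          rw [mul_comm _ D]
          gcongr
          · exact hF.norm_sub_le hxy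
          · exact hG.norm_sub_le hxy

/-- Chain rule for the exponential of a locally absolutely continuous function. -/
lemma IsPrimitive.exp {F f : ℝ → ℝ} (hF : IsPrimitive F f) :
    IsPrimitive (fun x => Real.exp (F x)) (fun x => Real.exp (F x) * f x) := by
  refine .of_norm_sub_le (locallyIntegrable_continuous_mul
    (Real.continuous_exp.comp hF.continuous) hF.locallyIntegrable) ?_ fun R => ?_
  · filter_upwards [hF.ae_hasDerivAt] with x h1
    exact h1.exp
  · obtain ⟨C, hC0, hC⟩ := exists_norm_le_of_continuous hF.continuous R
    refine ⟨fun t => Real.exp C * ‖f t‖,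
      (locallyIntegrable_norm hF.locallyIntegrable).smul (Real.exp C),
      fun x hx y hy hxy => ?_⟩
    rw [intervalIntegral.integral_const_mul]
    have := (convex_Icc (-C) C).norm_image_sub_le_of_norm_hasDerivWithin_le (f := Real.exp)
      (f' := Real.exp) (C := Real.exp C) (fun z _ => (Real.hasDerivAt_exp z).hasDerivWithinAt)
      (fun z hz => by
        rw [Real.norm_eq_abs, abs_of_pos (Real.exp_pos _)]
        exact Real.exp_le_exp.2 hz.2) (abs_le.1 (hC x hx)) (abs_le.1 (hC y hy))
    exact this.trans (by gcongr; exact hF.norm_sub_le hxy)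

end Primitive

/-! ### Test functions and weak derivatives -/

/-- A smooth compactly supported function as a test function. -/
noncomputable def toTest (φ : ℝ → ℝ) (h : ContDiff ℝ (⊤ : ℕ∞) φ) (hc : HasCompactSupport φ) :
    Test :=
  ⟨φ, h, hc, fun _ _ => trivial⟩

lemma Test.hasDerivAt (φ : Test) (x : ℝ) : HasDerivAt φ (deriv φ x) x :=
  (φ.contDiff.differentiable (by simp) x).hasDerivAt

lemma Test.continuous_deriv (φ : Test) : Continuous (deriv φ) :=
  φ.contDiff.continuous_deriv (by simp)

lemma Test.exists_eq_zero (φ : Test) :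
    ∃ R : ℝ, 0 < R ∧ ∀ x, R ≤ |x| → φ x = 0 ∧ deriv φ x = 0 := by
  obtain ⟨R, hR⟩ := φ.hasCompactSupport.isCompact.isBounded.subset_ball (0 : ℝ)
  refine ⟨max R 1, by positivity, fun x hx => ?_⟩
  have hx' : x ∉ tsupport φ := fun h => by
    have := hR h
    rw [Metric.mem_ball, dist_zero_right, Real.norm_eq_abs] at this
    exact absurd ((le_max_left R 1).trans hx) (not_le.2 this)
  refine ⟨image_eq_zero_of_notMem_tsupport hx', ?_⟩
  exact image_eq_zero_of_notMem_tsupport fun h => hx' (tsupport_deriv_subset h)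

section Weak

variable {𝕂 : Type*} [RCLike 𝕂]

/-- Integration by parts against a test function. -/
lemma IsPrimitive.integral_deriv_test {F f : ℝ → 𝕂} (h : IsPrimitive F f) (φ : Test) :
    ∫ x, deriv φ x • F x = -∫ x, φ x • f x := by
  obtain ⟨R, hR, hφ⟩ := Test.exists_eq_zero φ
  have hφp : IsPrimitive (fun x => ((φ x : ℝ) : 𝕂)) (fun x => ((deriv φ x : ℝ) : 𝕂)) :=
    (IsPrimitive.of_hasDerivAt (Test.hasDerivAt φ) (Test.continuous_deriv φ)).clm_apply
      (RCLike.ofRealCLM (K := 𝕂))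
  have hm := (hφp.mul h).sub_eq (-R) R
  have hz : φ R = 0 := (hφ R (le_abs_self R)).1
  have hz' : φ (-R) = 0 := (hφ (-R) (by rw [abs_neg]; exact le_abs_self R)).1
  rw [hz, hz'] at hm
  have key : ∀ (ψ : ℝ → ℝ) (G : ℝ → 𝕂), (∀ x, R ≤ |x| → ψ x = 0) →
      ∫ x, ψ x • G x = ∫ x in (-R)..R, (ψ x : 𝕂) * G x := by
    intro ψ G hψ
    rw [intervalIntegral.integral_of_le (by linarith),
      setIntegral_eq_integral_of_forall_compl_eq_zero]
    · simp [RCLike.real_smul_eq_coe_mul]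
    · intro x hx
      rw [hψ x, RCLike.ofReal_zero, zero_mul]
      by_contra hlt
      have := abs_lt.1 (not_le.1 hlt)
      exact hx ⟨this.1, this.2.le⟩
  rw [key _ _ fun x hx => (hφ x hx).2, key _ _ fun x hx => (hφ x hx).1, eq_neg_iff_add_eq_zero,
    ← intervalIntegral.integral_add]
  · simpa using hm.symm
  · exact locallyIntegrable_intervalIntegrable (locallyIntegrable_mul_continuous h.continuous
      hφp.locallyIntegrable) _ _
  · exact locallyIntegrable_intervalIntegrable (locallyIntegrable_continuous_mul hφp.continuous
      h.locallyIntegrable) _ _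

/-- A test function with integral zero is the derivative of a test function. -/
lemma Test.exists_deriv_eq (φ : Test) (h0 : ∫ x, φ x = 0) : ∃ ψ : Test, ∀ x, deriv ψ x = φ x := by
  obtain ⟨R, hR, hφ⟩ := Test.exists_eq_zero φ
  have hd : ∀ x, HasDerivAt (fun x => ∫ t in (-R)..x, φ t) (φ x) x := fun x =>
    φ.continuous.integral_hasStrictDerivAt (-R) x |>.hasDerivAt
  have hderiv : deriv (fun x => ∫ t in (-R)..x, φ t) = φ := funext fun x => (hd x).deriv
  have hsm : ContDiff ℝ (⊤ : ℕ∞) (fun x => ∫ t in (-R)..x, φ t) := by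
    rw [contDiff_infty_iff_deriv, hderiv]
    exact ⟨fun x => (hd x).differentiableAt, φ.contDiff⟩
  have hsupp : HasCompactSupport (fun x => ∫ t in (-R)..x, φ t) := by
    refine HasCompactSupport.intro (isCompact_Icc (a := -R) (b := R)) fun x hx => ?_
    have hz : ∀ a b, (∀ x ∈ Set.uIcc a b, R ≤ |x|) → ∫ t in a..b, φ t = 0 := fun a b hab => by
      rw [intervalIntegral.integral_congr (g := fun _ => (0 : ℝ)) fun x hx => (hφ x (hab x hx)).1]
      simp
    rcases lt_or_ge x (-R) with h | h
    · refine hz _ _ fun y hy => ?_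
      rw [Set.uIcc_of_ge h.le] at hy
      rw [le_abs]; right; linarith [hy.2]
    · have hxR : R < x := by
        by_contra hlt
        exact hx ⟨h, not_lt.1 hlt⟩
      have hfull : ∫ t in (-R)..R, φ t = 0 := by
        rw [← h0, intervalIntegral.integral_of_le (by linarith),
          setIntegral_eq_integral_of_forall_compl_eq_zero]
        intro x hx
        refine (hφ x ?_).1
        by_contra hlt
        have := abs_lt.1 (not_le.1 hlt)
        exact hx ⟨this.1, this.2.le⟩
      rw [← intervalIntegral.integral_add_adjacent_intervals (b := R)
        (φ.continuous.intervalIntegrable _ _) (φ.continuous.intervalIntegrable _ _), hfull, zero_add]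
      refine hz _ _ fun y hy => ?_
      rw [Set.uIcc_of_le hxR.le] at hy
      exact hy.1.trans (le_abs_self y)
  exact ⟨toTest _ hsm hsupp, fun x => (hd x).deriv⟩

lemma exists_test_eq_one (R : ℝ) (hR : 0 < R) : ∃ η : Test, ∀ x, |x| ≤ R → η x = 1 := by
  let b : ContDiffBump (0 : ℝ) := ⟨R, R + 1, hR, by linarith⟩
  exact ⟨toTest b b.contDiff b.hasCompactSupport, fun x hx =>
    b.one_of_mem_closedBall (by simpa using hx)⟩

lemma exists_test_integral_eq_one : ∃ η : Test, ∫ x, η x = 1 := by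
  let b : ContDiffBump (0 : ℝ) := ⟨1, 2, one_pos, one_lt_two⟩
  exact ⟨toTest (b.normed volume) b.contDiff_normed b.hasCompactSupport_normed, b.integral_normed⟩

lemma integrable_test_smul {f : ℝ → 𝕂} (hf : LocallyIntegrable f volume) (φ : Test) :
    Integrable (fun x => φ x • f x) :=
  hf.integrable_smul_left_of_hasCompactSupport φ.continuous φ.hasCompactSupport

lemma integrable_test (φ : Test) : Integrable φ :=
  φ.continuous.integrable_of_hasCompactSupport φ.hasCompactSupport

/-- The du Bois-Reymond lemma: a locally integrable function with vanishing weak derivative is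
constant. -/
lemma exists_ae_eq_const {f : ℝ → 𝕂} (hf : LocallyIntegrable f volume)
    (h : ∀ φ : Test, ∫ x, deriv φ x • f x = 0) : ∃ c : 𝕂, ∀ᵐ x : ℝ, f x = c := by
  obtain ⟨η, hη⟩ := exists_test_integral_eq_one
  refine ⟨∫ x, η x • f x, ae_eq_of_integral_contDiff_smul_eq hf (locallyIntegrable_const _)
    fun g hg hgc => ?_⟩
  set φ : Test := toTest g hg hgc
  obtain ⟨ψ, hψ⟩ := Test.exists_deriv_eq (φ - (∫ x, φ x) • η) (by
    have : ∀ x, (φ - (∫ x, φ x) • η) x = φ x - (∫ x, φ x) * η x := fun x => rfl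
    simp only [this]
    rw [integral_sub (integrable_test φ) ((integrable_test η).const_mul _), integral_const_mul, hη]
    simp)
  have h1 := h ψ
  have : ∀ x, deriv ψ x • f x = φ x • f x - (∫ x, φ x) • (η x • f x) := fun x => by
    rw [hψ x, show (φ - (∫ x, φ x) • η) x = φ x - (∫ x, φ x) * η x from rfl, sub_smul, mul_smul]
  simp only [this] at h1
  have hI : Integrable (fun x => (∫ x, φ x) • η x • f x) :=
    (integrable_test_smul hf η).fun_smul (∫ x, φ x)
  rw [integral_sub (integrable_test_smul hf φ) hI, integral_smul, sub_eq_zero] at h1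
  change ∫ x, φ x • f x = _
  rw [h1, ← integral_smul_const]
  rfl

/-- A function with a weak derivative agrees almost everywhere with a primitive of it. -/
lemma exists_isPrimitive_of_weak {f g : ℝ → 𝕂} (hf : LocallyIntegrable f volume)
    (hg : LocallyIntegrable g volume)
    (h : ∀ φ : Test, ∫ x, deriv φ x • f x = -∫ x, φ x • g x) :
    ∃ F : ℝ → 𝕂, f =ᵐ[volume] F ∧ IsPrimitive F g := by
  have hP := IsPrimitive.of_integral hg 0
  have hder : ∀ {u : ℝ → 𝕂} (_ : LocallyIntegrable u volume) (φ : Test),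
      Integrable fun x => deriv φ x • u x := fun hu φ =>
    hu.integrable_smul_left_of_hasCompactSupport (Test.continuous_deriv φ)
      φ.hasCompactSupport.deriv
  obtain ⟨c, hc⟩ := exists_ae_eq_const (hf.sub hP.continuous.locallyIntegrable) fun φ => by
    simp only [Pi.sub_apply, smul_sub]
    rw [integral_sub (hder hf φ) (hder hP.continuous.locallyIntegrable φ), h φ,
      hP.integral_deriv_test φ, sub_self]
  refine ⟨fun x => (∫ t in (0 : ℝ)..x, g t) + c, ?_, ?_⟩
  · filter_upwards [hc] with x hx
    rw [← hx]
    simp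
  · simpa using hP.add (IsPrimitive.const c)

end Weak

/-! ### Linear systems with locally integrable coefficients -/

lemma locallyIntegrable_of_intervalIntegrable {E : Type*} [NormedAddCommGroup E] {f : ℝ → E}
    (h : ∀ a b, IntervalIntegrable f volume a b) : LocallyIntegrable f volume := by
  rw [locallyIntegrable_iff]
  intro k hk
  obtain ⟨R, hR⟩ := hk.isBounded.subset_closedBall (0 : ℝ)
  rw [Real.closedBall_eq_Icc, zero_sub, zero_add] at hR
  rcases le_total (-R) R with hR0 | hR0
  · exact ((intervalIntegrable_iff_integrableOn_Icc_of_le hR0).1 (h (-R) R)).mono_set hR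
  · refine IntegrableOn.mono_set ?_ hR
    rw [integrableOn_Icc_iff_integrableOn_Ioc, Set.Ioc_eq_empty (not_lt.2 hR0)]
    exact integrableOn_empty

lemma IsPrimitive.comp_add_right {E : Type*} [NormedAddCommGroup E] [NormedSpace ℝ E]
    {F f : ℝ → E} (h : IsPrimitive F f) (c : ℝ) :
    IsPrimitive (fun x => F (x + c)) (fun x => f (x + c)) :=
  ⟨locallyIntegrable_of_intervalIntegrable fun a b => by
      have := (h.intervalIntegrable (a + c) (b + c)).comp_add_right c
      simpa using this,
    fun x y => by rw [h.sub_eq, intervalIntegral.integral_comp_add_right]⟩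

lemma intervalIntegral_le_of_subinterval {p : ℝ → ℝ} (hp : LocallyIntegrable p volume)
    (h0 : ∀ t, 0 ≤ p t) {a b c d : ℝ} (hca : c ≤ a) (hab : a ≤ b) (hbd : b ≤ d) :
    ∫ t in a..b, p t ≤ ∫ t in c..d, p t :=
  intervalIntegral.integral_mono_interval hca hab hbd (Eventually.of_forall h0)
    (locallyIntegrable_intervalIntegrable hp _ _)

lemma abs_intervalIntegral_le_of_mem {p : ℝ → ℝ} (hp : LocallyIntegrable p volume)
    (h0 : ∀ t, 0 ≤ p t) {c d s t : ℝ} (hs : s ∈ Set.Icc c d) (ht : t ∈ Set.Icc c d) :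
    |∫ u in s..t, p u| ≤ ∫ u in c..d, p u := by
  rcases le_total s t with h | h
  · rw [abs_of_nonneg (intervalIntegral.integral_nonneg h fun u _ => h0 u)]
    exact intervalIntegral_le_of_subinterval hp h0 hs.1 h ht.2
  · rw [intervalIntegral.integral_symm, abs_neg,
      abs_of_nonneg (intervalIntegral.integral_nonneg h fun u _ => h0 u)]
    exact intervalIntegral_le_of_subinterval hp h0 ht.1 h hs.2

/-- The Volterra operator is a contraction by the factor `1 / 2` for the exponential weight
`exp (2 |B|)`, where `B` is the integral of the coefficient. -/
lemma abs_integral_mul_exp_le {p : ℝ → ℝ} (hp : LocallyIntegrable p volume) (h0 : ∀ t, 0 ≤ p t)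
    (t : ℝ) :
    |∫ s in (0 : ℝ)..t, Real.exp (2 * |∫ u in (0 : ℝ)..s, p u|) * p s|
      ≤ Real.exp (2 * |∫ u in (0 : ℝ)..t, p u|) / 2 := by
  have hB : IsPrimitive (fun x => ∫ u in (0 : ℝ)..x, p u) p := .of_integral hp 0
  have hc : ∀ c : ℝ, IsPrimitive (fun x => Real.exp (c * ∫ u in (0 : ℝ)..x, p u))
      (fun x => Real.exp (c * ∫ u in (0 : ℝ)..x, p u) * (c * p x)) := fun c =>
    (hB.clm_apply (c • ContinuousLinearMap.id ℝ ℝ)).exp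
  rcases le_total 0 t with ht | ht
  · have hpos : ∀ s, 0 ≤ s → |∫ u in (0 : ℝ)..s, p u| = ∫ u in (0 : ℝ)..s, p u := fun s hs =>
      abs_of_nonneg (intervalIntegral.integral_nonneg hs fun u _ => h0 u)
    have h1 : ∫ s in (0 : ℝ)..t, Real.exp (2 * |∫ u in (0 : ℝ)..s, p u|) * p s
        = (Real.exp (2 * ∫ u in (0 : ℝ)..t, p u) - 1) / 2 := by
      have h2 := (hc 2).sub_eq 0 t
      simp only [intervalIntegral.integral_same, mul_zero, Real.exp_zero] at h2
      rw [h2, eq_div_iff two_ne_zero, ← intervalIntegral.integral_mul_const]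
      refine intervalIntegral.integral_congr fun s hs => ?_
      rw [Set.uIcc_of_le ht] at hs
      rw [hpos s hs.1]
      ring
    have h3 : 1 ≤ Real.exp (2 * ∫ u in (0 : ℝ)..t, p u) :=
      Real.one_le_exp (mul_nonneg zero_le_two
        (intervalIntegral.integral_nonneg ht fun u _ => h0 u))
    rw [h1, hpos t ht, abs_of_nonneg (by linarith)]
    linarith
  · have hneg : ∀ s, s ≤ 0 → |∫ u in (0 : ℝ)..s, p u| = -∫ u in (0 : ℝ)..s, p u := fun s hs => by
      rw [abs_of_nonpos]
      rw [intervalIntegral.integral_symm]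
      exact neg_nonpos.2 (intervalIntegral.integral_nonneg hs fun u _ => h0 u)
    have h1 : ∫ s in (0 : ℝ)..t, Real.exp (2 * |∫ u in (0 : ℝ)..s, p u|) * p s
        = -((Real.exp (-2 * ∫ u in (0 : ℝ)..t, p u) - 1) / 2) := by
      have h2 := (hc (-2)).sub_eq 0 t
      simp only [intervalIntegral.integral_same, mul_zero, Real.exp_zero] at h2
      rw [h2, ← neg_div, eq_div_iff two_ne_zero, ← intervalIntegral.integral_mul_const,
        ← intervalIntegral.integral_neg]
      refine intervalIntegral.integral_congr fun s hs => ?_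
      rw [Set.uIcc_of_ge ht] at hs
      rw [hneg s hs.2, show 2 * -(∫ u in (0 : ℝ)..s, p u) = -2 * ∫ u in (0 : ℝ)..s, p u by ring]
      ring
    have h3 : 1 ≤ Real.exp (-2 * ∫ u in (0 : ℝ)..t, p u) := by
      have := abs_nonneg (∫ u in (0 : ℝ)..t, p u)
      rw [hneg t ht] at this
      exact Real.one_le_exp (by linarith)
    rw [h1, abs_neg, abs_of_nonneg (by linarith), hneg t ht,
      show 2 * -(∫ u in (0 : ℝ)..t, p u) = -2 * ∫ u in (0 : ℝ)..t, p u by ring]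
    linarith

section Existence

variable {A : Type*} [NormedRing A] [NormedAlgebra ℝ A] [CompleteSpace A]

open scoped BoundedContinuousFunction

/-- Existence, on the whole line, of the fundamental solution of `X' = a X`, by the contraction
principle in a space with exponential weight. -/
lemma exists_fundamental {a : ℝ → A} (ha : LocallyIntegrable a volume) :
    ∃ X : ℝ → A, X 0 = 1 ∧ IsPrimitive X (fun t => a t * X t) ∧
      ∀ t, ‖X t‖ ≤ 2 * ‖(1 : A)‖ * Real.exp (2 * |∫ s in (0 : ℝ)..t, ‖a s‖|) := by
  set p : ℝ → ℝ := fun t => ‖a t‖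
  have hp : LocallyIntegrable p volume := locallyIntegrable_norm ha
  have hp0 : ∀ t, 0 ≤ p t := fun t => norm_nonneg _
  set w : ℝ → ℝ := fun t => Real.exp (2 * |∫ s in (0 : ℝ)..t, p s|)
  have hw0 : ∀ t, 0 < w t := fun t => Real.exp_pos _
  have hw1 : ∀ t, 1 ≤ w t := fun t => Real.one_le_exp (by positivity)
  have hwc : Continuous w :=
    Real.continuous_exp.comp
      (continuous_const.mul (IsPrimitive.of_integral hp 0).continuous.abs)
  have hgl : ∀ Z : ℝ →ᵇ A, LocallyIntegrable (fun s => a s * (w s • Z s)) volume := fun Z =>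
    locallyIntegrable_mul_continuous (hwc.smul Z.continuous) ha
  set I : (ℝ →ᵇ A) → ℝ → A := fun Z t => ∫ s in (0 : ℝ)..t, a s * (w s • Z s)
  have hIc : ∀ Z, Continuous (I Z) := fun Z => (IsPrimitive.of_integral (hgl Z) 0).continuous
  have hIb : ∀ Z t, ‖I Z t‖ ≤ ‖Z‖ * (w t / 2) := by
    intro Z t
    calc ‖I Z t‖ ≤ |∫ s in (0 : ℝ)..t, ‖Z‖ * (w s * p s)| := by
          refine intervalIntegral.norm_integral_le_abs_of_norm_le (Eventually.of_forall fun s => ?_)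
            (locallyIntegrable_intervalIntegrable
              ((locallyIntegrable_continuous_mul hwc hp).smul ‖Z‖) _ _)
          calc ‖a s * (w s • Z s)‖ ≤ ‖a s‖ * ‖w s • Z s‖ := norm_mul_le _ _
            _ = p s * (w s * ‖Z s‖) := by
              rw [norm_smul, Real.norm_of_nonneg (hw0 s).le]
            _ ≤ p s * (w s * ‖Z‖) := by
              refine mul_le_mul_of_nonneg_left (mul_le_mul_of_nonneg_left ?_ (hw0 s).le) (hp0 s)
              exact Z.norm_coe_le_norm s
            _ = ‖Z‖ * (w s * p s) := by ring
      _ = ‖Z‖ * |∫ s in (0 : ℝ)..t, w s * p s| := by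
          rw [intervalIntegral.integral_const_mul, abs_mul, abs_norm]
      _ ≤ ‖Z‖ * (w t / 2) := by
          gcongr
          exact abs_integral_mul_exp_le hp hp0 t
  have hIs : ∀ Z Z' t, I Z t - I Z' t = I (Z - Z') t := by
    intro Z Z' t
    simp only [I]
    rw [← intervalIntegral.integral_sub (locallyIntegrable_intervalIntegrable (hgl Z) _ _)
      (locallyIntegrable_intervalIntegrable (hgl Z') _ _)]
    refine intervalIntegral.integral_congr fun s _ => ?_
    simp only [BoundedContinuousFunction.coe_sub, Pi.sub_apply, smul_sub, mul_sub]
  have hPb : ∀ Z t, ‖(w t)⁻¹ • (1 + I Z t)‖ ≤ ‖(1 : A)‖ + ‖Z‖ / 2 := by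
    intro Z t
    rw [norm_smul, norm_inv, Real.norm_of_nonneg (hw0 t).le, inv_mul_le_iff₀ (hw0 t)]
    calc ‖1 + I Z t‖ ≤ ‖(1 : A)‖ + ‖Z‖ * (w t / 2) :=
          (norm_add_le _ _).trans (add_le_add_right (hIb Z t) _)
      _ ≤ w t * ‖(1 : A)‖ + ‖Z‖ * (w t / 2) := by
          gcongr
          exact le_mul_of_one_le_left (norm_nonneg _) (hw1 t)
      _ = w t * (‖(1 : A)‖ + ‖Z‖ / 2) := by ring
  let P : (ℝ →ᵇ A) → (ℝ →ᵇ A) := fun Z =>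
    BoundedContinuousFunction.ofNormedAddCommGroup (fun t => (w t)⁻¹ • (1 + I Z t))
      ((hwc.inv₀ fun t => (hw0 t).ne').smul (continuous_const.add (hIc Z))) _ (hPb Z)
  have hP : ContractingWith (1 / 2) P := by
    refine ⟨by rw [← NNReal.coe_lt_coe]; norm_num, LipschitzWith.of_dist_le_mul fun Z Z' => ?_⟩
    refine (BoundedContinuousFunction.dist_le (by positivity)).2 fun t => ?_
    change dist ((w t)⁻¹ • (1 + I Z t)) ((w t)⁻¹ • (1 + I Z' t)) ≤ _
    rw [dist_eq_norm, ← smul_sub, add_sub_add_left_eq_sub, hIs, norm_smul, norm_inv,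
      Real.norm_of_nonneg (hw0 t).le, inv_mul_le_iff₀ (hw0 t), dist_eq_norm]
    refine (hIb _ t).trans (le_of_eq ?_)
    push_cast
    ring
  set Z := hP.fixedPoint
  have hZ : ∀ t, (w t)⁻¹ • (1 + I Z t) = Z t := fun t =>
    DFunLike.congr_fun (hP.fixedPoint_isFixedPt) t
  have hX : ∀ t, w t • Z t = 1 + ∫ s in (0 : ℝ)..t, a s * (w s • Z s) := fun t => by
    rw [← hZ t, smul_smul, mul_inv_cancel₀ (hw0 t).ne', one_smul]
  have hZn : ‖Z‖ ≤ 2 * ‖(1 : A)‖ := by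
    have : ‖Z‖ ≤ ‖(1 : A)‖ + ‖Z‖ / 2 :=
      (BoundedContinuousFunction.norm_le (by positivity)).2 fun t => by
        rw [← hZ t]; exact hPb Z t
    linarith
  refine ⟨fun t => w t • Z t, ?_, ?_, fun t => ?_⟩
  · change w 0 • Z 0 = 1
    rw [hX 0]
    simp
  · have h1 := (IsPrimitive.const (1 : A)).add (IsPrimitive.of_integral (hgl Z) 0)
    simp only [zero_add] at h1
    rw [← funext hX] at h1
    exact h1
  · rw [norm_smul, Real.norm_of_nonneg (hw0 t).le, mul_comm]
    exact mul_le_mul_of_nonneg_right ((Z.norm_coe_le_norm t).trans hZn) (hw0 t).le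

end Existence

/-! ### Systems with trace zero -/

/-- The properties of the adjugate of `2 × 2` matrices that Gordon's argument uses, in a normed
algebra: `J` is an anti-automorphism, and `X + J X` (the trace of `X`) is a central element that
multiplies norms. A matrix has trace zero if and only if `J X = -X`. -/
structure IsAdjugate {A : Type*} [NormedRing A] [NormedAlgebra ℝ A] (J : A →L[ℝ] A) : Prop where
  map_mul : ∀ X Y, J (X * Y) = J Y * J X
  map_one : J 1 = 1
  add_comm_mul : ∀ X Z, (X + J X) * Z = Z * (X + J X)
  norm_add_mul : ∀ X, ∃ r : ℝ, ∀ Z, ‖(X + J X) * Z‖ = r * ‖Z‖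

section TraceZero

variable {A : Type*} [NormedRing A] [NormedAlgebra ℝ A] {J : A →L[ℝ] A}
  {a b X Y : ℝ → A}

lemma IsAdjugate.mul_comm (hJ : IsAdjugate J) (X : A) : J X * X = X * J X := by
  have := hJ.add_comm_mul X X
  rw [add_mul, mul_add] at this
  exact add_left_cancel this

/-- The Cayley–Hamilton estimate behind Gordon's argument: for a matrix `M` of determinant one,
`M Z`, `M² Z` and `M⁻¹ Z` cannot all be small compared with `Z`. -/
lemma norm_le_of_mul_adj_eq_one (hJ : IsAdjugate J) {M Z : A} (h : M * J M = 1) :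
    ‖Z‖ ≤ ‖M * Z‖ + ‖M * (M * Z)‖ + ‖J M * Z‖ := by
  obtain ⟨r, hr⟩ := hJ.norm_add_mul M
  have h3 : M * (M * Z) + Z = (M + J M) * (M * Z) := by
    rw [← mul_assoc (M + J M), hJ.add_comm_mul, mul_assoc, add_mul, mul_add,
      ← mul_assoc M (J M), h, one_mul]
  rcases le_total r 1 with ht | ht
  · have : Z = (M + J M) * (M * Z) - M * (M * Z) := by rw [← h3]; abel
    calc ‖Z‖ = ‖(M + J M) * (M * Z) - M * (M * Z)‖ := by rw [← this]
      _ ≤ r * ‖M * Z‖ + ‖M * (M * Z)‖ := by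
        rw [← hr]; exact norm_sub_le _ _
      _ ≤ ‖M * Z‖ + ‖M * (M * Z)‖ := by
        gcongr; exact mul_le_of_le_one_left (norm_nonneg _) ht
      _ ≤ _ := by linarith [norm_nonneg (J M * Z)]
  · calc ‖Z‖ ≤ r * ‖Z‖ := le_mul_of_one_le_left (norm_nonneg _) ht
      _ = ‖M * Z + J M * Z‖ := by rw [← hr, add_mul]
      _ ≤ ‖M * Z‖ + ‖J M * Z‖ := norm_add_le _ _
      _ ≤ _ := by linarith [norm_nonneg (M * (M * Z))]

variable [CompleteSpace A]

/-- Variation of constants: if `X' = b X`, `Y' = a Y` and `b` has trace zero, then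
`(J X · Y)' = J X · (a - b) · Y`. -/
lemma IsPrimitive.adj_mul_solution (hJ : IsAdjugate J) (hb : ∀ t, J (b t) = -b t)
    (hX : IsPrimitive X fun t => b t * X t) (hY : IsPrimitive Y fun t => a t * Y t) :
    IsPrimitive (fun t => J (X t) * Y t) fun t => J (X t) * ((a t - b t) * Y t) := by
  have := (hX.clm_apply J).mul hY
  refine this.congr (Eventually.of_forall fun t => ?_)
  simp only
  rw [hJ.map_mul, hb t]
  noncomm_ring

lemma adj_mul_solution_eq (hJ : IsAdjugate J) (ha : ∀ t, J (a t) = -a t)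
    (hX : IsPrimitive X fun t => a t * X t) (hX0 : X 0 = 1)
    (hY : IsPrimitive Y fun t => a t * Y t) (t : ℝ) : J (X t) * Y t = Y 0 := by
  have := (IsPrimitive.adj_mul_solution hJ ha hX hY).sub_eq 0 t
  simp only [sub_self, zero_mul, mul_zero, intervalIntegral.integral_zero, sub_eq_zero, hX0,
    hJ.map_one, one_mul] at this
  exact this

lemma adj_mul_self (hJ : IsAdjugate J) (ha : ∀ t, J (a t) = -a t)
    (hX : IsPrimitive X fun t => a t * X t) (hX0 : X 0 = 1) (t : ℝ) : J (X t) * X t = 1 := by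
  rw [adj_mul_solution_eq hJ ha hX hX0 hX, hX0]

lemma self_mul_adj (hJ : IsAdjugate J) (ha : ∀ t, J (a t) = -a t)
    (hX : IsPrimitive X fun t => a t * X t) (hX0 : X 0 = 1) (t : ℝ) : X t * J (X t) = 1 :=
  (hJ.mul_comm (X t)).symm.trans (adj_mul_self hJ ha hX hX0 t)

/-- Uniqueness: every solution is the fundamental solution times its initial value. -/
lemma solution_eq (hJ : IsAdjugate J) (ha : ∀ t, J (a t) = -a t)
    (hX : IsPrimitive X fun t => a t * X t) (hX0 : X 0 = 1)
    (hY : IsPrimitive Y fun t => a t * Y t) (t : ℝ) : Y t = X t * Y 0 := by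
  rw [← adj_mul_solution_eq hJ ha hX hX0 hY t, ← mul_assoc, self_mul_adj hJ ha hX hX0, one_mul]

/-- For a periodic system the fundamental solution is multiplied by the monodromy matrix. -/
lemma fundamental_add_period (hJ : IsAdjugate J) (ha : ∀ t, J (a t) = -a t)
    (hX : IsPrimitive X fun t => a t * X t) (hX0 : X 0 = 1)
    {T : ℝ} (hT : Function.Periodic a T) (t : ℝ) : X (t + T) = X t * X T := by
  have h := hX.comp_add_right T
  simp only [hT _] at h
  simpa using solution_eq hJ ha hX hX0 h t

/-- Stability under perturbation of the coefficients: comparison of a bounded solution of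
`Y' = a Y` with the solution of `X' = b X` that has the same initial value. -/
lemma norm_sub_fundamental_mul_le (hJ : IsAdjugate J) (ha : LocallyIntegrable a volume)
    (hb : LocallyIntegrable b volume) (hb0 : ∀ t, J (b t) = -b t)
    (hX : IsPrimitive X fun t => b t * X t) (hX0 : X 0 = 1)
    (hY : IsPrimitive Y fun t => a t * Y t) {c d t D S : ℝ} (hc : (0 : ℝ) ∈ Set.Icc c d)
    (ht : t ∈ Set.Icc c d) (hXD : ∀ s ∈ Set.Icc c d, ‖X s‖ ≤ D) (hYS : ∀ s, ‖Y s‖ ≤ S) :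
    ‖Y t - X t * Y 0‖ ≤ ‖J‖ * D ^ 2 * S * ∫ s in c..d, ‖a s - b s‖ := by
  have hD : 0 ≤ D := (norm_nonneg _).trans (hXD 0 hc)
  have hS : 0 ≤ S := (norm_nonneg _).trans (hYS 0)
  have hl : LocallyIntegrable (fun s => ‖a s - b s‖) volume :=
    locallyIntegrable_norm (ha.sub hb)
  have h1 := (IsPrimitive.adj_mul_solution hJ hb0 hX hY).sub_eq 0 t
  rw [hX0, hJ.map_one, one_mul] at h1
  have h2 : Y t - X t * Y 0
      = X t * ∫ s in (0 : ℝ)..t, J (X s) * ((a s - b s) * Y s) := by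
    rw [← h1, mul_sub, ← mul_assoc, self_mul_adj hJ hb0 hX hX0, one_mul]
  have h3 : ‖∫ s in (0 : ℝ)..t, J (X s) * ((a s - b s) * Y s)‖
      ≤ ‖J‖ * D * S * ∫ s in c..d, ‖a s - b s‖ := by
    calc _ ≤ |∫ s in (0 : ℝ)..t, ‖J‖ * D * S * ‖a s - b s‖| := by
          refine intervalIntegral.norm_integral_le_abs_of_norm_le ?_
            (locallyIntegrable_intervalIntegrable (hl.smul (‖J‖ * D * S)) _ _)
          refine (ae_restrict_iff' measurableSet_uIoc).2 (Eventually.of_forall fun s hs => ?_)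
          have hs' : s ∈ Set.Icc c d :=
            (Set.uIcc_subset_Icc hc ht) (Set.uIoc_subset_uIcc hs)
          calc ‖J (X s) * ((a s - b s) * Y s)‖
              ≤ ‖J (X s)‖ * (‖a s - b s‖ * ‖Y s‖) :=
                (norm_mul_le _ _).trans (mul_le_mul_of_nonneg_left (norm_mul_le _ _)
                  (norm_nonneg _))
            _ ≤ (‖J‖ * D) * (‖a s - b s‖ * S) := by
                gcongr
                · exact (J.le_opNorm _).trans (by gcongr; exact hXD s hs')
                · exact hYS s
            _ = ‖J‖ * D * S * ‖a s - b s‖ := by ring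
      _ = ‖J‖ * D * S * |∫ s in (0 : ℝ)..t, ‖a s - b s‖| := by
          rw [intervalIntegral.integral_const_mul, abs_mul, abs_of_nonneg (by positivity)]
      _ ≤ _ := by
          gcongr
          exact abs_intervalIntegral_le_of_mem hl (fun _ => norm_nonneg _) hc ht
  rw [h2]
  calc _ ≤ ‖X t‖ * ‖∫ s in (0 : ℝ)..t, J (X s) * ((a s - b s) * Y s)‖ := norm_mul_le _ _
    _ ≤ D * (‖J‖ * D * S * ∫ s in c..d, ‖a s - b s‖) := by
        gcongr
        exact hXD t ht
    _ = _ := by ring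

lemma intervalIntegral_le_of_forall_unit {p : ℝ → ℝ} (hp : LocallyIntegrable p volume)
    (h0 : ∀ t, 0 ≤ p t) {K : ℝ} (hK : ∀ t, ∫ s in t..(t + 1), p s ≤ K) (s : ℝ) {L : ℝ}
    (hL : 0 ≤ L) : ∫ t in s..(s + L), p t ≤ K * (L + 1) := by
  have hi := locallyIntegrable_intervalIntegrable hp
  have hn : ∀ n : ℕ, ∫ t in s..(s + n), p t ≤ K * n := by
    intro n
    induction n with
    | zero => simp
    | succ n ih =>
      rw [← intervalIntegral.integral_add_adjacent_intervals (hi s (s + n)) (hi _ _)]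
      have := hK (s + n)
      push_cast
      rw [← add_assoc]
      linarith
  have hK0 : 0 ≤ K := (intervalIntegral.integral_nonneg (by linarith) fun u _ => h0 u).trans (hK 0)
  calc ∫ t in s..(s + L), p t ≤ ∫ t in s..(s + ⌈L⌉₊), p t :=
        intervalIntegral_le_of_subinterval hp h0 le_rfl (by linarith)
          (by linarith [Nat.le_ceil L])
    _ ≤ K * ⌈L⌉₊ := hn _
    _ ≤ K * (L + 1) := by
        gcongr
        exact (Nat.ceil_lt_add_one hL).le

/-- Gordon's theorem for trace-free systems: a bounded solution of `Y' = a Y` that tends to zero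
along `T m`, `2 T m` and `-T m` vanishes, provided that `a` is approximated by `T m`-periodic
coefficients faster than any exponential of `T m`. -/
theorem eq_zero_of_periodic_approximation (hJ : IsAdjugate J) {b : ℕ → ℝ → A} {T : ℕ → ℝ}
    {K S : ℝ} (ha : LocallyIntegrable a volume) (ha0 : ∀ t, J (a t) = -a t)
    (hK : ∀ t, ∫ s in t..(t + 1), ‖a s‖ ≤ K)
    (hb : ∀ m, LocallyIntegrable (b m) volume) (hb0 : ∀ m t, J (b m t) = -b m t)
    (hT0 : ∀ m, 0 < T m) (hT : Tendsto T atTop atTop)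
    (hbT : ∀ m, Function.Periodic (b m) (T m))
    (hab : ∀ C : ℝ, Tendsto
      (fun m => Real.exp (C * T m) * ∫ s in (-T m)..(2 * T m), ‖a s - b m s‖) atTop (𝓝 0))
    (hY : IsPrimitive Y fun t => a t * Y t) (hYS : ∀ t, ‖Y t‖ ≤ S)
    (h1 : Tendsto (fun m => Y (T m)) atTop (𝓝 0))
    (h2 : Tendsto (fun m => Y (2 * T m)) atTop (𝓝 0))
    (h3 : Tendsto (fun m => Y (-T m)) atTop (𝓝 0)) (t : ℝ) : Y t = 0 := by
  obtain ⟨X₀, hX₀0, hX₀, -⟩ := exists_fundamental ha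
  suffices hzero : Y 0 = 0 by
    rw [solution_eq hJ ha0 hX₀ hX₀0 hY, hzero, mul_zero]
  choose X hX0 hX hXb using fun m => exists_fundamental (hb m)
  have hS : 0 ≤ S := (norm_nonneg _).trans (hYS 0)
  have hK0 : 0 ≤ K :=
    (intervalIntegral.integral_nonneg (by linarith) fun u _ => norm_nonneg _).trans (hK 0)
  set ε : ℕ → ℝ := fun m => ∫ s in (-T m)..(2 * T m), ‖a s - b m s‖
  have hε0 : ∀ m, 0 ≤ ε m := fun m =>
    intervalIntegral.integral_nonneg (by linarith [hT0 m]) fun _ _ => norm_nonneg _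
  set n := ‖(1 : A)‖
  set C₁ : ℝ := ‖J‖ * (2 * n) ^ 2 * S
  set C₂ : ℝ := 4 * (4 * K + 1)
  -- For large `m` the fundamental solution of the periodic system is at most exponential in `T m`.
  have hev : ∀ᶠ m in atTop, ∀ t ∈ Set.Icc (-T m) (2 * T m),
      ‖Y t - X m t * Y 0‖ ≤ C₁ * (Real.exp (C₂ * T m) * ε m) := by
    have he1 : ∀ᶠ m in atTop, ε m < 1 := by
      have := hab 0
      simp only [zero_mul, Real.exp_zero, one_mul] at this
      exact this.eventually_lt_const one_pos
    filter_upwards [he1, hT.eventually_ge_atTop 1] with m hm hTm t ht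
    have hTm0 := hT0 m
    have hmem : (0 : ℝ) ∈ Set.Icc (-T m) (2 * T m) := ⟨by linarith, by linarith⟩
    have hbn : LocallyIntegrable (fun s => ‖b m s‖) volume := locallyIntegrable_norm (hb m)
    have han : LocallyIntegrable (fun s => ‖a s‖) volume := locallyIntegrable_norm ha
    have hdn : LocallyIntegrable (fun s => ‖a s - b m s‖) volume :=
      locallyIntegrable_norm (ha.sub (hb m))
    have hβ : ∫ s in (-T m)..(2 * T m), ‖b m s‖ ≤ (4 * K + 1) * T m := by
      have hi := @locallyIntegrable_intervalIntegrable ℝ _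
      calc ∫ s in (-T m)..(2 * T m), ‖b m s‖
          ≤ ∫ s in (-T m)..(2 * T m), (‖a s‖ + ‖a s - b m s‖) := by
            refine intervalIntegral.integral_mono_on (by linarith) (hi hbn _ _)
              ((hi han _ _).add (hi hdn _ _)) fun s _ => ?_
            exact norm_le_norm_add_norm_sub _ _
        _ = (∫ s in (-T m)..(2 * T m), ‖a s‖) + ε m :=
            intervalIntegral.integral_add (hi han _ _) (hi hdn _ _)
        _ ≤ K * (3 * T m + 1) + 1 := by
            refine add_le_add ?_ hm.le
            have := intervalIntegral_le_of_forall_unit han (fun _ => norm_nonneg _) hK (-T m)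
              (L := 3 * T m) (by linarith)
            rwa [show -T m + 3 * T m = 2 * T m by ring] at this
        _ ≤ (4 * K + 1) * T m := by nlinarith
    have hXD : ∀ s ∈ Set.Icc (-T m) (2 * T m),
        ‖X m s‖ ≤ 2 * n * Real.exp (2 * ((4 * K + 1) * T m)) := fun s hs => by
      refine (hXb m s).trans ?_
      gcongr
      exact (abs_intervalIntegral_le_of_mem hbn (fun _ => norm_nonneg _) hmem hs).trans hβ
    refine (norm_sub_fundamental_mul_le hJ ha (hb m) (hb0 m) (hX m) (hX0 m) hY hmem ht hXD
      hYS).trans (le_of_eq ?_)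
    rw [mul_pow, ← Real.exp_nat_mul]
    simp only [C₁, C₂, ε]
    push_cast
    rw [show (2 : ℝ) * (2 * ((4 * K + 1) * T m)) = 4 * (4 * K + 1) * T m by ring]
    ring
  have hlim : Tendsto (fun m => ‖Y (T m)‖ + ‖Y (2 * T m)‖ + ‖Y (-T m)‖
      + 3 * (C₁ * (Real.exp (C₂ * T m) * ε m))) atTop (𝓝 0) := by
    have := ((h1.norm.add h2.norm).add h3.norm).add (((hab C₂).const_mul C₁).const_mul 3)
    simpa using this
  have hle : ‖Y 0‖ ≤ 0 := by
    refine ge_of_tendsto hlim ?_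
    filter_upwards [hev] with m hm
    have hTm := hT0 m
    set M := X m (T m)
    have hM2 : X m (2 * T m) = M * M := by
      rw [two_mul, fundamental_add_period hJ (hb0 m) (hX m) (hX0 m) (hbT m)]
    have hMi : M * J M = 1 := self_mul_adj hJ (hb0 m) (hX m) (hX0 m) _
    have hMn : X m (-T m) = J M := by
      have h := fundamental_add_period hJ (hb0 m) (hX m) (hX0 m) (hbT m) (-T m)
      rw [neg_add_cancel, hX0] at h
      calc X m (-T m) = X m (-T m) * (M * J M) := by rw [hMi, mul_one]
        _ = J M := by rw [← mul_assoc, ← h, one_mul]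
    have e1 := hm (T m) ⟨by linarith, by linarith⟩
    have e2 := hm (2 * T m) ⟨by linarith, by linarith⟩
    have e3 := hm (-T m) ⟨by linarith, by linarith⟩
    rw [hM2] at e2
    rw [hMn] at e3
    have key := norm_le_of_mul_adj_eq_one hJ (Z := Y 0) hMi
    have tri : ∀ U V : A, ‖V‖ ≤ ‖U‖ + ‖U - V‖ := fun U V => by
      exact norm_le_norm_add_norm_sub _ _
    have f1 := tri (Y (T m)) (M * Y 0)
    have f2 := tri (Y (2 * T m)) (M * M * Y 0)
    have f3 := tri (Y (-T m)) (J M * Y 0)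
    rw [← mul_assoc] at key
    linarith
  exact norm_le_zero_iff.1 hle

end TraceZero

/-! ### Uniformly locally integrable functions -/

lemma locallyIntegrable_of_unit {E : Type*} [NormedAddCommGroup E] {f : ℝ → E}
    (h : ∀ t : ℝ, IntegrableOn f (Set.Icc t (t + 1))) : LocallyIntegrable f volume := fun x =>
  ⟨Set.Icc (x - 1 / 2) (x - 1 / 2 + 1), Icc_mem_nhds (by linarith) (by linarith), h _⟩

lemma integral_norm_sq_eq {E : Type*} [NormedAddCommGroup E] {f : ℝ → E} {μ : Measure ℝ}
    (hf : AEStronglyMeasurable f μ) : ∫ x, ‖f x‖ ^ 2 ∂μ = (eLpNorm f 2 μ).toReal ^ 2 := by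
  have h := eLpNorm_nnreal_pow_eq_lintegral (f := f) (μ := μ) (p := 2) two_ne_zero
  rw [integral_eq_lintegral_of_nonneg_ae (Eventually.of_forall fun x => sq_nonneg _)
    (hf.norm.pow 2), ← ENNReal.toReal_pow]
  congr 1
  simp only [NNReal.coe_ofNat, ENNReal.rpow_ofNat, ENNReal.coe_ofNat] at h
  rw [h]
  exact lintegral_congr fun x => by
    rw [ENNReal.ofReal_pow (norm_nonneg _), ofReal_norm]

lemma integral_norm_eq_toReal_eLpNorm {E : Type*} [NormedAddCommGroup E] {f : ℝ → E}
    {μ : Measure ℝ} (hf : AEStronglyMeasurable f μ) :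
    ∫ x, ‖f x‖ ∂μ = (eLpNorm f 1 μ).toReal := by
  rw [integral_norm_eq_lintegral_enorm hf, eLpNorm_one_eq_lintegral_enorm]

/-- The Cauchy–Schwarz inequality on an interval. -/
lemma integral_mul_le_sqrt {f g : ℝ → ℝ} (hf : AEStronglyMeasurable f volume)
    (hg : AEStronglyMeasurable g volume) (hf2 : LocallyIntegrable (fun x => f x ^ 2) volume)
    (hg2 : LocallyIntegrable (fun x => g x ^ 2) volume) {a b : ℝ} (hab : a ≤ b) :
    ∫ x in a..b, |f x| * |g x| ≤ √(∫ x in a..b, f x ^ 2) * √(∫ x in a..b, g x ^ 2) := by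
  have key : ∀ {u : ℝ → ℝ}, AEStronglyMeasurable u volume →
      LocallyIntegrable (fun x => u x ^ 2) volume →
      MemLp u (ENNReal.ofReal 2) (volume.restrict (Set.Ioc a b)) := fun hu hu2 => by
    rw [ENNReal.ofReal_ofNat]
    exact (memLp_two_iff_integrable_sq hu.restrict).2
      (locallyIntegrable_intervalIntegrable hu2 a b).1
  have h := integral_mul_norm_le_Lp_mul_Lq (μ := volume.restrict (Set.Ioc a b))
    (p := 2) (q := 2) (by constructor <;> norm_num) (key hf hf2) (key hg hg2)
  simp only [intervalIntegral.integral_of_le hab]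
  simpa [Real.sqrt_eq_rpow] using h

lemma locallyIntegrable_mul_of_sq {f g : ℝ → ℝ} (hf : AEStronglyMeasurable f volume)
    (hg : AEStronglyMeasurable g volume) (hf2 : LocallyIntegrable (fun x => f x ^ 2) volume)
    (hg2 : LocallyIntegrable (fun x => g x ^ 2) volume) :
    LocallyIntegrable (fun x => f x * g x) volume := by
  refine (hf2.add hg2).mono (hf.mul hg) (Eventually.of_forall fun x => ?_)
  rw [Real.norm_eq_abs, Pi.add_apply, Real.norm_of_nonneg (by positivity), abs_mul]
  nlinarith [sq_nonneg (|f x| - |g x|), sq_abs (f x), sq_abs (g x)]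

namespace MemLpUnif

variable {f : ℝ → ℝ}

lemma memLp {p : ℝ≥0∞} (h : MemLpUnif p f) (t : ℝ) :
    MemLp f p (volume.restrict (Set.Icc t (t + 1))) :=
  ⟨h.1.restrict, (le_iSup (fun t : ℝ => eLpNorm f p (volume.restrict (Set.Icc t (t + 1)))) t).trans_lt
    h.2⟩

lemma locallyIntegrable {p : ℝ≥0∞} (hp : 1 ≤ p) (h : MemLpUnif p f) :
    LocallyIntegrable f volume :=
  locallyIntegrable_of_unit fun t => (h.memLp t).integrable hp

lemma locallyIntegrable_sq (h : MemLpUnif 2 f) : LocallyIntegrable (fun x => f x ^ 2) volume :=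
  locallyIntegrable_of_unit fun t => (h.memLp t).integrable_sq

lemma toReal_le {p : ℝ≥0∞} (h : MemLpUnif p f) (t : ℝ) :
    (eLpNorm f p (volume.restrict (Set.Ioc t (t + 1)))).toReal
      ≤ (⨆ t : ℝ, eLpNorm f p (volume.restrict (Set.Icc t (t + 1)))).toReal := by
  refine ENNReal.toReal_mono h.2.ne ?_
  rw [restrict_Ioc_eq_restrict_Icc]
  exact le_iSup (fun t : ℝ => eLpNorm f p (volume.restrict (Set.Icc t (t + 1)))) t

lemma exists_integral_abs_le (h : MemLpUnif 1 f) : ∃ K, ∀ t, ∫ s in t..(t + 1), |f s| ≤ K :=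
  ⟨_, fun t => by
    rw [intervalIntegral.integral_of_le (by linarith)]
    exact (integral_norm_eq_toReal_eLpNorm h.1.restrict).le.trans (h.toReal_le t)⟩

lemma exists_integral_sq_le (h : MemLpUnif 2 f) : ∃ K, ∀ t, ∫ s in t..(t + 1), f s ^ 2 ≤ K :=
  ⟨_, fun t => by
    rw [intervalIntegral.integral_of_le (by linarith)]
    have := integral_norm_sq_eq (μ := volume.restrict (Set.Ioc t (t + 1))) h.1.restrict
    simp only [Real.norm_eq_abs, sq_abs] at this
    rw [this]
    exact pow_le_pow_left₀ ENNReal.toReal_nonneg (h.toReal_le t) 2⟩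

end MemLpUnif

/-! ### The first order system of the Schrödinger equation -/

/-- The `2 × 2` complex matrices as a normed algebra whose norm is multiplicative on scalar
matrices. The algebra is kept abstract because matrices carry no global norm. -/
lemma exists_matrix_algebra :
    ∃ (A : Type) (_ : NormedRing A) (_ : NormedAlgebra ℝ A) (_ : FiniteDimensional ℝ A)
      (e : Matrix (Fin 2) (Fin 2) ℂ ≃ₐ[ℝ] A), ∀ (c : ℂ) (Z : A),
        ‖e (c • 1) * Z‖ = ‖c‖ * ‖Z‖ := by
  let i1 : NormedRing (Matrix (Fin 2) (Fin 2) ℂ) := Matrix.linftyOpNormedRing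
  let i2 : NormedAlgebra ℝ (Matrix (Fin 2) (Fin 2) ℂ) := Matrix.linftyOpNormedAlgebra
  refine ⟨Matrix (Fin 2) (Fin 2) ℂ, i1, i2, ?_, AlgEquiv.refl, fun c Z => ?_⟩
  · exact inferInstanceAs (Module.Finite ℝ (Matrix (Fin 2) (Fin 2) ℂ))
  · let : NormedSpace ℂ (Matrix (Fin 2) (Fin 2) ℂ) := Matrix.linftyOpNormedSpace
    have h : (AlgEquiv.refl (R := ℝ) (c • (1 : Matrix (Fin 2) (Fin 2) ℂ))) * Z = c • Z := by
      change (c • (1 : Matrix (Fin 2) (Fin 2) ℂ)) * Z = c • Z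
      exact (smul_mul_assoc c _ Z).trans (by rw [one_mul])
    rw [h]
    exact norm_smul c Z

/-- The adjugate of `2 × 2` matrices as a linear map. -/
def adjugateLin : Matrix (Fin 2) (Fin 2) ℂ →ₗ[ℝ] Matrix (Fin 2) (Fin 2) ℂ where
  toFun := Matrix.adjugate
  map_add' X Y := by
    simp only [Matrix.adjugate_fin_two]
    ext i j
    fin_cases i <;> fin_cases j <;> simp [add_comm]
  map_smul' c X := by
    simp only [Matrix.adjugate_fin_two]
    ext i j
    fin_cases i <;> fin_cases j <;> simp

lemma add_adjugate (X : Matrix (Fin 2) (Fin 2) ℂ) :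
    X + adjugateLin X = X.trace • (1 : Matrix (Fin 2) (Fin 2) ℂ) := by
  change X + X.adjugate = _
  rw [Matrix.adjugate_fin_two]
  ext i j
  fin_cases i <;> fin_cases j <;> simp [Matrix.trace_fin_two, add_comm]

lemma isAdjugate_adjugateLin {A : Type*} [NormedRing A] [NormedAlgebra ℝ A]
    [FiniteDimensional ℝ A] (e : Matrix (Fin 2) (Fin 2) ℂ ≃ₐ[ℝ] A)
    (he : ∀ (c : ℂ) (Z : A), ‖e (c • 1) * Z‖ = ‖c‖ * ‖Z‖) :
    IsAdjugate (LinearMap.toContinuousLinearMap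
      (e.toLinearMap ∘ₗ adjugateLin ∘ₗ e.symm.toLinearMap)) := by
  have hadd : ∀ X : A, X + e (adjugateLin (e.symm X)) = e ((e.symm X).trace • 1) := fun X => by
    rw [← add_adjugate, map_add, AlgEquiv.apply_symm_apply]
  constructor
  · intro X Y
    change e (Matrix.adjugate (e.symm (X * Y)))
      = e (Matrix.adjugate (e.symm Y)) * e (Matrix.adjugate (e.symm X))
    rw [map_mul, Matrix.adjugate_mul_distrib, map_mul]
  · change e (Matrix.adjugate (e.symm 1)) = 1
    rw [map_one, Matrix.adjugate_one, map_one]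
  · intro X Z
    change (X + e (adjugateLin (e.symm X))) * Z = Z * (X + e (adjugateLin (e.symm X)))
    rw [hadd]
    obtain ⟨Z, rfl⟩ := e.surjective Z
    rw [← map_mul, ← map_mul, smul_mul_assoc, mul_smul_comm, one_mul, mul_one]
  · intro X
    refine ⟨‖(e.symm X).trace‖, fun Z => ?_⟩
    change ‖(X + e (adjugateLin (e.symm X))) * Z‖ = _
    rw [hadd, he]

/-- The matrix unit with indices `i`, `j`, as a continuous linear map into a normed algebra
isomorphic to the `2 × 2` matrices. -/
noncomputable def matUnit {A : Type*} [NormedRing A] [NormedAlgebra ℝ A]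
    (e : Matrix (Fin 2) (Fin 2) ℂ ≃ₐ[ℝ] A) (i j : Fin 2) : ℂ →L[ℝ] A :=
  LinearMap.toContinuousLinearMap (e.toLinearMap ∘ₗ Matrix.singleLinearMap ℝ i j)

section MatUnit

variable {A : Type*} [NormedRing A] [NormedAlgebra ℝ A] (e : Matrix (Fin 2) (Fin 2) ℂ ≃ₐ[ℝ] A)

lemma matUnit_apply (i j : Fin 2) (c : ℂ) : matUnit e i j c = e (Matrix.single i j c) := rfl

lemma matUnit_mul_same (i j k : Fin 2) (c d : ℂ) :
    matUnit e i j c * matUnit e j k d = matUnit e i k (c * d) := by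
  simp only [matUnit_apply, ← map_mul, Matrix.single_mul_single_same]

lemma matUnit_mul_of_ne (i j k l : Fin 2) (h : j ≠ k) (c d : ℂ) :
    matUnit e i j c * matUnit e k l d = 0 := by
  simp only [matUnit_apply, ← map_mul, Matrix.single_mul_single_of_ne _ _ _ _ h, map_zero]

/-- The coefficient matrix `!![σ, 1; ρ, -σ]`. -/
noncomputable def coeffMat (σ ρ : ℂ) : A :=
  matUnit e 0 0 σ + matUnit e 0 1 1 + matUnit e 1 0 ρ + matUnit e 1 1 (-σ)

/-- The matrix with first column `(u, v)` and second column zero. -/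
noncomputable def colMat (u v : ℂ) : A := matUnit e 0 0 u + matUnit e 1 0 v

lemma coeffMat_mul_colMat (σ ρ u v : ℂ) :
    coeffMat e σ ρ * colMat e u v = colMat e (σ * u + v) (ρ * u - σ * v) := by
  have h01 : (0 : Fin 2) ≠ 1 := by decide
  simp only [coeffMat, colMat, add_mul, mul_add, matUnit_mul_same, matUnit_mul_of_ne e _ _ _ _ h01,
    matUnit_mul_of_ne e _ _ _ _ h01.symm, map_add, map_sub, one_mul, neg_mul, map_neg]
  abel

lemma colMat_eq_zero {u v : ℂ} (h : colMat e u v = 0) : u = 0 := by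
  have h1 : Matrix.single 0 0 u + Matrix.single 1 0 v = (0 : Matrix (Fin 2) (Fin 2) ℂ) := by
    apply e.injective
    rw [map_add, map_zero]
    exact h
  simpa using congrFun (congrFun h1 0) 0

lemma adjugate_coeffMat [FiniteDimensional ℝ A] (σ ρ : ℂ) :
    LinearMap.toContinuousLinearMap (e.toLinearMap ∘ₗ adjugateLin ∘ₗ e.symm.toLinearMap)
      (coeffMat e σ ρ) = -coeffMat e σ ρ := by
  have h : coeffMat e σ ρ = e !![σ, 1; ρ, -σ] := by
    simp only [coeffMat, matUnit_apply, ← map_add]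
    congr 1
    ext i j
    fin_cases i <;> fin_cases j <;> simp
  rw [h]
  change e (Matrix.adjugate (e.symm (e !![σ, 1; ρ, -σ]))) = _
  rw [AlgEquiv.symm_apply_apply, Matrix.adjugate_fin_two, ← map_neg]
  congr 1
  ext i j
  fin_cases i <;> fin_cases j <;> simp

/-- A common bound for the norms of the matrix units. -/
noncomputable def unitBound : ℝ :=
  ‖matUnit e 0 0‖ + ‖matUnit e 0 1‖ + ‖matUnit e 1 0‖ + ‖matUnit e 1 1‖

lemma unitBound_nonneg : 0 ≤ unitBound e := by unfold unitBound; positivity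

lemma norm_matUnit_le (i j : Fin 2) (c : ℂ) : ‖matUnit e i j c‖ ≤ unitBound e * ‖c‖ := by
  refine ((matUnit e i j).le_opNorm c).trans ?_
  gcongr
  have h1 := norm_nonneg (matUnit e 0 0)
  have h2 := norm_nonneg (matUnit e 0 1)
  have h3 := norm_nonneg (matUnit e 1 0)
  have h4 := norm_nonneg (matUnit e 1 1)
  unfold unitBound
  fin_cases i <;> fin_cases j <;> simp only [Fin.zero_eta, Fin.mk_one] <;> linarith

lemma norm_coeffMat_le (σ ρ : ℂ) : ‖coeffMat e σ ρ‖ ≤ unitBound e * (2 * ‖σ‖ + 1 + ‖ρ‖) := by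
  refine (norm_add₄_le).trans ?_
  have h1 := norm_matUnit_le e 0 0 σ
  have h2 := norm_matUnit_le e 0 1 1
  have h3 := norm_matUnit_le e 1 0 ρ
  have h4 := norm_matUnit_le e 1 1 (-σ)
  rw [norm_neg] at h4
  rw [norm_one] at h2
  linarith

lemma norm_coeffMat_sub_le (σ ρ σ' ρ' : ℂ) :
    ‖coeffMat e σ ρ - coeffMat e σ' ρ'‖ ≤ unitBound e * (2 * ‖σ - σ'‖ + ‖ρ - ρ'‖) := by
  have h : coeffMat e σ ρ - coeffMat e σ' ρ'
      = matUnit e 0 0 (σ - σ') + matUnit e 1 0 (ρ - ρ') + matUnit e 1 1 (-(σ - σ')) := by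
    simp only [coeffMat, map_sub, map_neg]
    abel
  rw [h]
  refine (norm_add₃_le).trans ?_
  have h1 := norm_matUnit_le e 0 0 (σ - σ')
  have h3 := norm_matUnit_le e 1 0 (ρ - ρ')
  have h4 := norm_matUnit_le e 1 1 (-(σ - σ'))
  rw [norm_neg] at h4
  linarith

lemma norm_colMat_le (u v : ℂ) : ‖colMat e u v‖ ≤ unitBound e * (‖u‖ + ‖v‖) := by
  refine (norm_add_le _ _).trans ?_
  linarith [norm_matUnit_le e 0 0 u, norm_matUnit_le e 1 0 v]

lemma locallyIntegrable_clm_apply {E F : Type*} [NormedAddCommGroup E] [NormedSpace ℝ E]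
    [NormedAddCommGroup F] [NormedSpace ℝ F] (L : E →L[ℝ] F) {f : ℝ → E}
    (hf : LocallyIntegrable f volume) : LocallyIntegrable (fun x => L (f x)) volume :=
  fun x => L.integrableAtFilter_comp (hf x)

lemma locallyIntegrable_coeffMat {σ ρ : ℝ → ℂ} (hσ : LocallyIntegrable σ volume)
    (hρ : LocallyIntegrable ρ volume) :
    LocallyIntegrable (fun x => coeffMat e (σ x) (ρ x)) volume :=
  (((locallyIntegrable_clm_apply (matUnit e 0 0) hσ).add
    (locallyIntegrable_const _)).add (locallyIntegrable_clm_apply (matUnit e 1 0) hρ)).add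
    (locallyIntegrable_clm_apply (matUnit e 1 1) hσ.neg)

end MatUnit

/-! ### Gordon's argument for the Schrödinger equation -/

lemma exists_norm_le_of_tendsto_cocompact {F : ℝ → ℂ} (hF : Continuous F)
    (h : Tendsto F (cocompact ℝ) (𝓝 0)) : ∃ S, ∀ t, ‖F t‖ ≤ S := by
  let G : ZeroAtInftyContinuousMap ℝ ℂ := ⟨⟨F, hF⟩, h⟩
  obtain ⟨S, hS⟩ := G.isBounded_range.exists_norm_le
  exact ⟨S, fun t => hS _ ⟨t, rfl⟩⟩

lemma MemLpUnif.locallyIntegrable_sub_sq {f g : ℝ → ℝ} (hf : MemLpUnif 2 f)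
    (hg : MemLpUnif 2 g) : LocallyIntegrable (fun x => (f x - g x) ^ 2) volume := by
  have h := (hf.locallyIntegrable_sq.sub ((locallyIntegrable_mul_of_sq hf.1 hg.1
    hf.locallyIntegrable_sq hg.locallyIntegrable_sq).smul (2 : ℝ))).add hg.locallyIntegrable_sq
  rw [show (fun x => (f x - g x) ^ 2) = (fun x => f x ^ 2) - (2 : ℝ) • (fun x => f x * g x)
    + fun x => g x ^ 2 from funext fun x => by
      change (f x - g x) ^ 2 = f x ^ 2 - 2 * (f x * g x) + g x ^ 2
      ring]
  exact h

lemma sqrt_le_one_add {x : ℝ} (hx : 0 ≤ x) : √x ≤ 1 + x := by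
  rw [Real.sqrt_le_left (by linarith)]
  nlinarith

/-- The distance of the coefficients of the first order systems of two potentials, in terms of the
distance of the potentials. As `σ²` enters the coefficients, so does the `L₂` norm of `σ` on the
interval, which grows with `T`; the factor `exp T` is a convenient bound for it. -/
lemma integral_coeff_sub_le {σ τ σ' τ' : ℝ → ℝ} (hσ : MemLpUnif 2 σ) (hτ : MemLpUnif 1 τ)
    (hσ' : MemLpUnif 2 σ') (hτ' : MemLpUnif 1 τ') {K : ℝ}
    (hK : ∀ t, ∫ s in t..(t + 1), σ s ^ 2 ≤ K) {T δ : ℝ} (hT : 0 < T) (hδ0 : 0 ≤ δ) (hδ1 : δ ≤ 1)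
    (h1 : ∫ s in (-T)..(2 * T), (σ s - σ' s) ^ 2 ≤ δ ^ 2)
    (h2 : ∫ s in (-T)..(2 * T), |τ s - τ' s| ≤ δ) :
    ∫ s in (-T)..(2 * T), (2 * |σ s - σ' s| + |τ s - τ' s| + |σ s ^ 2 - σ' s ^ 2|)
      ≤ (6 + 6 * K) * Real.exp T * δ := by
  have hle : -T ≤ 2 * T := by linarith
  have hd2 := hσ.locallyIntegrable_sub_sq hσ'
  have hdm : AEStronglyMeasurable (fun s => σ s - σ' s) volume := hσ.1.sub hσ'.1
  have hK0 : 0 ≤ K :=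
    (intervalIntegral.integral_nonneg (by linarith) fun u _ => sq_nonneg _).trans (hK 0)
  have hi := @locallyIntegrable_intervalIntegrable ℝ _
  have hd : LocallyIntegrable (fun s => |σ s - σ' s|) volume :=
    locallyIntegrable_norm ((hσ.locallyIntegrable one_le_two).sub (hσ'.locallyIntegrable one_le_two))
  have ht : LocallyIntegrable (fun s => |τ s - τ' s|) volume :=
    locallyIntegrable_norm ((hτ.locallyIntegrable le_rfl).sub (hτ'.locallyIntegrable le_rfl))
  have hs : LocallyIntegrable (fun s => |σ s ^ 2 - σ' s ^ 2|) volume :=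
    locallyIntegrable_norm (hσ.locallyIntegrable_sq.sub hσ'.locallyIntegrable_sq)
  have hσd : LocallyIntegrable (fun s => |σ s| * |σ s - σ' s|) volume := by
    have := locallyIntegrable_norm (locallyIntegrable_mul_of_sq hσ.1 hdm hσ.locallyIntegrable_sq hd2)
    simpa only [norm_mul, Real.norm_eq_abs] using this
  have hsq : √(∫ s in (-T)..(2 * T), (σ s - σ' s) ^ 2) ≤ δ := by
    rw [← Real.sqrt_sq hδ0]
    exact Real.sqrt_le_sqrt h1
  have e1 : ∫ s in (-T)..(2 * T), |σ s - σ' s| ≤ (1 + 3 * T) * δ := by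
    have h := integral_mul_le_sqrt (f := fun _ => (1 : ℝ)) aestronglyMeasurable_const hdm
      (locallyIntegrable_const _) hd2 hle
    simp only [abs_one, one_mul, one_pow, intervalIntegral.integral_const, smul_eq_mul,
      mul_one] at h
    refine h.trans (mul_le_mul ?_ hsq (Real.sqrt_nonneg _) (by linarith))
    rw [show 2 * T - -T = 3 * T by ring]
    exact sqrt_le_one_add (by linarith)
  have e2 : ∫ s in (-T)..(2 * T), |σ s| * |σ s - σ' s| ≤ (1 + K * (3 * T + 1)) * δ := by
    refine (integral_mul_le_sqrt hσ.1 hdm hσ.locallyIntegrable_sq hd2 hle).trans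
      (mul_le_mul ?_ hsq (Real.sqrt_nonneg _) (by positivity))
    refine (sqrt_le_one_add (intervalIntegral.integral_nonneg hle fun u _ => sq_nonneg _)).trans ?_
    have := intervalIntegral_le_of_forall_unit hσ.locallyIntegrable_sq (fun _ => sq_nonneg _) hK (-T)
      (L := 3 * T) (by linarith)
    rw [show -T + 3 * T = 2 * T by ring] at this
    linarith
  have e3 : ∫ s in (-T)..(2 * T), |σ s ^ 2 - σ' s ^ 2|
      ≤ δ + 2 * ((1 + K * (3 * T + 1)) * δ) := by
    calc _ ≤ ∫ s in (-T)..(2 * T), ((σ s - σ' s) ^ 2 + 2 * (|σ s| * |σ s - σ' s|)) := by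
          refine intervalIntegral.integral_mono_on hle (hi hs _ _)
            ((hi hd2 _ _).add ((hi hσd _ _).const_mul 2)) fun s _ => ?_
          have : σ s ^ 2 - σ' s ^ 2 = 2 * (σ s * (σ s - σ' s)) - (σ s - σ' s) ^ 2 := by ring
          rw [this, ← abs_mul]
          refine (abs_sub _ _).trans ?_
          rw [abs_mul 2, abs_two, abs_of_nonneg (sq_nonneg (σ s - σ' s))]
          linarith
      _ = (∫ s in (-T)..(2 * T), (σ s - σ' s) ^ 2)
          + 2 * ∫ s in (-T)..(2 * T), |σ s| * |σ s - σ' s| := by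
          rw [intervalIntegral.integral_add (hi hd2 _ _) ((hi hσd _ _).const_mul 2),
            intervalIntegral.integral_const_mul]
      _ ≤ δ + 2 * ((1 + K * (3 * T + 1)) * δ) := by
          have : δ ^ 2 ≤ δ := by nlinarith
          linarith
  rw [intervalIntegral.integral_add (((hi hd _ _).const_mul 2).add (hi ht _ _)) (hi hs _ _),
    intervalIntegral.integral_add ((hi hd _ _).const_mul 2) (hi ht _ _),
    intervalIntegral.integral_const_mul]
  calc _ ≤ 2 * ((1 + 3 * T) * δ) + δ + (δ + 2 * ((1 + K * (3 * T + 1)) * δ)) := by linarith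
    _ ≤ (6 + 6 * K) * (1 + T) * δ := by
        have : 0 ≤ K * δ := by positivity
        nlinarith
    _ ≤ (6 + 6 * K) * Real.exp T * δ := by
        gcongr
        linarith [Real.add_one_le_exp T]

/-- Gordon's argument: a solution of the first order system of `-y'' + (σ' + τ) y = z y` that
vanishes at infinity is zero. -/
theorem eq_zero_of_gordon {σ τ : ℝ → ℝ} (hσ : MemLpUnif 2 σ) (hτ : MemLpUnif 1 τ)
    {T : ℕ → ℝ} {σm τm : ℕ → ℝ → ℝ} (hT0 : ∀ m, 0 < T m) (hT : Tendsto T atTop atTop)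
    (hσm : ∀ m, MemLpUnif 2 (σm m) ∧ Function.Periodic (σm m) (T m))
    (hτm : ∀ m, MemLpUnif 1 (τm m) ∧ Function.Periodic (τm m) (T m))
    (hlim : ∀ C : ℝ, Tendsto
        (fun m => ENNReal.ofReal (Real.exp (C * T m)) *
          (eLpNorm (σ - σm m) 2 (volume.restrict (Set.Icc (-T m) (2 * T m))) +
            eLpNorm (τ - τm m) 1 (volume.restrict (Set.Icc (-T m) (2 * T m)))))
        atTop (𝓝 0))
    {z : ℂ} {U V : ℝ → ℂ} (hU : IsPrimitive U fun t => σ t * U t + V t)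
    (hV : IsPrimitive V fun t => ((τ t : ℂ) - z - (σ t : ℂ) ^ 2) * U t - σ t * V t)
    (hU0 : Tendsto U (cocompact ℝ) (𝓝 0)) (hV0 : Tendsto V (cocompact ℝ) (𝓝 0)) (t : ℝ) :
    U t = 0 := by
  obtain ⟨A, _, _, _, e, he⟩ := exists_matrix_algebra
  have : CompleteSpace A := FiniteDimensional.complete ℝ A
  have hi := @locallyIntegrable_intervalIntegrable ℝ _
  set B := unitBound e
  have hB : 0 ≤ B := unitBound_nonneg e
  obtain ⟨K, hK⟩ := hσ.exists_integral_sq_le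
  obtain ⟨K', hK'⟩ := hτ.exists_integral_abs_le
  let ρ : (ℝ → ℝ) → (ℝ → ℝ) → ℝ → ℂ := fun σ τ t => (τ t : ℂ) - z - (σ t : ℂ) ^ 2
  have hcl : ∀ {f : ℝ → ℝ}, LocallyIntegrable f volume →
      LocallyIntegrable (fun x => (f x : ℂ)) volume := fun hf =>
    locallyIntegrable_clm_apply Complex.ofRealCLM hf
  have hρ : ∀ {σ τ : ℝ → ℝ}, MemLpUnif 2 σ → MemLpUnif 1 τ →
      LocallyIntegrable (ρ σ τ) volume := fun h1 h2 => by
    refine ((hcl (h2.locallyIntegrable le_rfl)).sub (locallyIntegrable_const z)).sub ?_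
    simpa only [Complex.ofReal_pow] using hcl h1.locallyIntegrable_sq
  have hcoef : ∀ {σ τ : ℝ → ℝ}, MemLpUnif 2 σ → MemLpUnif 1 τ →
      LocallyIntegrable (fun t => coeffMat e (σ t) (ρ σ τ t)) volume := fun h1 h2 =>
    locallyIntegrable_coeffMat e (hcl (h1.locallyIntegrable one_le_two)) (hρ h1 h2)
  have hY : IsPrimitive (fun t => colMat e (U t) (V t))
      (fun t => coeffMat e (σ t) (ρ σ τ t) * colMat e (U t) (V t)) := by
    simp only [coeffMat_mul_colMat]
    exact (hU.clm_apply (matUnit e 0 0)).add (hV.clm_apply (matUnit e 1 0))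
  have hYlim : Tendsto (fun t => colMat e (U t) (V t)) (cocompact ℝ) (𝓝 0) := by
    have h := (((matUnit e 0 0).continuous.tendsto 0).comp hU0).add
      (((matUnit e 1 0).continuous.tendsto 0).comp hV0)
    rw [map_zero, map_zero, add_zero] at h
    exact h
  obtain ⟨S₁, hS₁⟩ := exists_norm_le_of_tendsto_cocompact hU.continuous hU0
  obtain ⟨S₂, hS₂⟩ := exists_norm_le_of_tendsto_cocompact hV.continuous hV0
  have hnear : ∀ C : ℝ, Tendsto (fun m => Real.exp (C * T m) *
      ∫ s in (-T m)..(2 * T m), ‖coeffMat e (σ s) (ρ σ τ s)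
        - coeffMat e (σm m s) (ρ (σm m) (τm m) s)‖) atTop (𝓝 0) := by
    intro C
    set D : ℕ → ℝ≥0∞ := fun m =>
      eLpNorm (σ - σm m) 2 (volume.restrict (Set.Icc (-T m) (2 * T m))) +
        eLpNorm (τ - τm m) 1 (volume.restrict (Set.Icc (-T m) (2 * T m)))
    have hDr : ∀ C : ℝ, Tendsto (fun m => Real.exp (C * T m) * (D m).toReal) atTop (𝓝 0) := by
      intro C
      have := (ENNReal.tendsto_toReal ENNReal.zero_ne_top).comp (hlim C)
      simpa [Function.comp_def, ENNReal.toReal_mul, (Real.exp_pos _).le] using this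
    have hev : ∀ᶠ m in atTop, D m < 1 := by
      have := hlim 0
      simp only [zero_mul, Real.exp_zero, ENNReal.ofReal_one, one_mul] at this
      exact this.eventually_lt_const one_pos
    refine squeeze_zero' (Eventually.of_forall fun m => mul_nonneg (Real.exp_pos _).le
      (intervalIntegral.integral_nonneg (by linarith [hT0 m]) fun _ _ => norm_nonneg _)) ?_
      (by simpa using (hDr (C + 1)).const_mul (B * (6 + 6 * K)))
    filter_upwards [hev] with m hm
    have hTm := hT0 m
    have hle : -T m ≤ 2 * T m := by linarith
    have hD1 : (D m).toReal ≤ 1 := by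
      have := ENNReal.toReal_mono ENNReal.one_ne_top hm.le
      simpa using this
    have hDt : D m ≠ ∞ := (hm.trans ENNReal.one_lt_top).ne
    have hσs := (hσm m).1
    have hτs := (hτm m).1
    have key := integral_coeff_sub_le hσ hτ hσs hτs hK hTm ENNReal.toReal_nonneg hD1 (by
        have h := integral_norm_sq_eq (μ := volume.restrict (Set.Icc (-T m) (2 * T m)))
          (hσ.1.sub hσs.1).restrict
        simp only [Pi.sub_apply, Real.norm_eq_abs, sq_abs] at h
        rw [intervalIntegral.integral_of_le hle, ← integral_Icc_eq_integral_Ioc, h]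
        exact pow_le_pow_left₀ ENNReal.toReal_nonneg
          (ENNReal.toReal_mono hDt le_self_add) 2) (by
        have h := integral_norm_eq_toReal_eLpNorm
          (μ := volume.restrict (Set.Icc (-T m) (2 * T m))) (hτ.1.sub hτs.1).restrict
        simp only [Pi.sub_apply, Real.norm_eq_abs] at h
        rw [intervalIntegral.integral_of_le hle, ← integral_Icc_eq_integral_Ioc, h]
        exact ENNReal.toReal_mono hDt le_add_self)
    have hd : LocallyIntegrable (fun s => |σ s - σm m s|) volume :=
      locallyIntegrable_norm ((hσ.locallyIntegrable one_le_two).sub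
        (hσs.locallyIntegrable one_le_two))
    have ht : LocallyIntegrable (fun s => |τ s - τm m s|) volume :=
      locallyIntegrable_norm ((hτ.locallyIntegrable le_rfl).sub (hτs.locallyIntegrable le_rfl))
    have hs : LocallyIntegrable (fun s => |σ s ^ 2 - σm m s ^ 2|) volume :=
      locallyIntegrable_norm (hσ.locallyIntegrable_sq.sub hσs.locallyIntegrable_sq)
    have hint : ∫ s in (-T m)..(2 * T m), ‖coeffMat e (σ s) (ρ σ τ s)
        - coeffMat e (σm m s) (ρ (σm m) (τm m) s)‖
        ≤ B * ((6 + 6 * K) * Real.exp (T m) * (D m).toReal) := by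
      calc _ ≤ ∫ s in (-T m)..(2 * T m), B * (2 * |σ s - σm m s| + |τ s - τm m s|
            + |σ s ^ 2 - σm m s ^ 2|) := by
            refine intervalIntegral.integral_mono_on hle (hi (locallyIntegrable_norm
              ((hcoef hσ hτ).sub (hcoef hσs hτs))) _ _) (((((hi hd _ _).const_mul 2).add
              (hi ht _ _)).add (hi hs _ _)).const_mul B) fun s _ => ?_
            refine (norm_coeffMat_sub_le e _ _ _ _).trans ?_
            refine mul_le_mul_of_nonneg_left ?_ hB
            have h1 : ‖(σ s : ℂ) - σm m s‖ = |σ s - σm m s| := by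
              rw [← Complex.ofReal_sub, Complex.norm_real, Real.norm_eq_abs]
            have h2 : ρ σ τ s - ρ (σm m) (τm m) s
                = ((τ s - τm m s - (σ s ^ 2 - σm m s ^ 2) : ℝ) : ℂ) := by
              simp only [ρ]
              push_cast
              ring
            rw [h1, h2, Complex.norm_real, Real.norm_eq_abs]
            linarith [abs_sub (τ s - τm m s) (σ s ^ 2 - σm m s ^ 2)]
        _ = B * ∫ s in (-T m)..(2 * T m), (2 * |σ s - σm m s| + |τ s - τm m s|
            + |σ s ^ 2 - σm m s ^ 2|) := intervalIntegral.integral_const_mul _ _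
        _ ≤ _ := mul_le_mul_of_nonneg_left key hB
    calc _ ≤ Real.exp (C * T m) * (B * ((6 + 6 * K) * Real.exp (T m) * (D m).toReal)) :=
          mul_le_mul_of_nonneg_left hint (Real.exp_pos _).le
      _ = B * (6 + 6 * K) * (Real.exp ((C + 1) * T m) * (D m).toReal) := by
          rw [show (C + 1) * T m = C * T m + T m by ring, Real.exp_add]
          ring
  have hbound : ∀ t, ∫ s in t..(t + 1), ‖coeffMat e (σ s) (ρ σ τ s)‖
      ≤ B * (2 + 2 * K + K' + ‖z‖) := by
    intro t
    have hts : LocallyIntegrable (fun s => |τ s|) volume :=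
      locallyIntegrable_norm (hτ.locallyIntegrable le_rfl)
    calc _ ≤ ∫ s in t..(t + 1), B * ((2 + ‖z‖) + 2 * σ s ^ 2 + |τ s|) := by
          refine intervalIntegral.integral_mono_on (by linarith)
            (hi (locallyIntegrable_norm (hcoef hσ hτ)) _ _)
            (((intervalIntegrable_const.add ((hi hσ.locallyIntegrable_sq _ _).const_mul 2)).add
              (hi hts _ _)).const_mul B) fun s _ => ?_
          refine (norm_coeffMat_le e _ _).trans (mul_le_mul_of_nonneg_left ?_ hB)
          have h1 : ‖ρ σ τ s‖ ≤ |τ s| + ‖z‖ + σ s ^ 2 := by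
            refine (norm_sub_le _ _).trans ?_
            rw [norm_pow, Complex.norm_real, Real.norm_eq_abs, sq_abs]
            gcongr
            refine (norm_sub_le _ _).trans ?_
            rw [Complex.norm_real, Real.norm_eq_abs]
          rw [Complex.norm_real, Real.norm_eq_abs]
          nlinarith [sq_nonneg (|σ s| - 1), sq_abs (σ s)]
      _ ≤ _ := by
          rw [intervalIntegral.integral_const_mul, intervalIntegral.integral_add
            (intervalIntegrable_const.add ((hi hσ.locallyIntegrable_sq _ _).const_mul 2))
            (hi hts _ _), intervalIntegral.integral_add intervalIntegrable_const
            ((hi hσ.locallyIntegrable_sq _ _).const_mul 2), intervalIntegral.integral_const_mul,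
            intervalIntegral.integral_const]
          refine mul_le_mul_of_nonneg_left ?_ hB
          rw [add_sub_cancel_left, one_smul]
          linarith [hK t, hK' t]
  refine colMat_eq_zero e (eq_zero_of_periodic_approximation
    (b := fun m s => coeffMat e (σm m s) (ρ (σm m) (τm m) s)) (S := B * (S₁ + S₂))
    (isAdjugate_adjugateLin e he) (hcoef hσ hτ) (fun s => adjugate_coeffMat e _ _) hbound
    (fun m => hcoef (hσm m).1 (hτm m).1) (fun m s => adjugate_coeffMat e _ _) hT0 hT
    (fun m s => ?_) hnear hY (fun s => ?_) ?_ ?_ ?_ t)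
  · simp only [ρ, (hσm m).2 s, (hτm m).2 s]
  · exact (norm_colMat_le e _ _).trans
      (mul_le_mul_of_nonneg_left (add_le_add (hS₁ s) (hS₂ s)) hB)
  · exact hYlim.comp (hT.mono_right atTop_le_cocompact)
  · exact hYlim.comp ((hT.const_mul_atTop two_pos).mono_right atTop_le_cocompact)
  · exact hYlim.comp ((tendsto_neg_atTop_atBot.comp hT).mono_right atBot_le_cocompact)

/-! ### Decay of eigenfunctions -/

lemma tendsto_integral_unit {G : ℝ → ℝ} (hG : Integrable G) :
    Tendsto (fun t => ∫ s in t..(t + 1), G s) (cocompact ℝ) (𝓝 0) := by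
  have key : ∀ l : Filter ℝ, l.IsCountablyGenerated → (∀ s : ℝ, ∀ᶠ t in l, s ∉ Set.Ioc t (t + 1)) →
      Tendsto (fun t => ∫ s in t..(t + 1), G s) l (𝓝 0) := by
    intro l _ hl
    have h := tendsto_integral_filter_of_dominated_convergence (l := l) (μ := volume)
      (F := fun t => (Set.Ioc t (t + 1)).indicator G) (f := fun _ => (0 : ℝ)) (fun s => ‖G s‖)
      (Eventually.of_forall fun t => hG.1.indicator measurableSet_Ioc)
      (Eventually.of_forall fun t => Eventually.of_forall fun s => norm_indicator_le_norm_self _ _)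
      hG.norm (Eventually.of_forall fun s => tendsto_const_nhds.congr' (by
        filter_upwards [hl s] with t ht
        rw [Set.indicator_of_notMem ht]))
    simp only [integral_zero] at h
    refine h.congr fun t => ?_
    rw [integral_indicator measurableSet_Ioc, intervalIntegral.integral_of_le (by linarith)]
  rw [cocompact_eq_atBot_atTop]
  refine Tendsto.sup (key _ inferInstance fun s => ?_) (key _ inferInstance fun s => ?_)
  · filter_upwards [eventually_lt_atBot (s - 1)] with t ht hs
    linarith [hs.2]
  · filter_upwards [eventually_ge_atTop s] with t ht hs
    linarith [hs.1]

lemma IsPrimitive.norm_le_integral_unit {E : Type*} [NormedAddCommGroup E] [NormedSpace ℝ E]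
    {F f : ℝ → E} (h : IsPrimitive F f) (hF : Continuous F) {t s : ℝ}
    (hs : s ∈ Set.Icc t (t + 1)) :
    ‖F s‖ ≤ (∫ x in t..(t + 1), ‖F x‖) + ∫ x in t..(t + 1), ‖f x‖ := by
  have hfn := locallyIntegrable_norm h.locallyIntegrable
  have hpt : ∀ x ∈ Set.Icc t (t + 1), ‖F s‖ ≤ ‖F x‖ + ∫ x in t..(t + 1), ‖f x‖ := by
    intro x hx
    have h1 : ‖F s - F x‖ ≤ ∫ x in t..(t + 1), ‖f x‖ := by
      rcases le_total x s with hxs | hxs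
      · exact (h.norm_sub_le hxs).trans
          (intervalIntegral_le_of_subinterval hfn (fun _ => norm_nonneg _) hx.1 hxs hs.2)
      · rw [norm_sub_rev]
        exact (h.norm_sub_le hxs).trans
          (intervalIntegral_le_of_subinterval hfn (fun _ => norm_nonneg _) hs.1 hxs hx.2)
    have h2 : ‖F s‖ ≤ ‖F x‖ + ‖F s - F x‖ := by
      simpa using norm_add_le (F x) (F s - F x)
    linarith
  have hle : t ≤ t + 1 := by linarith
  have := intervalIntegral.integral_mono_on hle (μ := volume) intervalIntegrable_const
    ((hF.norm.intervalIntegrable t (t + 1)).add intervalIntegrable_const) hpt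
  rw [intervalIntegral.integral_add (hF.norm.intervalIntegrable t (t + 1))
    intervalIntegrable_const, intervalIntegral.integral_const, intervalIntegral.integral_const,
    add_sub_cancel_left, one_smul, one_smul] at this
  exact this

/-- A square integrable solution of the first order system with square integrable derivative tends
to zero at infinity, together with its quasi-derivative `V`. -/
lemma tendsto_zero_of_memLp {σ τ : ℝ → ℝ} (hσ : MemLpUnif 2 σ) (hτ : MemLpUnif 1 τ) {z : ℂ}
    {U V f : ℝ → ℂ} (hU : IsPrimitive U f) (hU2 : MemLp U 2 volume) (hf2 : MemLp f 2 volume)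
    (hV : IsPrimitive V fun t => (τ t - z) * U t - σ t * f t)
    (hVeq : ∀ᵐ t : ℝ, V t = f t - σ t * U t) :
    Tendsto U (cocompact ℝ) (𝓝 0) ∧ Tendsto V (cocompact ℝ) (𝓝 0) := by
  have hi := @locallyIntegrable_intervalIntegrable ℝ _
  obtain ⟨K, hK⟩ := hσ.exists_integral_sq_le
  obtain ⟨K', hK'⟩ := hτ.exists_integral_abs_le
  have hIU : Integrable (fun s => ‖U s‖ ^ 2) := hU2.integrable_norm_pow two_ne_zero
  have hIf : Integrable (fun s => ‖f s‖ ^ 2) := hf2.integrable_norm_pow two_ne_zero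
  set gU : ℝ → ℝ := fun t => √(∫ s in t..(t + 1), ‖U s‖ ^ 2)
  set gf : ℝ → ℝ := fun t => √(∫ s in t..(t + 1), ‖f s‖ ^ 2)
  have hgU : Tendsto gU (cocompact ℝ) (𝓝 0) := by
    simpa using (tendsto_integral_unit hIU).sqrt
  have hgf : Tendsto gf (cocompact ℝ) (𝓝 0) := by
    simpa using (tendsto_integral_unit hIf).sqrt
  have hUn : AEStronglyMeasurable (fun s => ‖U s‖) volume := hU2.1.norm
  have hfn : AEStronglyMeasurable (fun s => ‖f s‖) volume := hf2.1.norm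
  have hUl : LocallyIntegrable (fun s => ‖U s‖) volume := hU.continuous.norm.locallyIntegrable
  have hfl : LocallyIntegrable (fun s => ‖f s‖) volume := locallyIntegrable_norm hU.locallyIntegrable
  have hone : ∀ {p : ℝ → ℝ}, AEStronglyMeasurable p volume → Integrable (fun s => p s ^ 2) →
      ∀ t, ∫ s in t..(t + 1), |p s| ≤ √(∫ s in t..(t + 1), p s ^ 2) := fun hp hp2 t => by
    have h := integral_mul_le_sqrt (f := fun _ => (1 : ℝ)) aestronglyMeasurable_const hp
      (locallyIntegrable_const _) hp2.locallyIntegrable (by linarith : t ≤ t + 1)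
    simpa using h
  have hoU : ∀ t, ∫ s in t..(t + 1), ‖U s‖ ≤ gU t := fun t => by
    simpa only [abs_norm] using hone hUn hIU t
  have hof : ∀ t, ∫ s in t..(t + 1), ‖f s‖ ≤ gf t := fun t => by
    simpa only [abs_norm] using hone hfn hIf t
  have hσp : ∀ {p : ℝ → ℝ}, AEStronglyMeasurable p volume → Integrable (fun s => p s ^ 2) →
      (∀ s, 0 ≤ p s) → ∀ t, ∫ s in t..(t + 1), |σ s| * p s ≤ √K * √(∫ s in t..(t + 1), p s ^ 2) :=
    fun hp hp2 hp0 t => by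
      have h := integral_mul_le_sqrt hσ.1 hp hσ.locallyIntegrable_sq hp2.locallyIntegrable
        (by linarith : t ≤ t + 1)
      simp only [abs_of_nonneg (hp0 _)] at h
      exact h.trans (by gcongr; exact hK t)
  have hσl : ∀ {p : ℝ → ℝ}, AEStronglyMeasurable p volume → Integrable (fun s => p s ^ 2) →
      (∀ s, 0 ≤ p s) → LocallyIntegrable (fun s => |σ s| * p s) volume := fun hp hp2 hp0 => by
    have := locallyIntegrable_norm (locallyIntegrable_mul_of_sq hσ.1 hp hσ.locallyIntegrable_sq
      hp2.locallyIntegrable)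
    simpa only [norm_mul, Real.norm_eq_abs, abs_of_nonneg (hp0 _)] using this
  have hUle : ∀ t, ∀ s ∈ Set.Icc t (t + 1), ‖U s‖ ≤ gU t + gf t := fun t s hs =>
    (hU.norm_le_integral_unit hU.continuous hs).trans (add_le_add (hoU t) (hof t))
  have hVle : ∀ t, ‖V t‖ ≤ (1 + 2 * √K + K' + ‖z‖) * (gU t + gf t) := by
    intro t
    have hle : t ≤ t + 1 := by linarith
    have hU0 : 0 ≤ gU t := Real.sqrt_nonneg _
    have hf0 : 0 ≤ gf t := Real.sqrt_nonneg _
    have hτl : LocallyIntegrable (fun s => |τ s|) volume :=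
      locallyIntegrable_norm (hτ.locallyIntegrable le_rfl)
    have hUσ := hσp hUn hIU (fun _ => norm_nonneg _) t
    have hfσ := hσp hfn hIf (fun _ => norm_nonneg _) t
    have hUσl := hσl hUn hIU (fun _ => norm_nonneg _)
    have hfσl := hσl hfn hIf (fun _ => norm_nonneg _)
    have h1 : ∫ s in t..(t + 1), ‖V s‖ ≤ gf t + √K * gU t := by
      calc _ ≤ ∫ s in t..(t + 1), (‖f s‖ + |σ s| * ‖U s‖) := by
            refine intervalIntegral.integral_mono_ae hle
              (hV.continuous.norm.intervalIntegrable _ _)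
              ((hi hfl _ _).add (hi hUσl _ _)) ?_
            filter_upwards [hVeq] with s hs
            rw [hs]
            refine (norm_sub_le _ _).trans ?_
            rw [norm_mul, Complex.norm_real, Real.norm_eq_abs]
        _ ≤ _ := by
            rw [intervalIntegral.integral_add (hi hfl _ _) (hi hUσl _ _)]
            exact add_le_add (hof t) hUσ
    have h2 : ∫ s in t..(t + 1), ‖((τ s : ℂ) - z) * U s - σ s * f s‖
        ≤ (K' + ‖z‖) * (gU t + gf t) + √K * gf t := by
      calc _ ≤ ∫ s in t..(t + 1), ((|τ s| + ‖z‖) * (gU t + gf t) + |σ s| * ‖f s‖) := by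
            refine intervalIntegral.integral_mono_on hle
              (hi (locallyIntegrable_norm hV.locallyIntegrable) _ _)
              ((((hi hτl _ _).add intervalIntegrable_const).mul_const _).add (hi hfσl _ _))
              fun s hs => ?_
            refine (norm_sub_le _ _).trans ?_
            rw [norm_mul, norm_mul, Complex.norm_real, Real.norm_eq_abs]
            gcongr
            · refine (norm_sub_le _ _).trans ?_
              rw [Complex.norm_real, Real.norm_eq_abs]
            · exact hUle t s hs
        _ ≤ _ := by
            rw [intervalIntegral.integral_add (((hi hτl _ _).add
              intervalIntegrable_const).mul_const _) (hi hfσl _ _),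
              intervalIntegral.integral_mul_const, intervalIntegral.integral_add (hi hτl _ _)
              intervalIntegrable_const, intervalIntegral.integral_const, add_sub_cancel_left,
              one_smul]
            gcongr
            exact hK' t
    refine (hV.norm_le_integral_unit hV.continuous (Set.left_mem_Icc.2 hle)).trans ?_
    have h3 : 0 ≤ √K * gf t := by positivity
    have h4 : 0 ≤ √K * gU t := by positivity
    nlinarith
  refine ⟨?_, ?_⟩
  · exact squeeze_zero_norm (fun t => hUle t t (Set.left_mem_Icc.2 (by linarith)))
      (by simpa using hgU.add hgf)
  · exact squeeze_zero_norm hVle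
      (by simpa using (hgU.add hgf).const_mul (1 + 2 * √K + K' + ‖z‖))

/-! ### The point spectrum of a singular Gordon potential -/

lemma ofFun_apply {f : ℝ → ℝ} (hf : LocallyIntegrable f volume) (ψ : Test) :
    ofFun f ψ = ∫ x, ψ x * f x :=
  TestFunction.integralAgainstBilinCLM_eq_integral (hf.locallyIntegrableOn _)

lemma distDeriv_apply (T : Distr) (ψ : Test) : distDeriv T ψ = -T (∂_{(1 : ℝ)} ψ) := by
  rw [distDeriv, Distribution.lineDerivOp_apply_apply, map_neg]

lemma lineDeriv_test_apply (ψ : Test) (x : ℝ) : (∂_{(1 : ℝ)} ψ : Test) x = deriv ψ x := by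
  rw [TestFunction.lineDerivOp_eq_lineDerivCLM ℝ, TestFunction.lineDerivCLM_apply_of_le (by simp),
    (ψ.contDiff.differentiable (by simp)).differentiableAt.lineDeriv_eq_fderiv,
    fderiv_apply_one_eq_deriv]

lemma distDeriv_ofFun_apply {f : ℝ → ℝ} (hf : LocallyIntegrable f volume) (ψ : Test) :
    distDeriv (ofFun f) ψ = -∫ x, deriv ψ x * f x := by
  rw [distDeriv_apply, ofFun_apply hf]
  simp only [lineDeriv_test_apply]

/-- Two decompositions of the same distribution differ by a locally absolutely continuous
function. -/
lemma IsDecomposition.exists_isPrimitive {q : Distr} {σ τ σ' τ' : ℝ → ℝ}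
    (h : IsDecomposition q σ τ) (h' : IsDecomposition q σ' τ') :
    ∃ W : ℝ → ℝ, (fun x => σ x - σ' x) =ᵐ[volume] W ∧ IsPrimitive W fun x => τ' x - τ x := by
  have hσ := h.memσ.locallyIntegrable one_le_two
  have hσ' := h'.memσ.locallyIntegrable one_le_two
  have hτ := h.memτ.locallyIntegrable le_rfl
  have hτ' := h'.memτ.locallyIntegrable le_rfl
  refine exists_isPrimitive_of_weak (hσ.sub hσ') (hτ'.sub hτ) fun φ => ?_
  have hq : (distDeriv (ofFun σ) + ofFun τ) φ = (distDeriv (ofFun σ') + ofFun τ') φ := by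
    rw [← h.eq, ← h'.eq]
  have hsplit : ∀ σ τ : ℝ → ℝ, (distDeriv (ofFun σ) + ofFun τ) φ
      = distDeriv (ofFun σ) φ + ofFun τ φ := fun _ _ => rfl
  rw [hsplit, hsplit, distDeriv_ofFun_apply hσ, distDeriv_ofFun_apply hσ', ofFun_apply hτ,
    ofFun_apply hτ'] at hq
  have hder : ∀ {u : ℝ → ℝ} (_ : LocallyIntegrable u volume),
      Integrable fun x => deriv φ x * u x := fun hu =>
    hu.integrable_smul_left_of_hasCompactSupport (Test.continuous_deriv φ)
      φ.hasCompactSupport.deriv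
  have hI : ∀ {u : ℝ → ℝ} (_ : LocallyIntegrable u volume), Integrable fun x => φ x * u x :=
    fun hu => integrable_test_smul hu φ
  simp only [smul_eq_mul, mul_sub]
  rw [integral_sub (hder hσ) (hder hσ'), integral_sub (hI hτ') (hI hτ)]
  linarith

/-- The Schrödinger operator with a singular Gordon potential has no eigenvalues. -/
theorem pointSpectrum_eq_empty {q : Distr} (hq : IsSingularGordon q) : pointSpectrum q = ∅ := by
  obtain ⟨σ, τ, hd, T, σm, τm, hT0, hT, hσm, hτm, hlim⟩ := hq
  rw [Set.eq_empty_iff_forall_notMem]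
  rintro z ⟨u, hu, σ', τ', hd', f, h, hf2, hw1, hw2, heq⟩
  refine hu ?_
  obtain ⟨W, hW, hWp⟩ := hd.exists_isPrimitive hd'
  obtain ⟨U, huU, hU⟩ := exists_isPrimitive_of_weak hw1.1 hw1.2.1 hw1.2.2
  obtain ⟨V', hV', hVp'⟩ := exists_isPrimitive_of_weak hw2.1 hw2.2.1 hw2.2.2
  have hWc := hWp.clm_apply Complex.ofRealCLM
  have hVp := hVp'.sub (hWc.mul hU)
  set V : ℝ → ℂ := fun x => V' x - Complex.ofRealCLM (W x) * U x
  have hVeq : ∀ᵐ t : ℝ, V t = f t - σ t * U t := by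
    filter_upwards [hV', huU, hW] with t h1 h2 h3
    simp only [V, ← h1, ← h2, ← h3, Complex.ofRealCLM_apply]
    push_cast
    ring
  -- The equation for the quasi-derivative `V` with respect to the decomposition `σ`, `τ`.
  have hV : IsPrimitive V fun t => ((τ t : ℂ) - z) * U t - σ t * f t := by
    refine hVp.congr ?_
    filter_upwards [heq, huU, hW, Lp.coeFn_smul z u] with t h1 h2 h3 h4
    rw [h4, Pi.smul_apply, smul_eq_mul] at h1
    have h5 : h t = -(z * U t) - σ' t * f t + τ' t * U t := by
      rw [← h2]
      linear_combination h1
    simp only [h5, ← h3, Complex.ofRealCLM_apply]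
    push_cast
    ring
  have hU2 : MemLp U 2 volume := (memLp_congr_ae huU).1 (Lp.memLp u)
  obtain ⟨hU0, hV0⟩ := tendsto_zero_of_memLp hd.memσ hd.memτ hU hU2 hf2 hV hVeq
  have hfeq : ∀ᵐ t : ℝ, f t = σ t * U t + V t := by
    filter_upwards [hVeq] with t ht
    rw [ht]; ring
  have hzero := eq_zero_of_gordon hd.memσ hd.memτ hT0 hT hσm hτm hlim (hU.congr hfeq)
    (z := z) (hV.congr (by
      filter_upwards [hfeq] with t ht
      rw [ht]; ring)) hU0 hV0
  rw [Lp.eq_zero_iff_ae_eq_zero]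
  filter_upwards [huU] with t ht
  rw [ht, hzero]
  rfl

open scoped FourierTransform ContDiff

/-! ### Fourier estimates for translations -/

/-- A real-valued compactly supported smooth function times a smooth complex function, as a
Schwartz function. -/
noncomputable def smulSchwartz (e : ℝ → ℂ) (he : ContDiff ℝ ∞ e) (ψ : ℝ → ℝ)
    (hψ : ContDiff ℝ ∞ ψ) (hc : HasCompactSupport ψ) : 𝓢(ℝ, ℂ) :=
  (show HasCompactSupport fun x => (ψ x : ℂ) * e x from
    (hc.comp_left (g := Complex.ofReal) rfl).mul_right).toSchwartzMap
    ((Complex.ofRealCLM.contDiff.comp hψ).mul he)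

lemma smulSchwartz_apply (e : ℝ → ℂ) (he : ContDiff ℝ ∞ e) (ψ : ℝ → ℝ)
    (hψ : ContDiff ℝ ∞ ψ) (hc : HasCompactSupport ψ) (x : ℝ) :
    smulSchwartz e he ψ hψ hc x = (ψ x : ℂ) * e x := rfl

lemma integral_smulSchwartz_fourier (v : Lp ℂ 2 (volume : Measure ℝ)) (Ψ : 𝓢(ℝ, ℂ)) :
    ∫ x, (𝓕 Ψ) x * v x = ∫ ξ, Ψ ξ * (𝓕 v : Lp ℂ 2 (volume : Measure ℝ)) ξ := by
  have h := congrArg (fun T : 𝓢'(ℝ, ℂ) => T Ψ) (Lp.fourier_toTemperedDistribution_eq v)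
  simp only [TemperedDistribution.fourier_apply, Lp.toTemperedDistribution_apply,
    smul_eq_mul] at h
  exact h

/-- The exponential multiplier of the translation by `h`. -/
noncomputable def translationSymbol (h ξ : ℝ) : ℂ :=
  Complex.exp (Complex.I * ((2 * Real.pi * (h * ξ) : ℝ) : ℂ))

lemma contDiff_translationSymbol (h : ℝ) : ContDiff ℝ ∞ (translationSymbol h) := by
  unfold translationSymbol
  have : ContDiff ℝ ∞ fun ξ : ℝ => ((2 * Real.pi * (h * ξ) : ℝ) : ℂ) :=
    Complex.ofRealCLM.contDiff.comp (contDiff_const.mul (contDiff_const.mul contDiff_id))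
  exact (contDiff_const.mul this).cexp

lemma norm_translationSymbol_sub_one_le {s : ℝ} (h0 : 0 < s) (h1 : s ≤ 1) (h ξ : ℝ) :
    ‖translationSymbol h ξ - 1‖ ≤ 2 * Real.pi * (|h| ^ s * (1 + ξ ^ 2) ^ (s / 2)) := by
  have hpi := Real.pi_gt_three
  have hle : (|h| * |ξ|) ^ s ≤ |h| ^ s * (1 + ξ ^ 2) ^ (s / 2) := by
    rw [Real.mul_rpow (abs_nonneg _) (abs_nonneg _)]
    gcongr
    have : |ξ| ^ s = (ξ ^ 2) ^ (s / 2) := by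
      rw [← sq_abs, ← Real.rpow_natCast, ← Real.rpow_mul (abs_nonneg _)]
      congr 1; push_cast; ring
    rw [this]
    gcongr
    linarith
  refine le_trans ?_ (mul_le_mul_of_nonneg_left hle (by positivity))
  rcases le_total (|h| * |ξ|) 1 with ha | ha
  · refine (Real.norm_exp_I_mul_ofReal_sub_one_le).trans ?_
    rw [Real.norm_eq_abs, abs_mul, abs_mul h, abs_of_pos (by positivity : (0 : ℝ) < 2 * Real.pi)]
    gcongr
    have := Real.rpow_le_rpow_of_exponent_ge' (by positivity : 0 ≤ |h| * |ξ|) ha h0.le h1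
    simpa using this
  · have h2 : ‖translationSymbol h ξ - 1‖ ≤ 2 := by
      refine (norm_sub_le _ _).trans ?_
      rw [translationSymbol, mul_comm, Complex.norm_exp_ofReal_mul_I]
      norm_num
    have := Real.one_le_rpow ha h0.le
    nlinarith

/-- Translations act as multipliers on the Fourier transform of `L₂` functions. Both sides are
compared as tempered distributions, where the translation passes to the test function. -/
lemma fourier_translate_ae_eq {v w : Lp ℂ 2 (volume : Measure ℝ)} {h : ℝ}
    (hw : w =ᵐ[volume] fun x => v (x + h)) :
    (𝓕 w : Lp ℂ 2 (volume : Measure ℝ)) =ᵐ[volume]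
      fun ξ => translationSymbol h ξ * (𝓕 v : Lp ℂ 2 (volume : Measure ℝ)) ξ := by
  have hl : ∀ u : Lp ℂ 2 (volume : Measure ℝ), LocallyIntegrable u volume := fun u =>
    (Lp.memLp u).locallyIntegrable one_le_two
  refine ae_eq_of_integral_contDiff_smul_eq (hl _)
    (locallyIntegrable_continuous_mul (contDiff_translationSymbol h).continuous (hl _))
    fun ψ hψ hc => ?_
  let Ψ := smulSchwartz (fun _ => 1) contDiff_const ψ hψ hc
  let Ψ' := smulSchwartz _ (contDiff_translationSymbol h) ψ hψ hc
  have hF : ∀ x, (𝓕 Ψ' : 𝓢(ℝ, ℂ)) (x + h) = (𝓕 Ψ : 𝓢(ℝ, ℂ)) x := by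
    intro x
    rw [SchwartzMap.fourier_coe, SchwartzMap.fourier_coe, Real.fourier_real_eq_integral_exp_smul,
      Real.fourier_real_eq_integral_exp_smul]
    refine integral_congr_ae (Eventually.of_forall fun ξ => ?_)
    simp only [Ψ, Ψ', smulSchwartz_apply, translationSymbol, smul_eq_mul]
    rw [mul_left_comm, ← Complex.exp_add, mul_one, mul_comm]
    congr 2
    push_cast
    ring
  calc ∫ ξ, ψ ξ • (𝓕 w : Lp ℂ 2 (volume : Measure ℝ)) ξ
      = ∫ ξ, Ψ ξ * (𝓕 w : Lp ℂ 2 (volume : Measure ℝ)) ξ := by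
        simp [Ψ, smulSchwartz_apply]
    _ = ∫ x, (𝓕 Ψ : 𝓢(ℝ, ℂ)) x * w x := (integral_smulSchwartz_fourier w Ψ).symm
    _ = ∫ x, (𝓕 Ψ' : 𝓢(ℝ, ℂ)) (x + h) * v (x + h) := by
        refine integral_congr_ae ?_
        filter_upwards [hw] with x hx
        rw [hx, hF]
    _ = ∫ x, (𝓕 Ψ' : 𝓢(ℝ, ℂ)) x * v x :=
        integral_add_right_eq_self (fun x => (𝓕 Ψ' : 𝓢(ℝ, ℂ)) x * v x) h
    _ = ∫ ξ, Ψ' ξ * (𝓕 v : Lp ℂ 2 (volume : Measure ℝ)) ξ := integral_smulSchwartz_fourier v Ψ'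
    _ = _ := by
        simp [Ψ', smulSchwartz_apply, mul_assoc]

/-- The Fourier transform of a function from `W^s_2` is square integrable with the weight
`(1 + ξ²)^s`. -/
lemma exists_weight_mul_fourier_ae_eq {v : Lp ℂ 2 (volume : Measure ℝ)} {s : ℝ}
    (hv : TemperedDistribution.MemSobolev s 2 (v : 𝓢'(ℝ, ℂ))) :
    ∃ u : Lp ℂ 2 (volume : Measure ℝ), u =ᵐ[volume]
      fun ξ => (((1 + ξ ^ 2) ^ (s / 2) : ℝ) : ℂ) * (𝓕 v : Lp ℂ 2 (volume : Measure ℝ)) ξ := by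
  obtain ⟨u, hu⟩ := TemperedDistribution.memSobolev_iff_exists_smulLeftCLM_fourier.1 hv
  refine ⟨u, ?_⟩
  have hl : ∀ u : Lp ℂ 2 (volume : Measure ℝ), LocallyIntegrable u volume := fun u =>
    (Lp.memLp u).locallyIntegrable one_le_two
  have htg : Function.HasTemperateGrowth fun ξ : ℝ => (((1 + ‖ξ‖ ^ 2) ^ (s / 2) : ℝ) : ℂ) := by
    fun_prop
  refine ae_eq_of_integral_contDiff_smul_eq (hl _)
    (locallyIntegrable_continuous_mul ?_ (hl _)) fun ψ hψ hc => ?_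
  · refine Complex.continuous_ofReal.comp (Continuous.rpow_const (by fun_prop) fun ξ => Or.inl ?_)
    positivity
  let Ψ := smulSchwartz (fun _ => 1) contDiff_const ψ hψ hc
  have h := congrArg (fun T : 𝓢'(ℝ, ℂ) => T Ψ) hu
  rw [Lp.fourier_toTemperedDistribution_eq] at h
  simp only [TemperedDistribution.smulLeftCLM_apply_apply, Lp.toTemperedDistribution_apply,
    SchwartzMap.smulLeftCLM_apply_apply htg, smul_eq_mul] at h
  simp only [Ψ, smulSchwartz_apply, mul_one] at h
  simp only [Complex.real_smul]
  rw [← h]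
  refine integral_congr_ae (Eventually.of_forall fun ξ => ?_)
  simp only [Real.norm_eq_abs, sq_abs]
  ring

/-- The `L₂` modulus of continuity of a function from the Sobolev space `W^s_2`, `s > 0`, is of
Hölder type: the translation by `h` multiplies the Fourier transform by `exp (2πihξ)`, and
`|exp (2πihξ) - 1| ≤ 2π |h|^r (1 + ξ²)^(r/2)` for `r ≤ 1`. -/
lemma exists_eLpNorm_translate_sub_le {v : ℝ → ℂ} (hv : MemLp v 2 volume) {s : ℝ} (hs : 0 < s)
    (hS : TemperedDistribution.MemSobolev s 2
      ((hv.toLp : Lp ℂ 2 (volume : Measure ℝ)) : 𝓢'(ℝ, ℂ))) :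
    ∃ K : ℝ, 0 ≤ K ∧ ∀ h : ℝ,
      eLpNorm (fun x => v (x + h) - v x) 2 volume ≤ ENNReal.ofReal (K * |h| ^ min s 1) := by
  obtain ⟨u, hu⟩ := exists_weight_mul_fourier_ae_eq hS
  have hr0 : 0 < min s 1 := lt_min hs one_pos
  refine ⟨2 * Real.pi * ‖u‖, by positivity, fun h => ?_⟩
  have hvh : MemLp (fun x => v (x + h)) 2 volume :=
    hv.comp_measurePreserving (measurePreserving_add_right volume h)
  have hw : hvh.toLp =ᵐ[volume] fun x => (hv.toLp : Lp ℂ 2 (volume : Measure ℝ)) (x + h) := by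
    filter_upwards [hvh.coeFn_toLp,
      (measurePreserving_add_right volume h).quasiMeasurePreserving.ae hv.coeFn_toLp] with x h1 h2
    rw [h1, h2]
  have hF := fourier_translate_ae_eq hw
  have hle : ‖hvh.toLp - hv.toLp‖ ≤ 2 * Real.pi * |h| ^ min s 1 * ‖u‖ := by
    rw [← Lp.norm_fourier_eq, sub_eq_add_neg, FourierTransform.fourier_add,
      FourierTransform.fourier_neg, ← sub_eq_add_neg]
    refine Lp.norm_le_mul_norm_of_ae_le_mul ?_
    filter_upwards [Lp.coeFn_sub (𝓕 hvh.toLp : Lp ℂ 2 (volume : Measure ℝ)) (𝓕 hv.toLp), hF, hu]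
      with ξ h1 h2 h3
    rw [h1, Pi.sub_apply, h2, h3, ← sub_one_mul, norm_mul, norm_mul, ← mul_assoc]
    gcongr
    refine (norm_translationSymbol_sub_one_le hr0 (min_le_right _ _) h ξ).trans ?_
    rw [Complex.norm_real, Real.norm_of_nonneg (by positivity), ← mul_assoc]
    exact mul_le_mul_of_nonneg_left (Real.rpow_le_rpow_of_exponent_le
      (by nlinarith [sq_nonneg ξ]) (by linarith [min_le_left s 1])) (by positivity)
  have heq : eLpNorm (fun x => v (x + h) - v x) 2 volume
      = ENNReal.ofReal ‖hvh.toLp - hv.toLp‖ := by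
    rw [← MemLp.toLp_sub, Lp.norm_toLp, ENNReal.ofReal_toReal (hvh.sub hv).2.ne]
    rfl
  rw [heq]
  refine ENNReal.ofReal_le_ofReal (hle.trans_eq ?_)
  ring

/-! ### Periodic functions with a Hölder modulus of continuity in `L₂` -/

lemma sq_intervalIntegral_le {p : ℝ → ℝ} (hp : AEStronglyMeasurable p volume)
    (hp2 : LocallyIntegrable (fun x => p x ^ 2) volume) {a b : ℝ} (hab : a ≤ b) :
    (∫ x in a..b, p x) ^ 2 ≤ (b - a) * ∫ x in a..b, p x ^ 2 := by
  have h := integral_mul_le_sqrt (f := fun _ => (1 : ℝ)) aestronglyMeasurable_const hp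
    (locallyIntegrable_const _) hp2 hab
  have h1 : |∫ x in a..b, p x| ≤ √(b - a) * √(∫ x in a..b, p x ^ 2) := by
    refine (intervalIntegral.abs_integral_le_integral_abs hab).trans ?_
    simpa using h
  have h0 : 0 ≤ ∫ x in a..b, p x ^ 2 :=
    intervalIntegral.integral_nonneg hab fun _ _ => sq_nonneg _
  calc _ = |∫ x in a..b, p x| ^ 2 := (sq_abs _).symm
    _ ≤ (√(b - a) * √(∫ x in a..b, p x ^ 2)) ^ 2 := by gcongr
    _ = _ := by rw [mul_pow, Real.sq_sqrt (by linarith), Real.sq_sqrt h0]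

lemma locallyIntegrable_comp_add_right {f : ℝ → ℝ} (hf : LocallyIntegrable f volume) (c : ℝ) :
    LocallyIntegrable (fun x => f (x + c)) volume :=
  locallyIntegrable_of_intervalIntegrable fun a b => by
    simpa using (locallyIntegrable_intervalIntegrable hf (a + c) (b + c)).comp_add_right c

/-- The `1`-periodic functions from `L_{2,loc}(ℝ)`. -/
structure IsSqPeriodic (f : ℝ → ℝ) : Prop where
  aestronglyMeasurable : AEStronglyMeasurable f volume
  sq : LocallyIntegrable (fun x => f x ^ 2) volume
  periodic : Function.Periodic f 1

namespace IsSqPeriodic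

variable {f g : ℝ → ℝ}

lemma locallyIntegrable (hf : IsSqPeriodic f) : LocallyIntegrable f volume :=
  (hf.sq.add (locallyIntegrable_const 1)).mono hf.aestronglyMeasurable
    (Eventually.of_forall fun x => by
      rw [Real.norm_eq_abs, Pi.add_apply, Real.norm_of_nonneg (by positivity)]
      nlinarith [sq_abs (f x), sq_nonneg (|f x| - 1)])

lemma comp_add_right (hf : IsSqPeriodic f) (c : ℝ) : IsSqPeriodic fun x => f (x + c) :=
  ⟨hf.aestronglyMeasurable.comp_quasiMeasurePreserving
      (measurePreserving_add_right volume c).quasiMeasurePreserving,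
    locallyIntegrable_comp_add_right hf.sq c,
    fun x => by simp only [add_right_comm x 1 c, hf.periodic _]⟩

lemma mul (hf : IsSqPeriodic f) (hg : IsSqPeriodic g) :
    LocallyIntegrable (fun x => f x * g x) volume :=
  locallyIntegrable_mul_of_sq hf.aestronglyMeasurable hg.aestronglyMeasurable hf.sq hg.sq

lemma add (hf : IsSqPeriodic f) (hg : IsSqPeriodic g) : IsSqPeriodic fun x => f x + g x :=
  ⟨hf.aestronglyMeasurable.add hg.aestronglyMeasurable,
    ((hf.sq.add ((hf.mul hg).smul (2 : ℝ))).add hg.sq).congr (Eventually.of_forall fun x => by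
      simp only [Pi.add_apply, Pi.smul_apply, smul_eq_mul]; ring),
    fun x => by simp only [hf.periodic x, hg.periodic x]⟩

lemma const_mul (hf : IsSqPeriodic f) (c : ℝ) : IsSqPeriodic fun x => c * f x :=
  ⟨hf.aestronglyMeasurable.const_mul c,
    (hf.sq.smul (c ^ 2)).congr (Eventually.of_forall fun x => by
      simp only [Pi.smul_apply, smul_eq_mul]; ring),
    fun x => by simp only [hf.periodic x]⟩

lemma sub (hf : IsSqPeriodic f) (hg : IsSqPeriodic g) : IsSqPeriodic fun x => f x - g x :=
  by simpa [sub_eq_add_neg] using hf.add (hg.const_mul (-1))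

lemma of_continuous (hf : Continuous f) (hp : Function.Periodic f 1) : IsSqPeriodic f :=
  ⟨hf.aestronglyMeasurable, (hf.pow 2).locallyIntegrable, hp⟩

lemma of_memLpLoc (hf : MemLpLoc 2 f) (hp : Function.Periodic f 1) : IsSqPeriodic f :=
  ⟨(locallyIntegrable_of_unit fun t =>
      (hf _ (isCompact_Icc : IsCompact (Set.Icc t (t + 1)))).integrable
        one_le_two).aestronglyMeasurable,
    locallyIntegrable_of_unit fun _ => (hf _ isCompact_Icc).integrable_sq, hp⟩

lemma integral_sq_le (hf : IsSqPeriodic f) {x y : ℝ} (hxy : x ≤ y) (h1 : y ≤ x + 1) :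
    ∫ t in x..y, f t ^ 2 ≤ ∫ t in (0 : ℝ)..1, f t ^ 2 := by
  refine (intervalIntegral_le_of_subinterval hf.sq (fun _ => sq_nonneg _) le_rfl hxy h1).trans_eq ?_
  have := Function.Periodic.intervalIntegral_add_eq (f := fun t => f t ^ 2) (T := 1)
    (fun t => by simp only [hf.periodic t]) x 0
  simpa using this

end IsSqPeriodic

/-- The `L₂` modulus of continuity of a `1`-periodic function is of Hölder type:
`‖f(· + h) - f‖²_{L₂[0,1]} ≤ K h^b` for `0 ≤ h ≤ 1`. -/
structure HasHolderModulus (f : ℝ → ℝ) (K b : ℝ) : Prop where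
  nonneg : 0 ≤ K
  pos : 0 < b
  integral_le : ∀ h ∈ Set.Icc (0 : ℝ) 1, ∫ x in (0 : ℝ)..1, (f (x + h) - f x) ^ 2 ≤ K * h ^ b

lemma HasHolderModulus.add {f g : ℝ → ℝ} {K K' b b' : ℝ} (hf : IsSqPeriodic f)
    (hg : IsSqPeriodic g) (hfm : HasHolderModulus f K b) (hgm : HasHolderModulus g K' b') :
    HasHolderModulus (fun x => f x + g x) (2 * K + 2 * K') (min b b') := by
  have hb := lt_min hfm.pos hgm.pos
  have hK := hfm.nonneg
  have hK' := hgm.nonneg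
  refine ⟨by positivity, hb, fun h hh => ?_⟩
  have hi := @locallyIntegrable_intervalIntegrable ℝ _
  have hf' := ((hf.comp_add_right h).sub hf).sq
  have hg' := ((hg.comp_add_right h).sub hg).sq
  have hfg := (((hf.add hg).comp_add_right h).sub (hf.add hg)).sq
  calc ∫ x in (0 : ℝ)..1, (f (x + h) + g (x + h) - (f x + g x)) ^ 2
      ≤ ∫ x in (0 : ℝ)..1, (2 * (f (x + h) - f x) ^ 2 + 2 * (g (x + h) - g x) ^ 2) := by
        refine intervalIntegral.integral_mono_on zero_le_one (hi hfg _ _)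
          (((hi hf' _ _).const_mul 2).add ((hi hg' _ _).const_mul 2)) fun x _ => ?_
        nlinarith [sq_nonneg ((f (x + h) - f x) - (g (x + h) - g x))]
    _ ≤ 2 * (K * h ^ b) + 2 * (K' * h ^ b') := by
        rw [intervalIntegral.integral_add ((hi hf' _ _).const_mul 2) ((hi hg' _ _).const_mul 2),
          intervalIntegral.integral_const_mul, intervalIntegral.integral_const_mul]
        linarith [hfm.integral_le h hh, hgm.integral_le h hh]
    _ ≤ 2 * (K * h ^ min b b') + 2 * (K' * h ^ min b b') := by
        have h1 := Real.rpow_le_rpow_of_exponent_ge' hh.1 hh.2 hb.le (min_le_left b b')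
        have h2 := Real.rpow_le_rpow_of_exponent_ge' hh.1 hh.2 hb.le (min_le_right b b')
        gcongr
    _ = _ := by ring

/-- A function locally in `W^s_2` has a Hölder modulus of continuity in `L₂`. -/
lemma exists_hasHolderModulus_of_memSobolevLoc {f : ℝ → ℝ} {s : ℝ}
    (hs : 0 < s) (hS : MemSobolevLoc s f) : ∃ K b, HasHolderModulus f K b := by
  obtain ⟨φ, hφ⟩ := exists_test_eq_one 2 two_pos
  obtain ⟨hv, hvS⟩ := hS φ
  obtain ⟨K, hK0, hK⟩ := exists_eLpNorm_translate_sub_le hv hs hvS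
  have hr : 0 < min s 1 := lt_min hs one_pos
  refine ⟨K ^ 2, min s 1 * 2, by positivity, by positivity, fun h hh => ?_⟩
  set w : ℝ → ℂ := fun x => ((φ (x + h) * f (x + h) : ℝ) : ℂ) - ((φ x * f x : ℝ) : ℂ)
  have hw : MemLp w 2 volume :=
    (hv.comp_measurePreserving (measurePreserving_add_right volume h)).sub hv
  calc ∫ x in (0 : ℝ)..1, (f (x + h) - f x) ^ 2 = ∫ x in (0 : ℝ)..1, ‖w x‖ ^ 2 := by
        refine intervalIntegral.integral_congr fun x hx => ?_
        rw [Set.uIcc_of_le zero_le_one] at hx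
        simp only [w]
        rw [hφ x (abs_le.2 ⟨by linarith [hx.1], by linarith [hx.2]⟩),
          hφ (x + h) (abs_le.2 ⟨by linarith [hx.1, hh.1], by linarith [hx.2, hh.2]⟩), one_mul,
          one_mul, ← Complex.ofReal_sub, Complex.norm_real, Real.norm_eq_abs, sq_abs]
    _ ≤ ∫ x, ‖w x‖ ^ 2 := by
        rw [intervalIntegral.integral_of_le zero_le_one]
        exact setIntegral_le_integral (hw.integrable_norm_pow two_ne_zero)
          (Eventually.of_forall fun x => sq_nonneg _)
    _ = (eLpNorm w 2 volume).toReal ^ 2 := integral_norm_sq_eq hw.1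
    _ ≤ (K * |h| ^ min s 1) ^ 2 := by
        gcongr
        exact ENNReal.toReal_le_of_le_ofReal (by positivity) (hK h)
    _ = _ := by
        rw [abs_of_nonneg hh.1, mul_pow, ← Real.rpow_natCast (h ^ _), ← Real.rpow_mul hh.1]
        norm_num

/-- A periodic primitive of a locally integrable function has a Hölder modulus of continuity in
`L₂`. -/
lemma IsPrimitive.exists_hasHolderModulus {F u : ℝ → ℝ} (hF : IsPrimitive F u)
    (hu : Function.Periodic u 1) : ∃ K b, HasHolderModulus F K b := by
  have hi := @locallyIntegrable_intervalIntegrable ℝ _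
  have hul := locallyIntegrable_norm hF.locallyIntegrable
  obtain ⟨A, hA⟩ : ∃ A, A = ∫ t in (0 : ℝ)..1, ‖u t‖ := ⟨_, rfl⟩
  set Φ : ℝ → ℝ := fun x => ∫ t in (0 : ℝ)..x, ‖u t‖
  have hΦ : IsPrimitive Φ fun t => ‖u t‖ := IsPrimitive.of_integral hul 0
  have hper : ∀ x, ∫ t in x..(x + 1), ‖u t‖ = A := fun x => by
    have := Function.Periodic.intervalIntegral_add_eq (f := fun t => ‖u t‖) (T := 1)
      (fun t => by simp only [hu t]) x 0
    rw [hA, this, zero_add]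
  have hΦ1 : ∀ x, Φ (x + 1) - Φ x = A := fun x => by rw [hΦ.sub_eq, hper]
  have hΦi : ∀ a b, IntervalIntegrable Φ volume a b := fun a b => hΦ.continuous.intervalIntegrable _ _
  have hA0 : 0 ≤ A := hA ▸ intervalIntegral.integral_nonneg zero_le_one fun _ _ => norm_nonneg _
  refine ⟨A ^ 2, 1, by positivity, one_pos, fun h hh => ?_⟩
  have hΦc := hΦ.continuous
  have hFc := hF.continuous
  have hΦh : Continuous fun x => Φ (x + h) := hΦc.comp (continuous_id.add continuous_const)
  calc ∫ x in (0 : ℝ)..1, (F (x + h) - F x) ^ 2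
      ≤ ∫ x in (0 : ℝ)..1, A * (Φ (x + h) - Φ x) := by
        refine intervalIntegral.integral_mono_on zero_le_one
          (Continuous.intervalIntegrable (by fun_prop) _ _)
          (Continuous.intervalIntegrable (by fun_prop) _ _) fun x _ => ?_
        have h1 : |F (x + h) - F x| ≤ Φ (x + h) - Φ x := by
          rw [hΦ.sub_eq]
          exact hF.norm_sub_le (by linarith [hh.1])
        have h2 : Φ (x + h) - Φ x ≤ A := by
          rw [hΦ.sub_eq, ← hper x]
          exact intervalIntegral_le_of_subinterval hul (fun _ => norm_nonneg _) le_rfl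
            (by linarith [hh.1]) (by linarith [hh.2])
        rw [← sq_abs, sq]
        exact mul_le_mul (h1.trans h2) h1 (abs_nonneg _) hA0
    _ = A * (A * h) := by
        rw [intervalIntegral.integral_const_mul, intervalIntegral.integral_sub
          (hΦh.intervalIntegrable _ _) (hΦi _ _), intervalIntegral.integral_comp_add_right]
        congr 1
        have h1 := intervalIntegral.integral_add_adjacent_intervals (hΦi 0 h) (hΦi h (1 + h))
        have h2 := intervalIntegral.integral_add_adjacent_intervals (hΦi 0 1) (hΦi 1 (1 + h))
        have h3 : ∫ x in (1 : ℝ)..(1 + h), Φ x = (∫ x in (0 : ℝ)..h, Φ x) + A * h := by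
          have h4 : ∫ x in (0 : ℝ)..h, Φ (x + 1) = ∫ x in (1 : ℝ)..(1 + h), Φ x := by
            rw [intervalIntegral.integral_comp_add_right, zero_add, add_comm h]
          rw [← h4, intervalIntegral.integral_congr (g := fun x => Φ x + A)
            fun x _ => by simp only [← hΦ1 x]; ring,
            intervalIntegral.integral_add (hΦi _ _) intervalIntegrable_const,
            intervalIntegral.integral_const, sub_zero, smul_eq_mul, mul_comm]
        rw [zero_add]
        linarith
    _ = _ := by rw [Real.rpow_one]; ring

/-- Approximation by Steklov averages `x ↦ ε⁻¹ ∫ t in x..(x + ε), f t`. -/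
lemma HasHolderModulus.exists_approximation {f : ℝ → ℝ} {K b : ℝ} (hf : IsSqPeriodic f)
    (hfm : HasHolderModulus f K b) : ∃ M : ℝ, 0 ≤ M ∧ ∀ ε : ℝ, 0 < ε → ε ≤ 1 → ∃ g : ℝ → ℝ,
      IsSqPeriodic g ∧ (∀ x y, |x - y| ≤ 1 → |g x - g y| ≤ M / ε * √|x - y|) ∧
      ∫ x in (0 : ℝ)..1, (f x - g x) ^ 2 ≤ K * ε ^ b := by
  have hi := @locallyIntegrable_intervalIntegrable ℝ _
  set F : ℝ → ℝ := fun x => ∫ t in (0 : ℝ)..x, f t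
  have hF : IsPrimitive F f := IsPrimitive.of_integral hf.locallyIntegrable 0
  have hF1 : ∀ x y, x ≤ y → y ≤ x + 1 →
      |F y - F x| ≤ √(∫ t in (0 : ℝ)..1, f t ^ 2) * √(y - x) := by
    intro x y hxy hy
    rw [hF.sub_eq, ← Real.sqrt_mul' _ (by linarith), mul_comm]
    refine Real.abs_le_sqrt ((sq_intervalIntegral_le hf.aestronglyMeasurable hf.sq hxy).trans ?_)
    exact mul_le_mul_of_nonneg_left (hf.integral_sq_le hxy hy) (by linarith)
  have hF2 : ∀ x y, |x - y| ≤ 1 → |F x - F y| ≤ √(∫ t in (0 : ℝ)..1, f t ^ 2) * √|x - y| := by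
    intro x y hxy
    rw [abs_le] at hxy
    rcases le_total x y with h | h
    · rw [abs_sub_comm, abs_sub_comm x y, abs_of_nonneg (by linarith : 0 ≤ y - x)]
      exact hF1 x y h (by linarith)
    · rw [abs_of_nonneg (by linarith : 0 ≤ x - y)]
      exact hF1 y x h (by linarith)
  refine ⟨2 * √(∫ t in (0 : ℝ)..1, f t ^ 2), by positivity, fun ε hε hε1 => ?_⟩
  set g : ℝ → ℝ := fun x => ε⁻¹ * (F (x + ε) - F x)
  have hFc := hF.continuous
  have hg : IsSqPeriodic g := by
    refine .of_continuous (by fun_prop) fun x => ?_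
    simp only [g, hF.sub_eq]
    rw [add_right_comm, ← intervalIntegral.integral_comp_add_right]
    simp only [hf.periodic _]
  refine ⟨g, hg, fun x y hxy => ?_, ?_⟩
  · have h1 := hF2 x y hxy
    have h2 := hF2 (x + ε) (y + ε) (by simpa using hxy)
    rw [add_sub_add_right_eq_sub] at h2
    have h3 : g x - g y = ε⁻¹ * ((F (x + ε) - F (y + ε)) - (F x - F y)) := by
      simp only [g]; ring
    rw [h3, abs_mul, abs_of_pos (inv_pos.2 hε), div_eq_inv_mul, mul_assoc]
    gcongr
    refine (abs_sub _ _).trans ?_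
    linarith
  have hsub := fun c => ((hf.comp_add_right c).sub hf)
  have hpt : ∀ x, (f x - g x) ^ 2 ≤ ε⁻¹ * ∫ h in (0 : ℝ)..ε, (f (x + h) - f x) ^ 2 := by
    intro x
    have hfx := hf.comp_add_right x
    have hint := hi hfx.locallyIntegrable 0 ε
    have h1 : f x - g x = -(ε⁻¹ * ∫ h in (0 : ℝ)..ε, (f (h + x) - f x)) := by
      rw [intervalIntegral.integral_sub hint intervalIntegrable_const,
        intervalIntegral.integral_comp_add_right, intervalIntegral.integral_const]
      simp only [g, hF.sub_eq, sub_zero, smul_eq_mul, zero_add, add_comm ε x]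
      field_simp
      ring
    have hc : IsSqPeriodic fun _ => f x := .of_continuous continuous_const fun _ => rfl
    have h2 := sq_intervalIntegral_le (hfx.sub hc).aestronglyMeasurable (hfx.sub hc).sq hε.le
    rw [h1, neg_sq, mul_pow]
    simp only [add_comm x]
    calc _ ≤ ε⁻¹ ^ 2 * ((ε - 0) * ∫ h in (0 : ℝ)..ε, (f (h + x) - f x) ^ 2) := by gcongr
      _ = _ := by field_simp; ring
  have hprod : IntegrableOn (Function.uncurry fun x h => (f (x + h) - f x) ^ 2)
      (Set.uIoc (0 : ℝ) 1 ×ˢ Set.uIoc (0 : ℝ) ε) := by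
    rw [IntegrableOn, Measure.volume_eq_prod, ← Measure.prod_restrict]
    have hmeas : AEStronglyMeasurable (Function.uncurry fun x h => (f (x + h) - f x) ^ 2)
        ((volume.restrict (Set.uIoc (0 : ℝ) 1)).prod (volume.restrict (Set.uIoc (0 : ℝ) ε))) := by
      rw [Measure.prod_restrict]
      refine AEStronglyMeasurable.restrict (AEStronglyMeasurable.pow ?_ 2)
      exact (hf.aestronglyMeasurable.comp_quasiMeasurePreserving
        (quasiMeasurePreserving_add volume volume)).sub hf.aestronglyMeasurable.comp_fst
    refine (integrable_prod_iff' hmeas).2 ⟨Eventually.of_forall fun h => ?_, ?_⟩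
    · exact (intervalIntegrable_iff.1 (hi (hsub h).sq 0 1))
    · have : IsFiniteMeasure (volume.restrict (Set.uIoc (0 : ℝ) ε)) := by
        rw [Set.uIoc]; infer_instance
      refine Integrable.of_bound (C := K)
        hmeas.norm.prod_swap.integral_prod_right' ?_
      filter_upwards [ae_restrict_mem measurableSet_uIoc] with h hh
      rw [Set.uIoc_of_le hε.le] at hh
      have h1 := hfm.integral_le h ⟨hh.1.le, hh.2.trans hε1⟩
      have h2 : h ^ b ≤ 1 := Real.rpow_le_one hh.1.le (hh.2.trans hε1) hfm.pos.le
      rw [Set.uIoc_of_le zero_le_one, ← intervalIntegral.integral_of_le zero_le_one]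
      simp only [Function.uncurry_apply_pair, norm_pow, Real.norm_eq_abs, sq_abs]
      rw [abs_of_nonneg (intervalIntegral.integral_nonneg zero_le_one fun _ _ => sq_nonneg _)]
      nlinarith [hfm.nonneg]
  have hprod' := hprod
  rw [IntegrableOn, Measure.volume_eq_prod, ← Measure.prod_restrict] at hprod'
  calc ∫ x in (0 : ℝ)..1, (f x - g x) ^ 2
      ≤ ∫ x in (0 : ℝ)..1, ε⁻¹ * ∫ h in (0 : ℝ)..ε, (f (x + h) - f x) ^ 2 := by
        refine intervalIntegral.integral_mono_on zero_le_one (hi (hf.sub hg).sq _ _)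
          (IntervalIntegrable.const_mul ?_ _) fun x _ => hpt x
        rw [intervalIntegrable_iff]
        simpa only [IntegrableOn, Function.uncurry_apply_pair, Set.uIoc_of_le hε.le,
          intervalIntegral.integral_of_le hε.le] using hprod'.integral_prod_left
    _ = ε⁻¹ * ∫ h in (0 : ℝ)..ε, ∫ x in (0 : ℝ)..1, (f (x + h) - f x) ^ 2 := by
        rw [intervalIntegral.integral_const_mul, intervalIntegral_intervalIntegral_swap hprod]
    _ ≤ ε⁻¹ * ∫ h in (0 : ℝ)..ε, K * ε ^ b := by
        gcongr
        refine intervalIntegral.integral_mono_on hε.le ?_ intervalIntegrable_const fun h hh => ?_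
        · rw [intervalIntegrable_iff]
          simpa only [IntegrableOn, Function.uncurry_apply_pair, Set.uIoc_of_le (zero_le_one' ℝ),
            intervalIntegral.integral_of_le (zero_le_one' ℝ)] using hprod'.integral_prod_right
        · refine (hfm.integral_le h ⟨hh.1, hh.2.trans hε1⟩).trans ?_
          have := hfm.nonneg
          gcongr
          · exact hh.1
          · exact hfm.pos.le
          · exact hh.2
    _ = K * ε ^ b := by
        rw [intervalIntegral.integral_const, smul_eq_mul, sub_zero]
        field_simp

/-! ### Affine changes of variables -/

lemma quasiMeasurePreserving_affine {a : ℝ} (ha : a ≠ 0) (b : ℝ) :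
    Measure.QuasiMeasurePreserving (fun t : ℝ => a * t + b) volume volume := by
  have h1 : Measure.QuasiMeasurePreserving (fun t : ℝ => a * t) volume volume := by
    refine ⟨by fun_prop, ?_⟩
    rw [Real.map_volume_mul_left ha]
    exact Measure.smul_absolutelyContinuous
  exact (measurePreserving_add_right volume b).quasiMeasurePreserving.comp h1

lemma locallyIntegrable_comp_affine {f : ℝ → ℝ} (hf : LocallyIntegrable f volume) {a : ℝ}
    (ha : a ≠ 0) (b : ℝ) : LocallyIntegrable (fun t => f (a * t + b)) volume :=
  locallyIntegrable_of_intervalIntegrable fun x y => by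
    have := (locallyIntegrable_intervalIntegrable (locallyIntegrable_comp_add_right hf b)
      (a * x) (a * y)).comp_mul_left (c := a)
    simpa [ha] using this

lemma integral_comp_affine (g : ℝ → ℝ) (a b : ℝ) :
    ∫ t, g (a * t + b) = |a|⁻¹ * ∫ x, g x := by
  rw [Measure.integral_comp_mul_left (fun x => g (x + b)), integral_add_right_eq_self, abs_inv,
    smul_eq_mul]

lemma IsPrimitive.comp_affine {F f : ℝ → ℝ} (hF : IsPrimitive F f) {a : ℝ} (ha : a ≠ 0) (b : ℝ) :
    IsPrimitive (fun t => a⁻¹ * F (a * t + b)) fun t => f (a * t + b) :=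
  ⟨locallyIntegrable_comp_affine hF.locallyIntegrable ha b, fun x y => by
    rw [intervalIntegral.integral_comp_mul_add _ ha, ← hF.sub_eq, smul_eq_mul, mul_sub]⟩

lemma integral_comp_affine_le {G : ℝ → ℝ} (hG : LocallyIntegrable G volume) (h0 : ∀ t, 0 ≤ G t)
    (hp : Function.Periodic G 1) {a : ℝ} (ha : 0 < a) (ha1 : a ≤ 1) (b x : ℝ) (n : ℕ) :
    ∫ t in x..(x + n), G (a * t + b) ≤ a⁻¹ * (n * ∫ t in (0 : ℝ)..1, G t) := by
  have hi := locallyIntegrable_intervalIntegrable hG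
  rw [intervalIntegral.integral_comp_mul_add _ ha.ne', smul_eq_mul]
  gcongr
  have hn : (0 : ℝ) ≤ n := n.cast_nonneg
  calc ∫ t in (a * x + b)..(a * (x + n) + b), G t
      ≤ ∫ t in (a * x + b)..(a * x + b + n), G t :=
        intervalIntegral_le_of_subinterval hG h0 le_rfl (by nlinarith) (by nlinarith)
    _ = _ := by
        have h := hp.intervalIntegral_add_zsmul_eq n (a * x + b) hi
        rw [hp.intervalIntegral_add_eq (a * x + b) 0] at h
        simpa using h

/-! ### Perturbation of the frequency -/

lemma IsSqPeriodic.comp_affine {f : ℝ → ℝ} (hf : IsSqPeriodic f) {a : ℝ} (ha : a ≠ 0) (b : ℝ) :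
    AEStronglyMeasurable (fun t => f (a * t + b)) volume ∧
      LocallyIntegrable (fun t => f (a * t + b) ^ 2) volume :=
  ⟨hf.aestronglyMeasurable.comp_quasiMeasurePreserving (quasiMeasurePreserving_affine ha b),
    locallyIntegrable_comp_affine hf.sq ha b⟩

lemma locallyIntegrable_add_sq {f g : ℝ → ℝ} (hf : AEStronglyMeasurable f volume)
    (hg : AEStronglyMeasurable g volume) (hf2 : LocallyIntegrable (fun x => f x ^ 2) volume)
    (hg2 : LocallyIntegrable (fun x => g x ^ 2) volume) :
    LocallyIntegrable (fun x => (f x + g x) ^ 2) volume :=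
  ((hf2.add ((locallyIntegrable_mul_of_sq hf hg hf2 hg2).smul (2 : ℝ))).add hg2).congr
    (Eventually.of_forall fun x => by
      simp only [Pi.add_apply, Pi.smul_apply, smul_eq_mul]; ring)

/-- Replacing the frequency `α` by `β` in `f(αt + θ)`: the Steklov averages `g` of `f` are compared
with `f` at both frequencies, and `g(αt + θ)` with `g(βt + θ)` by continuity. -/
lemma HasHolderModulus.exists_integral_sq_sub_le {f : ℝ → ℝ} {K b : ℝ} (hf : IsSqPeriodic f)
    (hfm : HasHolderModulus f K b) : ∃ M : ℝ, 0 ≤ M ∧ ∀ (α β θ ε : ℝ) (N : ℕ), 0 < α → α ≤ 1 →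
      0 < β → β ≤ 1 → 0 < ε → ε ≤ 1 → |α - β| * (2 * N) ≤ 1 →
      ∫ t in (-N : ℝ)..(2 * N), (f (α * t + θ) - f (β * t + θ)) ^ 2
        ≤ 9 * N * ((α⁻¹ + β⁻¹) * (K * ε ^ b)) + 9 * N * ((M / ε) ^ 2 * (|α - β| * (2 * N))) := by
  have hi := @locallyIntegrable_intervalIntegrable ℝ _
  obtain ⟨M, hM0, hM⟩ := hfm.exists_approximation hf
  refine ⟨M, hM0, fun α β θ ε N hα hα1 hβ hβ1 hε hε1 hN => ?_⟩
  obtain ⟨g, hg, hgc, hfg⟩ := hM ε hε hε1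
  have hN0 : (0 : ℝ) ≤ N := N.cast_nonneg
  have hd : IsSqPeriodic fun x => f x - g x := hf.sub hg
  have hdper : Function.Periodic (fun x => (f x - g x) ^ 2) 1 := fun x => by
    simp only [hf.periodic x, hg.periodic x]
  have hdα := locallyIntegrable_comp_affine hd.sq hα.ne' θ
  have hdβ := locallyIntegrable_comp_affine hd.sq hβ.ne' θ
  have hbound : ∀ {a : ℝ}, 0 < a → a ≤ 1 →
      ∫ t in (-N : ℝ)..(2 * N), (f (a * t + θ) - g (a * t + θ)) ^ 2
        ≤ a⁻¹ * (3 * N * (K * ε ^ b)) := fun {a} ha ha1 => by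
    have h := integral_comp_affine_le hd.sq (fun _ => sq_nonneg _) hdper ha ha1 θ (-N) (3 * N)
    have h1 : (-N : ℝ) + ((3 * N : ℕ) : ℝ) = 2 * N := by push_cast; ring
    rw [h1] at h
    refine h.trans ?_
    push_cast
    gcongr
  have hint : LocallyIntegrable (fun t => (f (α * t + θ) - f (β * t + θ)) ^ 2) volume := by
    have h1 := hf.comp_affine hα.ne' θ
    have h2 := hf.comp_affine hβ.ne' θ
    simpa only [sub_eq_add_neg, Pi.neg_apply] using
      locallyIntegrable_add_sq h1.1 h2.1.neg h1.2 (by simpa only [Pi.neg_apply, neg_sq] using h2.2)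
  calc ∫ t in (-N : ℝ)..(2 * N), (f (α * t + θ) - f (β * t + θ)) ^ 2
      ≤ ∫ t in (-N : ℝ)..(2 * N), (3 * (f (α * t + θ) - g (α * t + θ)) ^ 2
          + 3 * (f (β * t + θ) - g (β * t + θ)) ^ 2
          + 3 * ((M / ε) ^ 2 * (|α - β| * (2 * N)))) := by
        refine intervalIntegral.integral_mono_on (by linarith) (hi hint _ _)
          ((((hi hdα _ _).const_mul 3).add ((hi hdβ _ _).const_mul 3)).add intervalIntegrable_const)
          fun t ht => ?_
        have ht2 : |t| ≤ 2 * N := abs_le.2 ⟨by linarith [ht.1], ht.2⟩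
        have h1 : |α * t + θ - (β * t + θ)| ≤ |α - β| * (2 * N) := by
          rw [add_sub_add_right_eq_sub, ← sub_mul, abs_mul]
          gcongr
        have h2 := hgc _ _ (h1.trans hN)
        have h3 : (g (α * t + θ) - g (β * t + θ)) ^ 2 ≤ (M / ε) ^ 2 * (|α - β| * (2 * N)) := by
          rw [← sq_abs]
          refine (pow_le_pow_left₀ (abs_nonneg _) h2 2).trans ?_
          rw [mul_pow, Real.sq_sqrt (abs_nonneg _)]
          gcongr
        set x := f (α * t + θ) - g (α * t + θ)
        set y := f (β * t + θ) - g (β * t + θ)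
        set z := g (α * t + θ) - g (β * t + θ)
        have h4 : f (α * t + θ) - f (β * t + θ) = x - y + z := by simp only [x, y, z]; ring
        rw [h4]
        nlinarith [sq_nonneg (x + y), sq_nonneg (x - z), sq_nonneg (y + z)]
    _ ≤ _ := by
        rw [intervalIntegral.integral_add (((hi hdα _ _).const_mul 3).add
          ((hi hdβ _ _).const_mul 3)) intervalIntegrable_const,
          intervalIntegral.integral_add ((hi hdα _ _).const_mul 3) ((hi hdβ _ _).const_mul 3),
          intervalIntegral.integral_const_mul, intervalIntegral.integral_const_mul,
          intervalIntegral.integral_const, smul_eq_mul]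
        have h1 := hbound hα hα1
        have h2 := hbound hβ hβ1
        nlinarith

/-! ### Uniform local integrability of quasiperiodic functions -/

lemma eLpNorm_two_eq {f : ℝ → ℝ} (hf : AEStronglyMeasurable f volume)
    (hf2 : LocallyIntegrable (fun x => f x ^ 2) volume) {a b : ℝ} (hab : a ≤ b) :
    eLpNorm f 2 (volume.restrict (Set.Icc a b)) = ENNReal.ofReal (√(∫ x in a..b, f x ^ 2)) := by
  rw [← restrict_Ioc_eq_restrict_Icc]
  have hm : MemLp f 2 (volume.restrict (Set.Ioc a b)) :=
    (memLp_two_iff_integrable_sq hf.restrict).2 (locallyIntegrable_intervalIntegrable hf2 a b).1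
  have h := integral_norm_sq_eq (μ := volume.restrict (Set.Ioc a b)) hf.restrict
  simp only [Real.norm_eq_abs, sq_abs] at h
  rw [intervalIntegral.integral_of_le hab, h, Real.sqrt_sq ENNReal.toReal_nonneg,
    ENNReal.ofReal_toReal hm.2.ne]

lemma memLpUnif_two_of_integral_le {f : ℝ → ℝ} (hf : AEStronglyMeasurable f volume)
    (hf2 : LocallyIntegrable (fun x => f x ^ 2) volume) {K : ℝ}
    (hK : ∀ t, ∫ x in t..(t + 1), f x ^ 2 ≤ K) : MemLpUnif 2 f := by
  refine ⟨hf, (iSup_le fun t => ?_).trans_lt (ENNReal.ofReal_lt_top (r := √K))⟩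
  rw [eLpNorm_two_eq hf hf2 (by linarith)]
  gcongr
  exact hK t

lemma memLpUnif_one_of_periodic {f : ℝ → ℝ} (hf : LocallyIntegrable f volume)
    (hp : Function.Periodic f 1) : MemLpUnif 1 f := by
  refine ⟨hf.aestronglyMeasurable, (iSup_le fun t => ?_).trans_lt
    (ENNReal.ofReal_lt_top (r := ∫ x in (0 : ℝ)..1, ‖f x‖))⟩
  have h := Function.Periodic.intervalIntegral_add_eq (f := fun x => ‖f x‖) (T := 1)
    (fun x => by simp only [hp x]) t 0
  rw [zero_add] at h
  have hm := memLp_one_iff_integrable.2 (locallyIntegrable_intervalIntegrable hf t (t + 1)).1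
  rw [← restrict_Ioc_eq_restrict_Icc, ← h, intervalIntegral.integral_of_le (by linarith),
    integral_norm_eq_toReal_eLpNorm hf.aestronglyMeasurable.restrict, ENNReal.ofReal_toReal hm.2.ne]

lemma memLpUnif_two_add_comp_affine {f g : ℝ → ℝ} (hf : IsSqPeriodic f) (hg : IsSqPeriodic g)
    {a : ℝ} (ha : 0 < a) (ha1 : a ≤ 1) (b : ℝ) : MemLpUnif 2 fun t => f t + g (a * t + b) := by
  have hi := @locallyIntegrable_intervalIntegrable ℝ _
  have hga := hg.comp_affine ha.ne' b
  have hsq := locallyIntegrable_add_sq hf.aestronglyMeasurable hga.1 hf.sq hga.2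
  refine memLpUnif_two_of_integral_le (hf.aestronglyMeasurable.add hga.1) hsq
    (K := 2 * (∫ x in (0 : ℝ)..1, f x ^ 2) + 2 * (a⁻¹ * ∫ x in (0 : ℝ)..1, g x ^ 2)) fun t => ?_
  have h := integral_comp_affine_le hg.sq (fun _ => sq_nonneg _)
    (fun x => by simp only [hg.periodic x]) ha ha1 b t 1
  rw [Nat.cast_one, one_mul] at h
  have h' := hf.integral_sq_le (le_add_of_nonneg_right zero_le_one) (le_refl (t + 1))
  calc ∫ x in t..(t + 1), (f x + g (a * x + b)) ^ 2
      ≤ ∫ x in t..(t + 1), (2 * f x ^ 2 + 2 * g (a * x + b) ^ 2) := by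
        refine intervalIntegral.integral_mono_on (by linarith) (hi hsq _ _)
          (((hi hf.sq _ _).const_mul 2).add ((hi hga.2 _ _).const_mul 2)) fun x _ => ?_
        nlinarith [sq_nonneg (f x - g (a * x + b))]
    _ ≤ _ := by
        rw [intervalIntegral.integral_add ((hi hf.sq _ _).const_mul 2)
          ((hi hga.2 _ _).const_mul 2), intervalIntegral.integral_const_mul,
          intervalIntegral.integral_const_mul]
        linarith

/-! ### A decomposition of the quasiperiodic potential -/

lemma compAffine_distDeriv_ofFun_apply {f : ℝ → ℝ} (hf : LocallyIntegrable f volume) {a : ℝ}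
    (ha : 0 < a) (b : ℝ) (ψ : Test) :
    compAffine a b (distDeriv (ofFun f)) ψ = -∫ t, deriv ψ t * (a⁻¹ * f (a * t + b)) := by
  have h1 : compAffine a b (distDeriv (ofFun f)) ψ
      = |a|⁻¹ * distDeriv (ofFun f) (testAffine a b ha.ne' ψ) := by
    rw [compAffine, dif_pos ha.ne']
    rfl
  have h2 : ∀ x, deriv (testAffine a b ha.ne' ψ) x = deriv ψ ((x - b) / a) * a⁻¹ := fun x => by
    have h3 : HasDerivAt (fun x => (x - b) / a) a⁻¹ x := by
      simpa using ((hasDerivAt_id x).sub_const b).div_const a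
    exact ((Test.hasDerivAt ψ _).comp x h3).deriv
  have h4 := integral_comp_affine (fun x => deriv ψ ((x - b) / a) * a⁻¹ * f x) a b
  rw [h1, distDeriv_ofFun_apply hf, mul_neg]
  simp only [h2]
  rw [← h4]
  congr 1
  refine integral_congr_ae (Eventually.of_forall fun t => ?_)
  simp only [add_sub_cancel_right, mul_div_cancel_left₀ t ha.ne', mul_assoc]

/-- The part `τ₂(αt + θ)` of the potential is, up to the mean value `c` of `τ₂`, the derivative of
`α⁻¹ ρ(αt + θ)` with a periodic function `ρ`. -/
lemma quasiPotential_eq {σ₁ σ₂ τ₁ τ₂ ρ : ℝ → ℝ} {α c : ℝ} (θ : ℝ) (hα : 0 < α)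
    (hσ₁ : LocallyIntegrable σ₁ volume) (hσ₂ : LocallyIntegrable σ₂ volume)
    (hτ₁ : LocallyIntegrable τ₁ volume) (hτ₂ : LocallyIntegrable τ₂ volume)
    (hρ : IsPrimitive ρ fun t => τ₂ t - c) :
    quasiPotential σ₁ σ₂ τ₁ τ₂ α θ
      = distDeriv (ofFun fun t => σ₁ t + α⁻¹ * (σ₂ (α * t + θ) + ρ (α * t + θ)))
        + ofFun fun t => τ₁ t + c := by
  have hσ₂' := (locallyIntegrable_comp_affine hσ₂ hα.ne' θ).smul α⁻¹
  have hτ₂' := locallyIntegrable_comp_affine hτ₂ hα.ne' θ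
  have hρ' := hρ.comp_affine hα.ne' θ
  have hρl := hρ'.continuous.locallyIntegrable (μ := volume)
  have hσ : LocallyIntegrable (fun t => σ₁ t + α⁻¹ * (σ₂ (α * t + θ) + ρ (α * t + θ))) volume :=
    (hσ₁.add (hσ₂'.add hρl)).congr (Eventually.of_forall fun t => by
      simp only [Pi.add_apply, Pi.smul_apply, smul_eq_mul, mul_add])
  have hc : LocallyIntegrable (fun _ : ℝ => c) volume := locallyIntegrable_const c
  have hτ : LocallyIntegrable (fun t => τ₁ t + c) volume := hτ₁.add hc
  ext ψ
  have hder : ∀ {u : ℝ → ℝ} (_ : LocallyIntegrable u volume),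
      Integrable fun x => deriv ψ x * u x := fun hu =>
    hu.integrable_smul_left_of_hasCompactSupport (Test.continuous_deriv ψ)
      ψ.hasCompactSupport.deriv
  have hI : ∀ {u : ℝ → ℝ} (_ : LocallyIntegrable u volume), Integrable fun x => ψ x * u x :=
    fun hu => integrable_test_smul hu ψ
  change distDeriv (ofFun σ₁) ψ + compAffine α θ (distDeriv (ofFun σ₂)) ψ + ofFun τ₁ ψ
    + ofFun (fun t => τ₂ (α * t + θ)) ψ = distDeriv (ofFun _) ψ + ofFun _ ψ
  rw [distDeriv_ofFun_apply hσ₁, compAffine_distDeriv_ofFun_apply hσ₂ hα, ofFun_apply hτ₁,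
    ofFun_apply hτ₂', distDeriv_ofFun_apply hσ, ofFun_apply hτ]
  have h1 : ∫ x, deriv ψ x * (α⁻¹ * ρ (α * x + θ)) = -∫ x, ψ x * (τ₂ (α * x + θ) - c) :=
    hρ'.integral_deriv_test ψ
  simp only [mul_add, mul_sub] at h1 ⊢
  rw [integral_sub (hI hτ₂') (hI hc)] at h1
  have hσ₂i := hder hσ₂'
  simp only [Pi.smul_apply, smul_eq_mul] at hσ₂i
  have hsum : Integrable fun x => deriv ψ x * (α⁻¹ * σ₂ (α * x + θ))
      + deriv ψ x * (α⁻¹ * ρ (α * x + θ)) := hσ₂i.add (hder hρl)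
  rw [integral_add (hder hσ₁) hsum, integral_add hσ₂i (hder hρl), h1,
    integral_add (hI hτ₁) (hI hc)]
  ring

/-! ### Rational approximation of the frequency -/

/-- Rationals with bounded denominators keep a positive distance from an irrational number. -/
lemma exists_pos_le_abs_sub_div {α : ℝ} (hα : Irrational α) (B : ℕ) :
    ∃ d : ℝ, 0 < d ∧ ∀ q : ℕ, 0 < q → q < B → ∀ r : ℤ, d ≤ |α - r / q| := by
  induction B with
  | zero => exact ⟨1, one_pos, fun q _ hq => absurd hq (Nat.not_lt_zero q)⟩
  | succ B ih =>
    obtain ⟨d, hd, h⟩ := ih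
    rcases Nat.eq_zero_or_pos B with rfl | hB
    · exact ⟨d, hd, fun q hq hq1 => absurd hq1 (by omega)⟩
    have hB' : (0 : ℝ) < B := by exact_mod_cast hB
    have hpos : 0 < |α * B - round (α * B)| := by
      rw [abs_pos, sub_ne_zero]
      exact (hα.mul_natCast hB.ne').ne_int _
    refine ⟨min d (|α * B - round (α * B)| / B), lt_min hd (by positivity),
      fun q hq hqB r => ?_⟩
    rcases Nat.lt_succ_iff_lt_or_eq.1 hqB with hlt | rfl
    · exact (min_le_left _ _).trans (h q hq hlt r)
    · refine (min_le_right _ _).trans ?_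
      rw [div_le_iff₀ hB']
      refine (round_le _ r).trans_eq ?_
      rw [← abs_of_pos hB', ← abs_mul, abs_of_pos hB', sub_mul, div_mul_cancel₀ _ hB'.ne']

lemma tendsto_denominators {α C : ℝ} (hα : Irrational α) {R : ℕ → ℤ} {T : ℕ → ℕ}
    (h : ∀ m : ℕ, 1 ≤ m → 0 < T m ∧ |α - (R m : ℝ) / (T m : ℝ)| ≤ C / (m : ℝ)) :
    Tendsto T atTop atTop := by
  refine tendsto_atTop.2 fun B => ?_
  obtain ⟨d, hd, hB⟩ := exists_pos_le_abs_sub_div hα B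
  have hC : Tendsto (fun m : ℕ => C / (m : ℝ)) atTop (𝓝 0) :=
    tendsto_const_nhds.div_atTop tendsto_natCast_atTop_atTop
  filter_upwards [hC.eventually_lt_const hd, eventually_ge_atTop 1] with m hm hm1
  by_contra! hlt
  have := hB (T m) (h m hm1).1 hlt (R m)
  linarith [(h m hm1).2]

/-! ### The Gordon property of the quasiperiodic potential -/

/-- A squared distance of order `(T n * n ^ (-κ T n))²` is negligible against every exponential of
`T n`, because `κ log n` exceeds every constant. -/
lemma tendsto_exp_mul_sqrt {A κ : ℝ} (hA : 0 ≤ A) (hκ : 0 < κ) {T : ℕ → ℕ}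
    (hT : Tendsto T atTop atTop) {D : ℕ → ℝ}
    (hD : ∀ᶠ n : ℕ in atTop, D n ≤ (A * T n * Real.exp (-(κ * (T n * Real.log n)))) ^ 2) (C : ℝ) :
    Tendsto (fun n => Real.exp (C * T n) * √(D n)) atTop (𝓝 0) := by
  have hTr : Tendsto (fun n => (T n : ℝ)) atTop atTop := tendsto_natCast_atTop_atTop.comp hT
  have hlim : Tendsto (fun n => A * Real.exp (-(T n : ℝ))) atTop (𝓝 0) := by
    simpa using (Real.tendsto_exp_neg_atTop_nhds_zero.comp hTr).const_mul A
  have hlog : Tendsto (fun n : ℕ => κ * Real.log n) atTop atTop :=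
    (Real.tendsto_log_atTop.comp tendsto_natCast_atTop_atTop).const_mul_atTop hκ
  refine squeeze_zero' (Eventually.of_forall fun n => by positivity) ?_ hlim
  filter_upwards [hD, hlog.eventually_ge_atTop (C + 2)] with n hn hl
  have hT0 : (0 : ℝ) ≤ T n := Nat.cast_nonneg _
  have h1 : √(D n) ≤ A * T n * Real.exp (-(κ * (T n * Real.log n))) :=
    Real.sqrt_le_iff.2 ⟨by positivity, hn⟩
  have h2 : (T n : ℝ) ≤ Real.exp (T n) := by linarith [Real.add_one_le_exp (T n : ℝ)]
  calc Real.exp (C * T n) * √(D n)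
      ≤ Real.exp (C * T n) * (A * Real.exp (T n) * Real.exp (-(κ * (T n * Real.log n)))) := by
        gcongr
        exact h1.trans (by gcongr)
    _ = A * Real.exp (C * T n + T n + -(κ * (T n * Real.log n))) := by
        rw [Real.exp_add, Real.exp_add]; ring
    _ ≤ A * Real.exp (-(T n : ℝ)) := by
        gcongr
        nlinarith

/-- A decomposition with a quasiperiodic part `f(αt + θ)` becomes periodic with period `T n` when
`α` is replaced by `R n / T n`. -/
lemma isSingularGordon_of_hasHolderModulus {q : Distr} {σ₁ f τ : ℝ → ℝ} {α θ K b : ℝ}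
    (hσ₁ : IsSqPeriodic σ₁) (hf : IsSqPeriodic f) (hfm : HasHolderModulus f K b)
    (hτ : LocallyIntegrable τ volume) (pτ : Function.Periodic τ 1) (hα0 : 0 < α) (hα1 : α < 1)
    (hL : IsLiouvilleNumber α)
    (hq : q = distDeriv (ofFun fun t => σ₁ t + α⁻¹ * f (α * t + θ)) + ofFun τ) :
    IsSingularGordon q := by
  obtain ⟨hirr, C, R, T, hRT⟩ := hL
  obtain ⟨M, hM0, hM⟩ := hfm.exists_integral_sq_sub_le hf
  have hK := hfm.nonneg
  have hC : 0 ≤ C := by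
    have h := (abs_nonneg _).trans (hRT 1 le_rfl).2
    simpa using h
  set β : ℕ → ℝ := fun n => (R n : ℝ) / (T n : ℝ)
  have hRT1 : ∀ m : ℕ, 1 ≤ m → 0 < T m ∧ |α - (R m : ℝ) / (T m : ℝ)| ≤ C / (m : ℝ) := by
    intro m hm
    refine ⟨(hRT m hm).1, (hRT m hm).2.trans ?_⟩
    have hm' : (1 : ℝ) ≤ m := by exact_mod_cast hm
    gcongr
    exact le_self_pow₀ hm' (hRT m hm).1.ne'
  have hT : Tendsto T atTop atTop := tendsto_denominators hirr hRT1
  have hTr : Tendsto (fun n => (T n : ℝ)) atTop atTop := tendsto_natCast_atTop_atTop.comp hT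
  have hβ : Tendsto β atTop (𝓝 α) := by
    have h0 : Tendsto (fun m : ℕ => C / (m : ℝ)) atTop (𝓝 0) :=
      tendsto_const_nhds.div_atTop tendsto_natCast_atTop_atTop
    rw [tendsto_iff_dist_tendsto_zero]
    refine squeeze_zero' (Eventually.of_forall fun _ => dist_nonneg) ?_ h0
    filter_upwards [eventually_ge_atTop 1] with m hm
    rw [dist_comm, Real.dist_eq]
    exact (hRT1 m hm).2
  obtain ⟨n₀, hn₀⟩ := eventually_atTop.1 (((hβ.eventually_const_lt (half_lt_self hα0)).and
    (hβ.eventually_lt_const hα1)).and (eventually_ge_atTop 1))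
  have hβ0 : ∀ n, n₀ ≤ n → 0 < β n := fun n hn => (half_pos hα0).trans (hn₀ n hn).1.1
  have hfα := hf.comp_affine hα0.ne' θ
  set D : ℕ → ℝ := fun n =>
    ∫ t in (-T n : ℝ)..(2 * T n), (α⁻¹ * f (α * t + θ) - α⁻¹ * f (β n * t + θ)) ^ 2
  set κ : ℝ := min (b / 4) (1 / 2) / 2
  have hb := hfm.pos
  have hκ : 0 < κ := by positivity
  have hκ1 : 2 * κ ≤ b / 4 := by
    have := min_le_left (b / 4) (1 / 2 : ℝ)
    simp only [κ]; linarith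
  have hκ2 : 2 * κ ≤ 1 / 2 := by
    have := min_le_right (b / 4) (1 / 2 : ℝ)
    simp only [κ]; linarith
  set B : ℝ := α⁻¹ ^ 2 * (27 * α⁻¹ * K + 18 * M ^ 2 * C)
  have hB : 0 ≤ B := by positivity
  have hD : ∀ᶠ n : ℕ in atTop,
      D n ≤ (√B * T n * Real.exp (-(κ * (T n * Real.log n)))) ^ 2 := by
    have hlog : Tendsto (fun n : ℕ => Real.log n) atTop atTop :=
      Real.tendsto_log_atTop.comp tendsto_natCast_atTop_atTop
    have hsmall : Tendsto (fun n => 2 * C * Real.exp (-(T n : ℝ))) atTop (𝓝 0) := by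
      simpa using (Real.tendsto_exp_neg_atTop_nhds_zero.comp hTr).const_mul (2 * C)
    filter_upwards [hsmall.eventually_lt_const one_pos, hlog.eventually_ge_atTop 2,
      eventually_ge_atTop n₀] with n hn hl hnn
    obtain ⟨⟨hβα, hβ1⟩, hn1⟩ := hn₀ n hnn
    have hT1 : (1 : ℝ) ≤ T n := by exact_mod_cast (hRT n hn1).1
    have hT0 : (0 : ℝ) ≤ T n := zero_le_one.trans hT1
    set L := Real.log n
    have hnpos : (0 : ℝ) < n := by exact_mod_cast hn1
    have hδ : |α - β n| ≤ C * Real.exp (-(T n * L)) := by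
      refine (hRT n hn1).2.trans_eq ?_
      rw [Real.exp_neg, Real.exp_nat_mul, Real.exp_log hnpos, div_eq_mul_inv]
    have hle : T n ≤ Real.exp (T n) := by linarith [Real.add_one_le_exp (T n : ℝ)]
    have hδ1 : |α - β n| * (2 * T n) ≤ 1 := by
      calc _ ≤ C * Real.exp (-(T n * L)) * (2 * Real.exp (T n)) := by gcongr
        _ = 2 * C * Real.exp (-(T n * L) + T n) := by rw [Real.exp_add]; ring
        _ ≤ 2 * C * Real.exp (-(T n : ℝ)) := by gcongr; nlinarith
        _ ≤ 1 := hn.le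
    set E := Real.exp (-(κ * (T n * L))) ^ 2
    have hTL : 0 ≤ T n * L := by positivity
    have hE : E = Real.exp (-(2 * κ * (T n * L))) := by
      simp only [E, ← Real.exp_nat_mul]
      congr 1; push_cast; ring
    -- The scale of the Steklov averages which balances the two error terms.
    set ε := Real.exp (-(T n * L / 4))
    have hε : 0 < ε := Real.exp_pos _
    have hεb : ε ^ b ≤ E := by
      rw [hE, ← Real.exp_mul]
      gcongr
      nlinarith
    have hεδ : (M / ε) ^ 2 * |α - β n| ≤ M ^ 2 * C * E := by
      have h1 : (M / ε) ^ 2 = M ^ 2 * Real.exp (T n * L / 2) := by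
        rw [div_pow, div_eq_mul_inv, ← Real.exp_nat_mul, ← Real.exp_neg]
        congr 2; push_cast; ring
      calc _ ≤ M ^ 2 * Real.exp (T n * L / 2) * (C * Real.exp (-(T n * L))) := by
            rw [h1]; gcongr
        _ = M ^ 2 * C * Real.exp (T n * L / 2 + -(T n * L)) := by rw [Real.exp_add]; ring
        _ ≤ M ^ 2 * C * E := by
            rw [hE]
            gcongr
            nlinarith
    have hβinv : (β n)⁻¹ ≤ 2 * α⁻¹ := by
      rw [← inv_inv (2 * α⁻¹)]
      gcongr
      rw [mul_inv, inv_inv]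
      linarith
    have hε1 : ε ≤ 1 := Real.exp_le_one_iff.2 (by linarith)
    have hI := hM α (β n) θ ε (T n) hα0 hα1.le (hβ0 n hnn) hβ1.le hε hε1 hδ1
    have hDn : D n = α⁻¹ ^ 2 *
        ∫ t in (-T n : ℝ)..(2 * T n), (f (α * t + θ) - f (β n * t + θ)) ^ 2 := by
      rw [← intervalIntegral.integral_const_mul]
      refine intervalIntegral.integral_congr fun t _ => ?_
      ring
    have hE0 : 0 ≤ E := by positivity
    rw [hDn, mul_pow, mul_pow, Real.sq_sqrt hB]
    calc _ ≤ α⁻¹ ^ 2 * (9 * T n * ((α⁻¹ + 2 * α⁻¹) * (K * E))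
            + 9 * T n * (M ^ 2 * C * E * (2 * T n))) := by
          refine mul_le_mul_of_nonneg_left (hI.trans ?_) (by positivity)
          rw [← mul_assoc ((M / ε) ^ 2)]
          gcongr
      _ = α⁻¹ ^ 2 * (27 * α⁻¹ * K * T n * E + 18 * M ^ 2 * C * (T n) ^ 2 * E) := by ring
      _ ≤ α⁻¹ ^ 2 * (27 * α⁻¹ * K * (T n) ^ 2 * E + 18 * M ^ 2 * C * (T n) ^ 2 * E) := by
          gcongr
          exact le_self_pow₀ hT1 two_ne_zero
      _ = _ := by simp only [B, E]; ring
  have hcoef : ∀ {a : ℝ}, 0 < a → a ≤ 1 → MemLpUnif 2 fun t => σ₁ t + α⁻¹ * f (a * t + θ) :=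
    fun ha ha1 => memLpUnif_two_add_comp_affine hσ₁ (hf.const_mul α⁻¹) ha ha1 θ
  have hshift : Tendsto (fun m => m + n₀) atTop atTop := tendsto_add_atTop_nat n₀
  have hge : ∀ m, n₀ ≤ m + n₀ := fun m => Nat.le_add_left _ _
  have hT1 : ∀ m, 0 < T (m + n₀) := fun m => (hRT _ (hn₀ _ (hge m)).2).1
  have hτu := memLpUnif_one_of_periodic hτ pτ
  refine ⟨_, τ, ⟨hcoef hα0 hα1.le, hτu, hq⟩, fun m => T (m + n₀),
    fun m t => σ₁ t + α⁻¹ * f (β (m + n₀) * t + θ), fun _ => τ,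
    fun m => Nat.cast_pos.2 (hT1 m), hTr.comp hshift, fun m => ⟨?_, fun t => ?_⟩,
    fun m => ⟨hτu, ?_⟩, fun C' => ?_⟩
  · exact hcoef (hβ0 _ (hge m)) (hn₀ _ (hge m)).1.2.le
  · have h1 : β (m + n₀) * (t + T (m + n₀)) + θ = β (m + n₀) * t + θ + R (m + n₀) * 1 := by
      have : (T (m + n₀) : ℝ) ≠ 0 := by exact_mod_cast (hT1 m).ne'
      simp only [β]
      field_simp
      ring
    have h2 := hσ₁.periodic.nat_mul (T (m + n₀)) t
    rw [mul_one] at h2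
    simp only [h1, h2, hf.periodic.int_mul (R (m + n₀)) _]
  · simpa using pτ.nat_mul (T (m + n₀))
  · have h := ENNReal.tendsto_ofReal
      ((tendsto_exp_mul_sqrt (Real.sqrt_nonneg B) hκ hT hD C').comp hshift)
    rw [ENNReal.ofReal_zero] at h
    refine h.congr fun m => ?_
    have hfβ := hf.comp_affine (hβ0 _ (hge m)).ne' θ
    have hdiff : (fun t => σ₁ t + α⁻¹ * f (α * t + θ))
          - (fun t => σ₁ t + α⁻¹ * f (β (m + n₀) * t + θ))
        = fun t => α⁻¹ * f (α * t + θ) - α⁻¹ * f (β (m + n₀) * t + θ) := by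
      funext t
      simp only [Pi.sub_apply]
      ring
    have hle : (-T (m + n₀) : ℝ) ≤ 2 * T (m + n₀) := by
      have : (0 : ℝ) ≤ T (m + n₀) := Nat.cast_nonneg _
      linarith
    have hsq : LocallyIntegrable
        (fun t => (α⁻¹ * f (α * t + θ) - α⁻¹ * f (β (m + n₀) * t + θ)) ^ 2) volume := by
      have h1 := (hf.const_mul α⁻¹).comp_affine hα0.ne' θ
      have h2 := (hf.const_mul (-α⁻¹)).comp_affine (hβ0 _ (hge m)).ne' θ
      simpa only [sub_eq_add_neg, neg_mul] using locallyIntegrable_add_sq h1.1 h2.1 h1.2 h2.2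
    have hmeas : AEStronglyMeasurable
        (fun t => α⁻¹ * f (α * t + θ) - α⁻¹ * f (β (m + n₀) * t + θ)) volume :=
      (hfα.1.const_mul _).sub (hfβ.1.const_mul _)
    rw [sub_self, eLpNorm_zero, add_zero, hdiff, eLpNorm_two_eq hmeas hsq hle,
      ← ENNReal.ofReal_mul (by positivity)]
    rfl

theorem isSingularGordon_quasiPotential {σ₁ σ₂ τ₁ τ₂ : ℝ → ℝ} {α : ℝ} (θ : ℝ)
    (hσ₁ : MemLpLoc 2 σ₁) (hσ₂ : MemLpLoc 2 σ₂) (hτ₁ : MemLpLoc 1 τ₁) (hτ₂ : MemLpLoc 1 τ₂)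
    (pσ₁ : Function.Periodic σ₁ 1) (pσ₂ : Function.Periodic σ₂ 1)
    (pτ₁ : Function.Periodic τ₁ 1) (pτ₂ : Function.Periodic τ₂ 1)
    (hα : α ∈ Set.Ico (0 : ℝ) 1) (hL : IsLiouvilleNumber α)
    (hs : ∃ s : ℝ, 0 < s ∧ MemSobolevLoc s σ₂) :
    IsSingularGordon (quasiPotential σ₁ σ₂ τ₁ τ₂ α θ) := by
  have hα0 : 0 < α := lt_of_le_of_ne hα.1 (Ne.symm hL.1.ne_zero)
  have hτl : ∀ {τ : ℝ → ℝ}, MemLpLoc 1 τ → LocallyIntegrable τ volume := fun h =>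
    locallyIntegrable_of_unit fun t => (h _ isCompact_Icc).integrable le_rfl
  have hS₁ := IsSqPeriodic.of_memLpLoc hσ₁ pσ₁
  have hS₂ := IsSqPeriodic.of_memLpLoc hσ₂ pσ₂
  -- The periodic primitive `ρ` of `τ₂` minus its mean value `c`.
  obtain ⟨c, hc⟩ : ∃ c, c = ∫ t in (0 : ℝ)..1, τ₂ t := ⟨_, rfl⟩
  have hul : LocallyIntegrable (fun t => τ₂ t - c) volume :=
    (hτl hτ₂).sub (locallyIntegrable_const c)
  have pu : Function.Periodic (fun t => τ₂ t - c) 1 := fun t => by simp only [pτ₂ t]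
  set ρ : ℝ → ℝ := fun x => ∫ t in (0 : ℝ)..x, (τ₂ t - c)
  have hρ : IsPrimitive ρ fun t => τ₂ t - c := IsPrimitive.of_integral hul 0
  have pρ : Function.Periodic ρ 1 := fun x => by
    rw [← sub_eq_zero, hρ.sub_eq, pu.intervalIntegral_add_eq x 0, zero_add,
      intervalIntegral.integral_sub (locallyIntegrable_intervalIntegrable (hτl hτ₂) 0 1)
        intervalIntegrable_const, ← hc]
    simp
  have hSρ := IsSqPeriodic.of_continuous hρ.continuous pρ
  obtain ⟨s, hs0, hs⟩ := hs
  obtain ⟨K₁, b₁, hm₁⟩ := exists_hasHolderModulus_of_memSobolevLoc hs0 hs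
  obtain ⟨K₂, b₂, hm₂⟩ := hρ.exists_hasHolderModulus pu
  exact isSingularGordon_of_hasHolderModulus hS₁ (hS₂.add hSρ) (hm₁.add hS₂ hSρ hm₂)
    ((hτl hτ₁).add (locallyIntegrable_const c)) (fun t => by simp only [Pi.add_apply, pτ₁ t])
    hα0 hα.2 hL (quasiPotential_eq θ hα0 hS₁.locallyIntegrable hS₂.locallyIntegrable (hτl hτ₁)
      (hτl hτ₂) hρ)

end SingularGordon

theorem theorem2 (σ₁ σ₂ τ₁ τ₂ : ℝ → ℝ) (α θ : ℝ)
    (hσ₁ : SingularGordon.MemLpLoc 2 σ₁) (hσ₂ : SingularGordon.MemLpLoc 2 σ₂)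
    (hτ₁ : SingularGordon.MemLpLoc 1 τ₁) (hτ₂ : SingularGordon.MemLpLoc 1 τ₂)
    (pσ₁ : Function.Periodic σ₁ 1) (pσ₂ : Function.Periodic σ₂ 1)
    (pτ₁ : Function.Periodic τ₁ 1) (pτ₂ : Function.Periodic τ₂ 1)
    (hα : α ∈ Set.Ico (0 : ℝ) 1) (hθ : θ ∈ Set.Ico (0 : ℝ) 1)
    (hL : SingularGordon.IsLiouvilleNumber α)
    (hs : ∃ s : ℝ, 0 < s ∧ SingularGordon.MemSobolevLoc s σ₂) :
    SingularGordon.IsSingularGordon (SingularGordon.quasiPotential σ₁ σ₂ τ₁ τ₂ α θ) ∧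
      SingularGordon.pointSpectrum (SingularGordon.quasiPotential σ₁ σ₂ τ₁ τ₂ α θ) = ∅ :=
  have hG := SingularGordon.isSingularGordon_quasiPotential θ hσ₁ hσ₂ hτ₁ hτ₂ pσ₁ pσ₂ pτ₁ pτ₂
    hα hL hs
  ⟨hG, SingularGordon.pointSpectrum_eq_empty hG⟩
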